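/- Write $l^{\beta}(z)=z+\beta$, $l=l^1$, $\sigma(z)=-z$, $\bar f(z)=\overline{f(\bar z)}$, $\check f=\sigma\circ f\circ\sigma$. Let $f(z)=z+1+O(z^{-2})$ be an analytic germ at $\infty$ (a standard diffeo). Its connector is the pair of germs $\pi=(\pi_{\rm no},\pi_{\rm so})$ defined for $\operatorname{Im}z\gg1$, resp. $-\operatorname{Im}z\gg1$, by $$\pi=f^*_+\circ{}^*\!f_-,\qquad f^*_+=\lim_{k\to+\infty}l^{-k}\circ f^{k},\qquad {}^*\!f_-=\lim_{k\to-\infty}f^{-k}\circ l^{k}.$$ A germ $f$ at $\infty$, or a pair $\pi$ of germs as above, is called reflexive if $\check f=f^{-1}$ (resp. $\check\pi=\pi^{-1}$), and counitary if $\check{\bar f}=f^{-1}$ (resp. $\check{\bar\pi}=\pi^{-1}$); here $\sigma$ exchanges the northern and the southern half-plane. The germ $f$ is weakly reflexive (resp. weakly counitary) through $h$ if $h(z)=\alpha z+b+O(z^{-1})$, $\alpha\neq0$, is an analytic germ at $\infty$ with $h\circ\check f=f^{-1}\circ h$ (resp. $h\circ\check{\bar f}=f^{-1}\circ h$). **(A)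 Conservation.** The limits that define $\pi$ exist. If $f$ is reflexive (resp. counitary), then so is $\pi$. If $f$ is weakly reflexive (resp. weakly counitary) through $h(z)=\alpha z+b+O(z^{-1})$, then $l^{-b/2}\circ\pi\circ l^{b/2}$ is strictly reflexive (resp. counitary); in particular $\pi$ itself is strictly reflexive (resp. counitary) as soon as the conjugating germ $h$ carries no constant term, $b=0$. **(B) Conservation at every step.** Let $g=l^{-1/2}\circ f\circ l^{-1/2}$, so that $l^{1/2}\circ f\circ l^{-1/2}=l\circ g$. There is exactly one formal series $g_*(z)=\sum_{d\ge1}g_{*,1+d}\,z^{-d}$ with $g=\exp(g_*\,\partial_z)\,z$. Consider the (formal) infinitesimal collector $$\mathfrak p_*(z)=\sum_{r\ge1}\ \sum_{\substack{d_1,\dots,d_r\ge1,\ l_1,\dots,l_r\ge0\\ \sum l_i=r-1}}(-1)^{r-1}\,\delta^{l_1,\dots,l_r}\,\mathrm{Tan}^{d_1+l_1,\dots,d_r+l_r}(z)\prod_{i=1}^r\frac{(d_i+l_i-1)!}{(d_i-1)!}\,g_{*,1+d_i},$$ where $\delta^{l_1,\dots,l_r}$ is the coefficient of $x_1^{l_1}\cdots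 x_r^{l_r}$ in $x_1(x_1+x_2)\cdots(x_1+\dots+x_{r-1})$. Here $\mathrm{Tan}^\bullet$ is the logarithm of the mould $$\mathrm{Ta}^{s_1,\dots,s_r}(z)=\sum_{n_1\ge\dots\ge n_r}\ \prod_i(n_i+z)^{-s_i}\ \prod_j\frac1{r_j!}$$ (the $n_i$ run over $\mathbb Z$, and the $r_j$ are the sizes of the clusters of equal $n_i$), with respect to the mould product $(A\times B)^{\mathbf s}=\sum_{\mathbf s'\mathbf s''=\mathbf s}A^{\mathbf s'}B^{\mathbf s''}$. The part of $\mathfrak p_*$ of weight $w$ is the finite sum of the terms with $\sum(1+d_i)=w$. It is in exactly one way a finite combination $\sum_{\sigma\ge2}p_{w,\sigma}\,\mathrm{Te}^\sigma(z)$ of the monotangents $\mathrm{Te}^\sigma(z)=\sum_{n\in\mathbb Z}(n+z)^{-\sigma}$, and $\mathbf p_*$ denotes the formal sum of the polynomials $\sum_\sigma p_{w,\sigma}z^{-\sigma}$ over all $w$. * If $f$ is reflexive, then $g_*$ is even ($g_{*,1+d}=0$ for odd $d$); $\mathfrak p_*$ is even, and more precisely each single term of its expansion, hence each of its parts of given weight,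 is an even function on $\mathbb C\setminus\mathbb Z$; and $\mathbf p_*$ is even, that is, $p_{w,\sigma}=0$ for all $w$ and all odd $\sigma$. * If $f$ is counitary, then $\bar g_*(-z)=g_*(z)$, that is, $g_{*,1+d}$ is real for even $d$ and purely imaginary for odd $d$; each single term $T$ of the expansion, hence each part of given weight, satisfies $\bar T(-z)=T(z)$; and $p_{w,\sigma}$ is real for even $\sigma$ and purely imaginary for odd $\sigma$. -/

import Mathlib

open Filter Topology Finset
open scoped ComplexConjugate Nat

noncomputable section

namespace IdentityTangent

/-! ## Germs at infinity -/

/-- `f z = α * z + ∑ n, a n * z ^ (-n)`, convergent for all large `z`: the power series `a`, in the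
variable `z⁻¹`, is the expansion of `f z - α * z` at infinity. -/
def HasExpansionAtInfty (f : ℂ → ℂ) (α : ℂ) (a : PowerSeries ℂ) : Prop :=
  ∃ R : ℝ, ∀ z : ℂ, R < ‖z‖ → HasSum (fun n : ℕ => PowerSeries.coeff n a * z⁻¹ ^ n) (f z - α * z)

/-- Standard diffeos: analytic germs `f z = z + 1 + O(z⁻²)` at infinity (tangency order one,
vanishing iterative residue). -/
def IsStandardDiffeo (f : ℂ → ℂ) : Prop :=
  ∃ a : PowerSeries ℂ, PowerSeries.coeff 0 a = 1 ∧ PowerSeries.coeff 1 a = 0 ∧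
    HasExpansionAtInfty f 1 a

/-- The germs of `f` and `g` along the filter `F` are inverse to each other for composition. -/
def IsInverseAlong (F : Filter ℂ) (f g : ℂ → ℂ) : Prop :=
  (∀ᶠ z in F, f (g z) = z) ∧ (∀ᶠ z in F, g (f z) = z)

/-- `σ ∘ f ∘ σ` with `σ z = -z`. -/
def reflect (f : ℂ → ℂ) : ℂ → ℂ := fun z => -f (-z)

/-- `σ ∘ f̄ ∘ σ`, where `f̄ z` is the complex conjugate of `f (conj z)`. -/
def coreflect (f : ℂ → ℂ) : ℂ → ℂ := fun z => -conj (f (-conj z))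

/-- The image of `f` under conjugation by `σ` is the inverse of `f`. -/
def IsReflexive (F : Filter ℂ) (f : ℂ → ℂ) : Prop := IsInverseAlong F f (reflect f)

/-- The image of the complex conjugate of `f` under conjugation by `σ` is the inverse of `f`. -/
def IsCounitary (F : Filter ℂ) (f : ℂ → ℂ) : Prop := IsInverseAlong F f (coreflect f)

/-- The filter of germs at infinity. -/
def atInfinity : Filter ℂ := Bornology.cobounded ℂ

/-- The filter generated by the sets `{z | K < |Im z|}`. A germ along it is a pair of germs, a
northern one (`Im z ≫ 1`) and a southern one (`-Im z ≫ 1`); `σ` exchanges the two half-planes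
and `z ↦ -conj z` preserves each of them. -/
def atVerticalInfinity : Filter ℂ := comap (fun z : ℂ => |z.im|) atTop

/-- `h` is a germ of analytic diffeomorphism at infinity, `h z = α z + b₀ + b₁ z⁻¹ + ⋯` with
`α ≠ 0`, that conjugates the germ `u` to the inverse of the germ `f`:
`h ∘ u = f⁻¹ ∘ h`. -/
def ConjugatesToInverse (h : ℂ → ℂ) (b : PowerSeries ℂ) (u f : ℂ → ℂ) : Prop :=
  (∃ α : ℂ, α ≠ 0 ∧ HasExpansionAtInfty h α b) ∧
    ∃ finv : ℂ → ℂ, IsInverseAlong atInfinity f finv ∧ ∀ᶠ z in atInfinity, h (u z) = finv (h z)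

/-- `f` is weakly reflexive through `h`: the germ `h` conjugates `σ ∘ f ∘ σ` to `f⁻¹`. -/
def IsWeaklyReflexiveVia (h : ℂ → ℂ) (b : PowerSeries ℂ) (f : ℂ → ℂ) : Prop :=
  ConjugatesToInverse h b (reflect f) f

/-- `f` is weakly counitary through `h`: the germ `h` conjugates `σ ∘ f̄ ∘ σ` to `f⁻¹`. -/
def IsWeaklyCounitaryVia (h : ℂ → ℂ) (b : PowerSeries ℂ) (f : ℂ → ℂ) : Prop :=
  ConjugatesToInverse h b (coreflect f) f

/-! ## Iterators and connectors -/

/-- `w` is the value at `z` of the direct iterator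
`f*₊ = lim l⁻ᵏ ∘ fᵏ`, `k → +∞`, with `l z = z + 1`. -/
def IsDirectIteratorValue (f : ℂ → ℂ) (z w : ℂ) : Prop :=
  Tendsto (fun k : ℕ => f^[k] z - k) atTop (𝓝 w)

/-- `w` is the value at `z` of the reciprocal iterator
`*f₋ = lim f⁻ᵏ ∘ lᵏ`, `k → -∞`, that is `lim fᵏ ∘ l⁻ᵏ`, `k → +∞`. -/
def IsReciprocalIteratorValue (f : ℂ → ℂ) (z w : ℂ) : Prop :=
  Tendsto (fun k : ℕ => f^[k] (z - k)) atTop (𝓝 w)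

/-- `P` is the connector `f*₊ ∘ *f₋` of `f` on the half-planes `±Im z ≫ 1`; the limits that
define it are required to exist. -/
def IsConnector (f P : ℂ → ℂ) : Prop :=
  ∀ᶠ z in atVerticalInfinity,
    ∃ u : ℂ, IsReciprocalIteratorValue f z u ∧ IsDirectIteratorValue f u (P z)

/-- `l^β ∘ P ∘ l^(-β)` with `l^β z = z + β`. -/
def shiftConj (β : ℂ) (P : ℂ → ℂ) : ℂ → ℂ := fun z => P (z - β) + β

/-! ## Infinitesimal generators -/

/-- The derivation `∂_z` on formal power series in `X = z⁻¹`. -/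
def zDeriv (v : PowerSeries ℂ) : PowerSeries ℂ := -(PowerSeries.X ^ 2 * PowerSeries.derivative ℂ v)

/-- `exp(v ∂_z) z - z = ∑_{k ≥ 0} (v ∂_z)^k v / (k + 1)!` as a formal power series in `z⁻¹`. The
summands with `k > n` have no term of degree `n`. -/
def expGenerator (v : PowerSeries ℂ) : PowerSeries ℂ :=
  PowerSeries.mk fun n =>
    ∑ k ∈ range (n + 1), PowerSeries.coeff n ((fun ψ => v * zDeriv ψ)^[k] v) / ((k + 1)! : ℂ)

/-- The formal series `v = ∑_{d ≥ 1} v_d z⁻ᵈ` is the infinitesimal generator of the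
germ `g`: `g z = exp(v ∂_z) z`. -/
def IsGenerator (g : ℂ → ℂ) (v : PowerSeries ℂ) : Prop :=
  PowerSeries.coeff 0 v = 0 ∧ HasExpansionAtInfty g 1 (expGenerator v)

/-- The factor `g = l^(-1/2) ∘ f ∘ l^(-1/2)`, for which `l^(1/2) ∘ f ∘ l^(-1/2) = l ∘ g`. -/
def symmetricFactor (f : ℂ → ℂ) : ℂ → ℂ := fun z => f (z - 1 / 2) - 1 / 2

/-! ## Moulds and multitangents -/

/-- The unit of mould multiplication. -/
def mouldOne : List ℕ → ℂ := fun s => if s = [] then 1 else 0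

/-- Mould multiplication. -/
def mouldMul (A B : List ℕ → ℂ) : List ℕ → ℂ :=
  fun s => ∑ i ∈ range (s.length + 1), A (s.take i) * B (s.drop i)

/-- Powers for mould multiplication. -/
def mouldPow (A : List ℕ → ℂ) : ℕ → List ℕ → ℂ
  | 0 => mouldOne
  | k + 1 => mouldMul A (mouldPow A k)

/-- The mould logarithm of a mould `M` with `M ∅ = 1`, namely
`(M - 1) - (M - 1)² / 2 + (M - 1)³ / 3 - ⋯`; on a sequence of length `r` the powers
beyond the `r`-th vanish. -/
def mouldLog (M : List ℕ → ℂ) : List ℕ → ℂ :=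
  fun s => ∑ k ∈ Icc 1 s.length,
    (-1 : ℂ) ^ (k - 1) / (k : ℂ) * mouldPow (fun t => M t - mouldOne t) k s

/-- The symmetral multitangent
`Ta^{s₁,…,s_r}(z) = ∑_{n₁ ≥ ⋯ ≥ n_r} ∏ (nᵢ + z)^(-sᵢ) ∏ 1 / r_j!`,
where the `r_j` are the sizes of the clusters of equal `nᵢ`. The sum is over integers, and
converges absolutely when all `sᵢ ≥ 2` and `z ∉ ℤ`. -/
def Ta (z : ℂ) : List ℕ → ℂ := fun s =>
  ∑' n : {n : Fin s.length → ℤ // Antitone n},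
    (∏ i, (((n.1 i : ℂ) + z) ^ s.get i)⁻¹) *
      ∏ m ∈ univ.image n.1, ((#{i | n.1 i = m})! : ℂ)⁻¹

/-- The alternal multitangent, the mould logarithm of `Ta`. -/
def Tan (z : ℂ) : List ℕ → ℂ := mouldLog (Ta z)

/-- The monotangent `Te^σ(z) = ∑ (n + z)^(-σ)`, `σ ≥ 2`. -/
def monotangent (σ : ℕ) (z : ℂ) : ℂ := ∑' n : ℤ, (((n : ℂ) + z) ^ σ)⁻¹

/-! ## The infinitesimal collector -/

/-- The integer `δ^{l₁,…,l_r}`, the coefficient of `x₁^{l₁} ⋯ x_r^{l_r}` in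
`x₁ (x₁ + x₂) ⋯ (x₁ + ⋯ + x_{r-1})`. -/
def deltaCoeff {r : ℕ} (l : Fin r → ℕ) : ℤ :=
  MvPolynomial.coeff (Finsupp.equivFunOnFinite.symm l)
    (∏ j ∈ univ.filter (fun j : Fin r => (j : ℕ) + 1 < r),
      ∑ i ∈ Iic j, (MvPolynomial.X i : MvPolynomial (Fin r) ℤ))

/-- The summand with indices `sᵢ = dᵢ + lᵢ` of the multitangent expansion of the infinitesimal
collector, for the generator `v = ∑ v_d z⁻ᵈ`:
`(-1)^(r-1) δ^{l₁,…,l_r} Tan^{s₁,…,s_r}(z) ∏ (sᵢ - 1)! / (dᵢ - 1)! v_{dᵢ}`. -/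
def collectorTerm (v : PowerSeries ℂ) {r : ℕ} (d l : Fin r → ℕ) (z : ℂ) : ℂ :=
  (-1 : ℂ) ^ (r - 1) * (deltaCoeff l : ℂ) * Tan z (List.ofFn fun i => d i + l i) *
    ∏ i, (((d i + l i - 1)! : ℂ) / ((d i - 1)! : ℂ) * PowerSeries.coeff (d i) v)

/-- The part of weight `w = ∑ (1 + dᵢ)` of the infinitesimal collector: the sum of all its
summands with `r ≥ 1`, `dᵢ ≥ 1`, `lᵢ ≥ 0` and `∑ lᵢ = r - 1` (`δ` vanishes for other `l`). The
infinitesimal collector is the formal sum of these parts. -/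
def collectorPart (v : PowerSeries ℂ) (w : ℕ) (z : ℂ) : ℂ :=
  ∑ r ∈ Icc 1 w,
    ∑ d ∈ piAntidiag (univ : Finset (Fin r)) (w - r) with ∀ i, 1 ≤ d i,
      ∑ l ∈ piAntidiag (univ : Finset (Fin r)) (r - 1), collectorTerm v d l z

/-- `p` is what a finite combination `F = ∑_{σ ≥ 2} p_σ Te^σ` of monotangents becomes when
each `Te^σ(z)` is changed to `z^(-σ)`, as a polynomial in `z⁻¹`. -/
def IsMonotangentReduction (F : ℂ → ℂ) (p : Polynomial ℂ) : Prop :=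
  p.coeff 0 = 0 ∧ p.coeff 1 = 0 ∧
    ∀ z : ℂ, (∀ n : ℤ, z ≠ n) → F z = p.sum fun σ c => c * monotangent σ z

/-! ## The two parities, for functions on `ℂ ∖ ℤ` and for coefficient sequences -/

/-- `F` is even on `ℂ ∖ ℤ`. -/
def IsEvenFun (F : ℂ → ℂ) : Prop := ∀ z : ℂ, (∀ n : ℤ, z ≠ n) → F (-z) = F z

/-- `F̄ (-z) = F z` on `ℂ ∖ ℤ`, where `F̄ z` is the complex conjugate of `F (conj z)`. -/
def IsCoevenFun (F : ℂ → ℂ) : Prop := ∀ z : ℂ, (∀ n : ℤ, z ≠ n) → conj (F (-conj z)) = F z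

/-- All coefficients of odd degree vanish. -/
def IsEvenSeq (c : ℕ → ℂ) : Prop := ∀ d, Odd d → c d = 0

/-- All coefficients of even degree are real, those of odd degree purely imaginary. -/
def IsCoevenSeq (c : ℕ → ℂ) : Prop := ∀ d, (Even d → (c d).im = 0) ∧ (Odd d → (c d).re = 0)

end IdentityTangent

end

open IdentityTangent

/-!
Reflexivity and counitariness are treated together. Let `χ` be the identity or complex
conjugation and `τ z = -χ z`; the symmetry says that `symConj χ f = τ ∘ f ∘ τ` is the inverse of `f`.

**The connector.** For `|Im z|` large, the orbits of `f` stay close to the orbits of the unit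
translation, since `f z - z - 1` is `O(z⁻²)` and `∑ ‖z + n‖⁻²` tends to `0` as `|Im z| → ∞`. All
iterates are moreover Lipschitz with one constant (`IterationBounds.norm_iterate_sub_iterate_le`).
Hence both limits exist (`IsStandardDiffeo.exists_isConnector`), and `P z - z → 0` for the connector
`P`. A germ `h` that conjugates `τ ∘ f ∘ τ` to the inverse of `f` has the form `h z = z + β + O(z⁻¹)`.
Composed with `τ`, it exchanges forward and backward orbits, and therefore the two limits that
define `P`; this yields the functional equation `P (τ (P (τ z)) + β) = z + β`
(`IsConnector.eventually_eq`). If `χ β = β`, this says that the conjugate of `P` by the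
translation by `β / 2` has the strict symmetry. Otherwise the equation and its mirror image show
that `P` commutes with the translation by `β - χ β`, which is purely imaginary and nonzero; since
`P z - z → 0`, the connector is then the identity (`eventually_eq_self_of_add`). The strict
symmetry of `f` is the case `h = id`.

**The generator.** Since the exponential of `v ∂` is multiplicative (`FormalExp.opExp_mul`), composition
with a germ whose expansion is the flow of `v` acts on asymptotic expansions as that exponential
(`HasAsymptotics.comp`). The flow determines `v` and is arbitrary
(`FormalExp.expGenerator_injective`, `FormalExp.expGenerator_surjective`), so that the generator
exists and is unique, and the relation `g ∘ τ ∘ g ∘ τ = id` becomes the parity of its coefficients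
(`IsGenerator.hasParitySeq`).

**Multitangents.** The change of `z` to `-z` reverses the order of the summation indices. The cluster
weight of the nonincreasing words is the ordered product, over the integers in decreasing order,
of the exponentials of single letters, and that of the nondecreasing words is the product in
the opposite order. Up to the sign of the letters, the two are therefore inverse to each other
(`Mould.clusterWeight_ge_mul_sign`), and so are, up to signs, the moulds `Ta z` and `Ta (-z)`. Taking
logarithms gives the parity of `Tan` (`Tan_neg`). As `δ` is homogeneous of degree `r - 1`, the signs
coming from `Tan` and from the coefficients of the generator cancel in each term of the
collector (`hasParityFun_collectorTerm`). Only terms with all `dᵢ ≥ 2` occur, because the generator of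
`g` starts in degree two; all the sums involved converge.

**Monotangents.** Each part of the collector is a function on `ℂ ∖ ℤ` that is periodic, has at most
poles at the integers and tends to `0` at `±i∞` (`IsTangential`). Subtracting multiples of
monotangents removes the principal part up to a simple pole, and Liouville's theorem shows that what
remains is zero (`IsTangential.eq_zero_of_simple_pole`). The coefficients are unique, as the highest one is
read off from the pole at the origin; uniqueness transfers the parity of the function to them
(`hasParitySeq_of_isMonotangentReduction`).
-/

open IdentityTangent

/-! ### The ring of moulds -/

/-- Complex-valued moulds over the alphabet `α`: functions on words, with the mould product as
multiplication. -/
def Mould (α : Type*) : Type _ := List α → ℂ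

namespace Mould

variable {α : Type*}

noncomputable instance : AddCommGroup (Mould α) := inferInstanceAs (AddCommGroup (List α → ℂ))
noncomputable instance : Module ℂ (Mould α) := inferInstanceAs (Module ℂ (List α → ℂ))

instance : One (Mould α) := ⟨fun s => match s with | [] => 1 | _ :: _ => 0⟩

instance : Mul (Mould α) :=
  ⟨fun A B s => ∑ i ∈ range (s.length + 1), A (s.take i) * B (s.drop i)⟩

/-- The mould `s ↦ A (a :: s)`. -/
def tail (A : Mould α) (a : α) : Mould α := fun s => A (a :: s)

theorem ext {A B : Mould α} (h : ∀ s, A s = B s) : A = B := funext h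

@[simp] theorem add_apply (A B : Mould α) (s : List α) : (A + B) s = A s + B s := rfl
@[simp] theorem neg_apply (A : Mould α) (s : List α) : (-A) s = -A s := rfl
@[simp] theorem sub_apply (A B : Mould α) (s : List α) : (A - B) s = A s - B s := rfl
@[simp] theorem zero_apply (s : List α) : (0 : Mould α) s = 0 := rfl
@[simp] theorem smul_apply (c : ℂ) (A : Mould α) (s : List α) : (c • A) s = c * A s := rfl
@[simp] theorem one_nil : (1 : Mould α) [] = 1 := rfl
@[simp] theorem one_cons (a : α) (s : List α) : (1 : Mould α) (a :: s) = 0 := rfl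

theorem mul_apply (A B : Mould α) (s : List α) :
    (A * B) s = ∑ i ∈ range (s.length + 1), A (s.take i) * B (s.drop i) := rfl

@[simp] theorem mul_nil (A B : Mould α) : (A * B) [] = A [] * B [] := by
  simp [mul_apply]

theorem mul_cons (A B : Mould α) (a : α) (s : List α) :
    (A * B) (a :: s) = A [] * B (a :: s) + (A.tail a * B) s := by
  rw [mul_apply, List.length_cons, sum_range_succ']
  simp only [List.take_succ_cons, List.drop_succ_cons, List.take_zero, List.drop_zero]
  rw [add_comm]
  rfl

theorem tail_mul (A B : Mould α) (a : α) :
    (A * B).tail a = A [] • B.tail a + A.tail a * B :=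
  ext fun s => mul_cons A B a s

theorem add_mul' (A B C : Mould α) : (A + B) * C = A * C + B * C :=
  ext fun s => by simp [mul_apply, add_mul, sum_add_distrib]

theorem mul_add' (A B C : Mould α) : A * (B + C) = A * B + A * C :=
  ext fun s => by simp [mul_apply, mul_add, sum_add_distrib]

theorem smul_mul' (c : ℂ) (A B : Mould α) : (c • A) * B = c • (A * B) :=
  ext fun s => by simp [mul_apply, mul_sum, mul_assoc]

theorem mul_smul' (c : ℂ) (A B : Mould α) : A * (c • B) = c • (A * B) :=
  ext fun s => by
    simp only [mul_apply, mul_sum, smul_apply]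
    exact sum_congr rfl fun _ _ => by ring

theorem zero_mul' (A : Mould α) : 0 * A = 0 := ext fun s => by simp [mul_apply]

theorem mul_zero' (A : Mould α) : A * 0 = 0 := ext fun s => by simp [mul_apply]

theorem one_mul' (A : Mould α) : 1 * A = A := ext fun s => by
  cases s with
  | nil => simp
  | cons a s =>
    rw [mul_cons, show (1 : Mould α).tail a = 0 from rfl, zero_mul']
    simp

theorem mul_one' (A : Mould α) : A * 1 = A := ext fun s => by
  induction s generalizing A with
  | nil => simp
  | cons a s ih =>
    rw [mul_cons, ih]
    simp [tail]

theorem mul_assoc' (A B C : Mould α) : A * B * C = A * (B * C) := ext fun s => by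
  induction s generalizing A B with
  | nil => simp [mul_assoc]
  | cons a s ih =>
    rw [mul_cons, tail_mul, mul_cons, mul_cons, add_mul', smul_mul', add_apply, ih, mul_nil,
      smul_apply]
    ring

noncomputable instance : Ring (Mould α) where
  mul_assoc := mul_assoc'
  one_mul := one_mul'
  mul_one := mul_one'
  left_distrib := mul_add'
  right_distrib := add_mul'
  zero_mul := zero_mul'
  mul_zero := mul_zero'
  zsmul := fun n A => n • A
  zsmul_zero' := SubNegMonoid.zsmul_zero'
  zsmul_succ' := SubNegMonoid.zsmul_succ'
  zsmul_neg' := SubNegMonoid.zsmul_neg'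
  neg_add_cancel := neg_add_cancel

noncomputable instance : Algebra ℂ (Mould α) := Algebra.ofModule smul_mul' mul_smul'

/-- The value of a product on a word depends only on the values of the factors on shorter
words. -/
theorem mul_congr_of_length_le {A A' B B' : Mould α} {r : ℕ}
    (hA : ∀ s, s.length ≤ r → A s = A' s) (hB : ∀ s, s.length ≤ r → B s = B' s)
    (s : List α) (hs : s.length ≤ r) : (A * B) s = (A' * B') s := by
  refine sum_congr rfl fun i _ => ?_
  rw [hA _ (by simp; omega), hB _ (by simp; omega)]

theorem pow_congr_of_length_le {A A' : Mould α} {r : ℕ}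
    (hA : ∀ s, s.length ≤ r → A s = A' s) (k : ℕ) (s : List α) (hs : s.length ≤ r) :
    (A ^ k) s = (A' ^ k) s := by
  induction k generalizing s with
  | zero => simp
  | succ k ih =>
    rw [pow_succ, pow_succ]
    exact mul_congr_of_length_le ih hA s hs

theorem mul_eq_zero_of_length_lt {A B : Mould α} {k m : ℕ} (hA : ∀ s, s.length < k → A s = 0)
    (hB : ∀ s, s.length < m → B s = 0) (s : List α) (hs : s.length < k + m) : (A * B) s = 0 := by
  refine sum_eq_zero fun i _ => ?_
  rcases lt_or_ge (s.take i).length k with h | h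
  · rw [hA _ h, zero_mul]
  · rw [hB, mul_zero]
    simp only [List.length_take, List.length_drop] at h ⊢
    omega

theorem pow_eq_zero_of_length_lt {U : Mould α} (hU : U [] = 0) (k : ℕ) (s : List α)
    (hs : s.length < k) : (U ^ k) s = 0 := by
  induction k generalizing s with
  | zero => omega
  | succ k ih =>
    rw [pow_succ]
    refine mul_eq_zero_of_length_lt (k := k) (m := 1) ih (fun t ht => ?_) s hs
    rw [List.length_eq_zero_iff.1 (by omega : t.length = 0), hU]

end Mould

/-! ### The logarithm of an inverse mould -/

section LogPolynomial

open Polynomial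

/-- The polynomial `X - X² / 2 + ⋯ ± Xʳ / r`. -/
noncomputable def logPoly (r : ℕ) : ℂ[X] :=
  ∑ k ∈ Icc 1 r, C ((-1 : ℂ) ^ (k - 1) / k) * X ^ k

/-- The polynomial `-X + X² - ⋯ ± Xʳ`, the truncation of `(1 + X)⁻¹ - 1`. -/
noncomputable def invPoly (r : ℕ) : ℂ[X] := (∑ k ∈ range (r + 1), (-X) ^ k) - 1

theorem one_add_mul_one_add_invPoly (r : ℕ) :
    (1 + X) * (1 + invPoly r) = 1 - (-X : ℂ[X]) ^ (r + 1) := by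
  have h := mul_neg_geom_sum (-X : ℂ[X]) (r + 1)
  rw [← h, invPoly]
  ring

theorem X_dvd_invPoly (r : ℕ) : X ∣ invPoly r := by
  rw [invPoly, sum_range_succ']
  simp only [pow_zero, add_sub_cancel_right]
  exact dvd_sum fun k _ => by rw [pow_succ]; exact Dvd.intro_left (-(-X) ^ k) (by ring)

theorem derivative_logPoly_mul (r : ℕ) :
    derivative (logPoly r) * (1 + X) = 1 - (-X) ^ r := by
  have h : derivative (logPoly r) = ∑ k ∈ range r, (-X : ℂ[X]) ^ k := by
    rw [logPoly, derivative_sum, range_eq_Ico]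
    refine (sum_Ico_add' (fun k : ℕ => derivative (C ((-1 : ℂ) ^ (k - 1) / k) * X ^ k)) 0 r 1).symm.trans
      (sum_congr rfl fun k _ => ?_)
    rw [derivative_C_mul_X_pow, add_tsub_cancel_right,
      div_mul_cancel₀ _ (Nat.cast_ne_zero.2 k.succ_ne_zero), neg_pow (X : ℂ[X]), C_pow, C_neg, C_1]
  rw [h, ← mul_neg_geom_sum (-X : ℂ[X]) r]
  ring

theorem X_pow_dvd_of_derivative {q : ℂ[X]} {r : ℕ} (h0 : q.coeff 0 = 0)
    (h : X ^ r ∣ derivative q) : X ^ (r + 1) ∣ q := by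
  rw [X_pow_dvd_iff] at h ⊢
  intro d hd
  cases d with
  | zero => exact h0
  | succ d =>
    have := h d (by omega)
    rw [coeff_derivative] at this
    exact (mul_eq_zero.1 this).resolve_right (by exact_mod_cast d.succ_ne_zero)

/-- The truncated form of `log ((1 + X)⁻¹) = -log (1 + X)`. -/
theorem X_pow_dvd_logPoly_add (r : ℕ) :
    X ^ (r + 1) ∣ logPoly r + (logPoly r).comp (invPoly r) := by
  have hW0 : (invPoly r).eval 0 = 0 := by
    obtain ⟨q, hq⟩ := X_dvd_invPoly r
    simp [hq]
  have hp0 : (logPoly r).eval 0 = 0 := by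
    rw [logPoly, eval_finsetSum]
    refine sum_eq_zero fun k hk => ?_
    rw [eval_C_mul, eval_pow, eval_X, zero_pow (by rw [mem_Icc] at hk; omega), mul_zero]
  refine X_pow_dvd_of_derivative ?_ ?_
  · rw [coeff_zero_eq_eval_zero, eval_add, eval_comp, hW0, hp0, add_zero]
  · rw [derivative_add, derivative_comp]
    set p' := derivative (logPoly r)
    set W := invPoly r
    have h1 : p' * (1 + X) = 1 - (-X) ^ r := derivative_logPoly_mul r
    have h2 : p'.comp W * (1 + W) = 1 - (-W) ^ r := by
      simpa using congrArg (fun q => q.comp W) h1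
    have h3 : (1 + X) * (1 + W) = 1 - (-X) ^ (r + 1) := one_add_mul_one_add_invPoly r
    have h4 : (1 + W) + (1 + X) * derivative W = (r + 1 : ℂ[X]) * (-X) ^ r := by
      have := congrArg derivative h3
      simp [derivative_pow] at this
      linear_combination this
    obtain ⟨V, hV⟩ := X_dvd_invPoly r
    have hV : W = X * V := hV
    have h5 : (-W) ^ r = X ^ r * (-V) ^ r := by rw [hV, ← mul_pow]; ring
    have h6 : (-X : ℂ[X]) ^ r = X ^ r * (-1) ^ r := by rw [← mul_pow]; ring
    -- Multiply by `(1 + X) (1 + W)`, which is `1` modulo `X ^ (r + 1)`.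
    refine ⟨(p' + derivative W * p'.comp W) * (-1) ^ r * (-X) + ((r : ℂ[X]) + 1) * (-1) ^ r
      - (-1) ^ r * (1 + W) - (-V) ^ r * derivative W * (1 + X), ?_⟩
    rw [pow_succ, h6] at h3
    rw [h6] at h1 h4
    rw [h5] at h2
    linear_combination (-(p' + derivative W * p'.comp W)) * h3 + (1 + W) * h1 +
      derivative W * (1 + X) * h2 + h4

end LogPolynomial

namespace Mould

variable {α : Type*}

/-- The truncated logarithms of two mutually inverse moulds are opposite. -/
theorem aeval_logPoly_of_mul_eq_one {M N : Mould α} (hM : M [] = 1) (hNM : N * M = 1)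
    (s : List α) {r : ℕ} (hr : s.length ≤ r) :
    (Polynomial.aeval (N - 1) (logPoly r)) s = -(Polynomial.aeval (M - 1) (logPoly r)) s := by
  set U := M - 1 with hU
  have hU0 : U [] = 0 := by simp [hU, hM]
  have hpow : ∀ (A : Mould α) (t : List α), t.length ≤ r → (A * U ^ (r + 1)) t = 0 :=
    fun A t ht => mul_eq_zero_of_length_lt (k := 0) (m := r + 1) (by simp)
      (pow_eq_zero_of_length_lt hU0 _) t (by omega)
  have hW : ∀ t : List α, t.length ≤ r → (N - 1) t = (Polynomial.aeval U (invPoly r)) t := by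
    intro t ht
    have h := congrArg (Polynomial.aeval U) (one_add_mul_one_add_invPoly r)
    simp only [map_mul, map_add, map_one, Polynomial.aeval_X, map_sub, map_pow, map_neg] at h
    have h1 : (1 + U) = M := by simp [hU]
    rw [h1] at h
    have h2 : N - 1 = Polynomial.aeval U (invPoly r) + (N * (-1) ^ (r + 1)) * U ^ (r + 1) := by
      have := congrArg (N * ·) h
      simp only [← mul_assoc, hNM, one_mul, mul_sub, mul_one] at this
      rw [neg_pow U, ← mul_assoc] at this
      rw [← sub_eq_zero] at this ⊢
      rw [← neg_eq_zero, ← this]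
      abel
    rw [h2, add_apply, hpow _ t ht, add_zero]
  have hc : (Polynomial.aeval (N - 1) (logPoly r)) s =
      (Polynomial.aeval (Polynomial.aeval U (invPoly r)) (logPoly r)) s := by
    have key : ∀ V : Mould α, (Polynomial.aeval V (logPoly r)) s =
        ∑ k ∈ Icc 1 r, ((-1 : ℂ) ^ (k - 1) / k) * (V ^ k) s := by
      intro V
      have : (Polynomial.aeval V (logPoly r)) =
          ∑ k ∈ Icc 1 r, ((-1 : ℂ) ^ (k - 1) / k) • V ^ k := by
        simp [logPoly, Polynomial.aeval_def, Algebra.smul_def]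
      rw [this]
      exact (Finset.sum_apply (M := fun _ : List α => ℂ) s _ _)
    rw [key, key]
    exact sum_congr rfl fun k _ => by rw [pow_congr_of_length_le hW k s hr]
  obtain ⟨q, hq⟩ := X_pow_dvd_logPoly_add r
  have h := congrArg (Polynomial.aeval U) hq
  rw [map_add, Polynomial.aeval_comp, mul_comm, map_mul, map_pow, Polynomial.aeval_X] at h
  rw [hc, eq_neg_iff_add_eq_zero, add_comm, ← add_apply, h]
  exact hpow _ s hr

/-- A function on words, as an element of the ring of moulds. -/
def of (A : List α → ℂ) : Mould α := A

theorem of_apply (A : List α → ℂ) (s : List α) : of A s = A s := rfl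

theorem mouldPow_eq (A : List ℕ → ℂ) (k : ℕ) (s : List ℕ) :
    mouldPow A k s = (of A ^ k) s := by
  induction k generalizing s with
  | zero => rw [pow_zero]; cases s <;> simp [mouldPow, mouldOne]
  | succ k ih =>
    rw [pow_succ', mul_apply]
    simp only [mouldPow, mouldMul, ih, of_apply]

theorem mouldOne_eq : mouldOne = (1 : Mould ℕ) := by
  funext s
  cases s <;> simp [mouldOne]

theorem mouldLog_eq (M : List ℕ → ℂ) (s : List ℕ) :
    mouldLog M s = (Polynomial.aeval (of M - 1) (logPoly s.length)) s := by
  have : (Polynomial.aeval (of M - 1) (logPoly s.length)) =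
      ∑ k ∈ Icc 1 s.length, ((-1 : ℂ) ^ (k - 1) / k) • (of M - 1) ^ k := by
    simp [logPoly, Polynomial.aeval_def, Algebra.smul_def]
  rw [this]
  refine Eq.trans ?_ (Finset.sum_apply (M := fun _ : List ℕ => ℂ) s _ _).symm
  refine sum_congr rfl fun k _ => ?_
  rw [mouldPow_eq, mouldOne_eq]
  rfl

/-- `log (M⁻¹) = -log M` for moulds with constant term `1`. -/
theorem mouldLog_of_mul_eq_one {M N : List ℕ → ℂ} (hM : M [] = 1) (hNM : of N * of M = 1)
    (s : List ℕ) : mouldLog N s = -mouldLog M s := by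
  rw [mouldLog_eq, mouldLog_eq]
  exact aeval_logPoly_of_mul_eq_one hM hNM s le_rfl

end Mould

/-! ### Cluster weights as ordered products of exponentials -/

namespace Mould

/-- The mould that multiplies `A` by the character `s ↦ (-1) ^ s.length`. -/
noncomputable def sign {α : Type*} (A : Mould α) : Mould α := fun s => (-1) ^ s.length * A s

theorem sign_mul {α : Type*} (A B : Mould α) : (A * B).sign = A.sign * B.sign := by
  refine ext fun s => ?_
  simp only [sign, mul_apply, mul_sum]
  refine sum_congr rfl fun i hi => ?_
  have : (-1 : ℂ) ^ s.length = (-1) ^ (s.take i).length * (-1) ^ (s.drop i).length := by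
    rw [← pow_add, ← List.length_append, List.take_append_drop]
  rw [this]
  ring

theorem sign_one {α : Type*} : (1 : Mould α).sign = 1 := by
  refine ext fun s => ?_
  cases s <;> simp [sign]

open Classical in
/-- The exponential of the mould that is `1` on the word `m` and `0` on all other words. -/
noncomputable def letterExp (m : ℤ) : Mould ℤ :=
  fun n => if ∀ a ∈ n, a = m then ((n.length ! : ℕ) : ℂ)⁻¹ else 0

theorem letterExp_mul_sign (m : ℤ) : letterExp m * (letterExp m).sign = 1 := by
  refine ext fun n => ?_
  by_cases h : ∀ a ∈ n, a = m
  · have h1 : ∀ i, ∀ a ∈ n.take i, a = m := fun i a ha => h a (List.mem_of_mem_take ha)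
    have h2 : ∀ i, ∀ a ∈ n.drop i, a = m := fun i a ha => h a (List.mem_of_mem_drop ha)
    have h3 : (letterExp m * (letterExp m).sign) n =
        ((n.length ! : ℕ) : ℂ)⁻¹ * ((1 : ℂ) + (-1)) ^ n.length := by
      rw [add_pow, mul_sum]
      refine sum_congr rfl fun i hi => ?_
      have hi : i ≤ n.length := by rw [mem_range] at hi; omega
      simp only [letterExp, sign, if_pos (h1 i), if_pos (h2 i), List.length_take,
        List.length_drop, min_eq_left hi, one_pow, one_mul]
      rw [Nat.cast_choose ℂ hi]
      have := Nat.cast_ne_zero (R := ℂ).2 (Nat.factorial_ne_zero n.length)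
      field_simp
    rw [h3]
    cases n <;> simp
  · have hz : (1 : Mould ℤ) n = 0 := by
      cases n with
      | nil => simp at h
      | cons a n => simp
    rw [hz]
    refine sum_eq_zero fun i _ => ?_
    by_cases h1 : ∀ a ∈ n.take i, a = m
    · have h2 : ¬ ∀ a ∈ n.drop i, a = m := fun h2 => h fun a ha => by
        rw [← List.take_append_drop i n, List.mem_append] at ha
        exact ha.elim (h1 a) (h2 a)
      simp [letterExp, sign, h2]
    · simp [letterExp, h1]

theorem exists_replicate_append (m : ℤ) (n : List ℤ) :
    ∃ k t, n = List.replicate k m ++ t ∧ t.head? ≠ some m := by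
  induction n with
  | nil => exact ⟨0, [], by simp⟩
  | cons a n ih =>
    by_cases h : a = m
    · obtain ⟨k, t, rfl, ht⟩ := ih
      exact ⟨k + 1, t, by simp [h, List.replicate_succ], ht⟩
    · exact ⟨0, a :: n, by simp [h]⟩

theorem letterExp_mul_apply {m : ℤ} {A : Mould ℤ} (hA : ∀ t, m ∈ t → A t = 0) (k : ℕ)
    {t : List ℤ} (ht : t.head? ≠ some m) :
    (letterExp m * A) (List.replicate k m ++ t) = (k ! : ℂ)⁻¹ * A t := by
  rw [mul_apply, sum_eq_single k]
  · rw [List.take_left' (by simp), List.drop_left' (by simp), letterExp,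
      if_pos (fun a ha => List.eq_of_mem_replicate ha), List.length_replicate]
  · intro i hi hik
    rcases lt_or_gt_of_ne hik with h | h
    · rw [hA, mul_zero]
      rw [List.drop_append_of_le_length (by simp; omega), List.drop_replicate]
      exact List.mem_append_left _ (List.mem_replicate.2 ⟨by omega, rfl⟩)
    · cases t with
      | nil => simp at hi; omega
      | cons x t =>
        have hx : x ≠ m := by simpa using ht
        rw [letterExp, if_neg, zero_mul]
        intro hall
        refine hx (hall x ?_)
        obtain ⟨j, rfl⟩ : ∃ j, i = k + (j + 1) := ⟨i - k - 1, by omega⟩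
        rw [List.take_append]
        simp
  · intro h
    simp at h

open Classical in
/-- The weight `∏ 1 / r_j!` of a word of integers that is sorted with respect to `R`, where the
`r_j` are the multiplicities of its letters; the words that are not sorted have weight `0`. -/
noncomputable def clusterWeight (R : ℤ → ℤ → Prop) : Mould ℤ :=
  fun n => if n.Pairwise R then ∏ m ∈ n.toFinset, ((n.count m)! : ℂ)⁻¹ else 0

theorem prod_count_eq {n : List ℤ} {S : Finset ℤ} (h : n.toFinset ⊆ S) :
    ∏ m ∈ n.toFinset, ((n.count m)! : ℂ)⁻¹ = ∏ m ∈ S, ((n.count m)! : ℂ)⁻¹ := by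
  refine prod_subset h fun m _ hm => ?_
  rw [List.mem_toFinset] at hm
  simp [List.count_eq_zero_of_not_mem hm]

/-- On the words with letters in a sorted list `L`, the cluster weight is the mould product, in the
order of `L`, of the exponentials of the letters. -/
theorem prod_letterExp_apply {R : ℤ → ℤ → Prop} (hR : ∀ a, R a a)
    (hR' : ∀ a b, R a b → R b a → a = b) (L : List ℤ)
    (hL : L.Pairwise fun a b => R a b ∧ a ≠ b) (n : List ℤ) :
    ((n ⊆ L) → (L.map letterExp).prod n = clusterWeight R n) ∧
      (¬ (n ⊆ L) → (L.map letterExp).prod n = 0) := by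
  induction L generalizing n with
  | nil =>
    cases n with
    | nil => simp [clusterWeight]
    | cons a n => simp
  | cons m L ih =>
    obtain ⟨hm, hL⟩ := List.pairwise_cons.1 hL
    have hmL : m ∉ L := fun h => (hm m h).2 rfl
    obtain ⟨k, t, rfl, ht⟩ := exists_replicate_append m n
    have hz : ∀ t, m ∈ t → (L.map letterExp).prod t = 0 :=
      fun t h => (ih hL t).2 fun h' => hmL (h' h)
    rw [List.map_cons, List.prod_cons, letterExp_mul_apply hz k ht]
    by_cases hmt : m ∈ t
    · rw [hz t hmt, mul_zero]
      refine ⟨fun hsub => ?_, fun _ => rfl⟩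
      cases t with
      | nil => simp at hmt
      | cons x t =>
        have hx : x ≠ m := by simpa using ht
        have hxL : x ∈ L := by
          have : x ∈ m :: L := hsub (by simp)
          simpa [hx] using this
        rw [clusterWeight, if_neg]
        intro hp
        have h1 := (List.pairwise_append.1 hp).2.1
        have h2 : m ∈ t := by simpa [hx.symm] using hmt
        exact hx (hR' _ _ ((List.pairwise_cons.1 h1).1 m h2) (hm x hxL).1)
    · have hsub : (List.replicate k m ++ t ⊆ m :: L) ↔ t ⊆ L := by
        constructor
        · intro h a ha
          have : a ∈ m :: L := h (List.mem_append_right _ ha)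
          rcases List.mem_cons.1 this with rfl | h
          · exact absurd ha hmt
          · exact h
        · intro h a ha
          rcases List.mem_append.1 ha with h1 | h1
          · simp [List.eq_of_mem_replicate h1]
          · exact List.mem_cons_of_mem _ (h h1)
      rw [hsub]
      refine ⟨fun h => ?_, fun h => by rw [(ih hL t).2 h, mul_zero]⟩
      rw [(ih hL t).1 h]
      have hsort : (List.replicate k m ++ t).Pairwise R ↔ t.Pairwise R := by
        rw [List.pairwise_append]
        refine ⟨fun h => h.2.1, fun h1 => ⟨List.pairwise_replicate.2 (Or.inr (hR m)), h1, ?_⟩⟩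
        intro a ha b hb
        rw [List.eq_of_mem_replicate ha]
        exact (hm b (h hb)).1
      by_cases hs : t.Pairwise R
      · rw [clusterWeight, clusterWeight, if_pos hs, if_pos (hsort.2 hs)]
        rw [prod_count_eq (n := List.replicate k m ++ t) (S := insert m t.toFinset),
          prod_insert (by simpa using hmt)]
        · congr 1
          · simp [List.count_append, List.count_eq_zero_of_not_mem hmt]
          · refine prod_congr rfl fun x hx => ?_
            have hxm : x ≠ m := by
              rintro rfl
              exact hmt (List.mem_toFinset.1 hx)
            rw [List.count_append, List.count_eq_zero_of_not_mem (l := List.replicate k m),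
              zero_add]
            exact fun h => hxm (List.eq_of_mem_replicate h)
        · intro x hx
          rw [List.mem_toFinset, List.mem_append] at hx
          rcases hx with hx | hx
          · simp [List.eq_of_mem_replicate hx]
          · simp [hx]
      · rw [clusterWeight, clusterWeight, if_neg hs, if_neg (by rwa [hsort]), mul_zero]

theorem prod_mul_prod_reverse_sign (L : List ℤ) :
    (L.map letterExp).prod * ((L.reverse.map letterExp).prod).sign = 1 := by
  induction L with
  | nil => simp [sign_one]
  | cons m L ih =>
    rw [List.reverse_cons, List.map_append, List.prod_append, sign_mul, List.map_cons,
      List.prod_cons, mul_assoc, ← mul_assoc (List.prod _) (sign _), ih, one_mul]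
    simpa using letterExp_mul_sign m

/-- The cluster weights for the two opposite orders are, up to sign, inverse to each other. -/
theorem clusterWeight_ge_mul_sign : clusterWeight (· ≥ ·) * (clusterWeight (· ≤ ·)).sign = 1 := by
  refine ext fun n => ?_
  set L := n.toFinset.sort (· ≥ ·) with hLdef
  have hL : L.Pairwise (· > ·) := by
    have := n.toFinset.sortedGT_sort
    exact this.pairwise
  have hn : n ⊆ L := fun a ha => by simpa [hLdef] using ha
  rw [← prod_mul_prod_reverse_sign L, mul_apply, mul_apply]
  refine sum_congr rfl fun i _ => ?_
  rw [(prod_letterExp_apply (R := (· ≥ ·)) (fun a => le_rfl) (fun a b h h' => le_antisymm h' h) L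
      (hL.imp fun h => ⟨le_of_lt h, ne_of_gt h⟩) (n.take i)).1
      fun a ha => hn (List.mem_of_mem_take ha)]
  rw [sign, sign, (prod_letterExp_apply (R := (· ≤ ·)) (fun a => le_rfl)
      (fun a b h h' => le_antisymm h h') L.reverse
      (List.pairwise_reverse.2 (hL.imp fun h => ⟨le_of_lt h, ne_of_lt h⟩)) (n.drop i)).1
      fun a ha => List.mem_reverse.2 (hn (List.mem_of_mem_drop ha))]

theorem clusterWeight_nil (R : ℤ → ℤ → Prop) : clusterWeight R [] = 1 := by
  simp [clusterWeight]

theorem norm_clusterWeight_le (R : ℤ → ℤ → Prop) (n : List ℤ) : ‖clusterWeight R n‖ ≤ 1 := by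
  rw [clusterWeight]
  split_ifs
  · rw [norm_prod]
    refine prod_le_one (fun _ _ => norm_nonneg _) fun m _ => ?_
    rw [norm_inv, Complex.norm_natCast]
    exact inv_le_one_of_one_le₀ (by exact_mod_cast Nat.factorial_pos _)
  · simp

theorem clusterWeight_map {R : ℤ → ℤ → Prop} {e : ℤ → ℤ} (he : Function.Injective e)
    (n : List ℤ) : clusterWeight R (n.map e) = clusterWeight (fun a b => R (e a) (e b)) n := by
  classical
  rw [clusterWeight, clusterWeight]
  simp only [List.pairwise_map]
  refine if_congr Iff.rfl ?_ rfl
  have : (n.map e).toFinset = n.toFinset.image e := by ext; simp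
  rw [this, prod_image he.injOn]
  exact prod_congr rfl fun m _ => by rw [List.count_map_of_injective _ _ he]

end Mould

/-! ### Multitangent sums attached to moulds over `ℤ` -/

/-- The sum `∑ ‖(n + z)^(-a)‖` over the integers `n`. -/
noncomputable def normTangent (z : ℂ) (a : ℕ) : ℝ := ∑' n : ℤ, ‖(((n : ℂ) + z) ^ a)⁻¹‖

theorem summable_inv_pow (z : ℂ) {a : ℕ} (ha : 2 ≤ a) :
    Summable fun n : ℤ => (((n : ℂ) + z) ^ a)⁻¹ := by
  have := EisensteinSeries.linear_right_summable z 1 (k := a) (by exact_mod_cast ha)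
  refine this.congr fun n => ?_
  rw [Int.cast_one, one_mul, zpow_natCast, add_comm]

theorem summable_norm_inv_pow (z : ℂ) {a : ℕ} (ha : 2 ≤ a) :
    Summable fun n : ℤ => ‖(((n : ℂ) + z) ^ a)⁻¹‖ := (summable_inv_pow z ha).norm

theorem normTangent_nonneg (z : ℂ) (a : ℕ) : 0 ≤ normTangent z a :=
  tsum_nonneg fun _ => norm_nonneg _

/-- The sum of `A n * ∏ (nᵢ + z)^(-sᵢ)` over all words `n` of integers of the same length as `s`,
as an iterated series. -/
noncomputable def multiSum (z : ℂ) : List ℕ → Mould ℤ → ℂ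
  | [], A => A []
  | a :: s, A => ∑' n : ℤ, (((n : ℂ) + z) ^ a)⁻¹ * multiSum z s (A.tail n)

theorem multiSum_nil (z : ℂ) (A : Mould ℤ) : multiSum z [] A = A [] := rfl

theorem multiSum_cons (z : ℂ) (a : ℕ) (s : List ℕ) (A : Mould ℤ) :
    multiSum z (a :: s) A = ∑' n : ℤ, (((n : ℂ) + z) ^ a)⁻¹ * multiSum z s (A.tail n) := rfl

theorem norm_multiSum_le (z : ℂ) {s : List ℕ} (hs : ∀ a ∈ s, 2 ≤ a) {A : Mould ℤ} {C : ℝ}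
    (hA : ∀ n, n.length = s.length → ‖A n‖ ≤ C) :
    ‖multiSum z s A‖ ≤ C * (s.map (normTangent z)).prod := by
  induction s generalizing A with
  | nil => simpa [multiSum] using hA [] rfl
  | cons a s ih =>
    simp only [List.mem_cons, forall_eq_or_imp] at hs
    have h := (summable_norm_inv_pow z hs.1).mul_right (C * (s.map (normTangent z)).prod)
    rw [multiSum, List.map_cons, List.prod_cons, mul_left_comm, normTangent, ← tsum_mul_right]
    refine tsum_of_norm_bounded h.hasSum fun n => ?_
    rw [norm_mul]
    exact mul_le_mul_of_nonneg_left (ih hs.2 fun t ht => hA _ (by simp [ht])) (norm_nonneg _)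

theorem summable_multiSum (z : ℂ) {a : ℕ} {s : List ℕ} (ha : 2 ≤ a) (hs : ∀ a ∈ s, 2 ≤ a)
    {A : Mould ℤ} {C : ℝ} (hA : ∀ n, n.length = s.length + 1 → ‖A n‖ ≤ C) :
    Summable fun n : ℤ => (((n : ℂ) + z) ^ a)⁻¹ * multiSum z s (A.tail n) := by
  have h := (summable_norm_inv_pow z ha).mul_right (C * (s.map (normTangent z)).prod)
  refine Summable.of_norm_bounded h fun n => ?_
  rw [norm_mul]
  exact mul_le_mul_of_nonneg_left (norm_multiSum_le z hs fun t ht => hA _ (by simp [ht]))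
    (norm_nonneg _)

theorem multiSum_smul (z : ℂ) (c : ℂ) (s : List ℕ) (A : Mould ℤ) :
    multiSum z s (c • A) = c * multiSum z s A := by
  induction s generalizing A with
  | nil => simp [multiSum]
  | cons a s ih =>
    rw [multiSum, multiSum, ← tsum_mul_left]
    refine tsum_congr fun n => ?_
    rw [show (c • A).tail n = c • A.tail n from rfl, ih]
    ring

theorem multiSum_add (z : ℂ) {s : List ℕ} (hs : ∀ a ∈ s, 2 ≤ a) {A B : Mould ℤ} {C D : ℝ}
    (hA : ∀ n, n.length = s.length → ‖A n‖ ≤ C) (hB : ∀ n, n.length = s.length → ‖B n‖ ≤ D) :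
    multiSum z s (A + B) = multiSum z s A + multiSum z s B := by
  induction s generalizing A B with
  | nil => simp [multiSum]
  | cons a s ih =>
    simp only [List.mem_cons, forall_eq_or_imp] at hs
    rw [multiSum, multiSum, multiSum,
      ← (summable_multiSum z hs.1 hs.2 hA).tsum_add (summable_multiSum z hs.1 hs.2 hB)]
    refine tsum_congr fun n => ?_
    rw [show (A + B).tail n = A.tail n + B.tail n from rfl, ih (A := A.tail n) (B := B.tail n) hs.2
      (fun t ht => hA _ (by simp [ht])) (fun t ht => hB _ (by simp [ht])), mul_add]

theorem multiSum_one (z : ℂ) (s : List ℕ) : multiSum z s 1 = (1 : Mould ℕ) s := by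
  cases s with
  | nil => simp [multiSum]
  | cons a s =>
    have h : ∀ (s : List ℕ), multiSum z s (0 : Mould ℤ) = 0 := fun s => by
      have := multiSum_smul z 0 s 0
      rwa [zero_smul, zero_mul] at this
    rw [multiSum, Mould.one_cons]
    refine (tsum_congr fun n => ?_).trans tsum_zero
    rw [show (1 : Mould ℤ).tail n = 0 from rfl, h, mul_zero]

theorem Mould.norm_mul_le {α : Type*} {A B : Mould α} {C D : ℝ} (hA : ∀ n, ‖A n‖ ≤ C)
    (hB : ∀ n, ‖B n‖ ≤ D) (n : List α) : ‖(A * B) n‖ ≤ (n.length + 1) * (C * D) := by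
  rw [Mould.mul_apply]
  refine (norm_sum_le _ _).trans ?_
  have hC : 0 ≤ C := (norm_nonneg _).trans (hA [])
  refine (sum_le_card_nsmul _ _ (C * D) fun i _ => ?_).trans (by simp)
  rw [norm_mul]
  exact mul_le_mul (hA _) (hB _) (norm_nonneg _) hC

/-- The multitangent sums of a product of moulds over `ℤ` are the mould product of the multitangent
sums of the factors. -/
theorem multiSum_mul (z : ℂ) {s : List ℕ} (hs : ∀ a ∈ s, 2 ≤ a) {A B : Mould ℤ} {C D : ℝ}
    (hA : ∀ n, ‖A n‖ ≤ C) (hB : ∀ n, ‖B n‖ ≤ D) :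
    multiSum z s (A * B) =
      (Mould.of (fun t => multiSum z t A) * Mould.of (fun t => multiSum z t B)) s := by
  induction s generalizing A with
  | nil => rw [Mould.mul_nil, multiSum_nil, Mould.mul_nil]; rfl
  | cons a s ih =>
    simp only [List.mem_cons, forall_eq_or_imp] at hs
    have htake : ∀ i, ∀ a ∈ s.take i, 2 ≤ a := fun i a ha => hs.2 a (List.mem_of_mem_take ha)
    have h1 : ∀ n : ℤ, (((n : ℂ) + z) ^ a)⁻¹ * multiSum z s ((A * B).tail n) =
        A [] * ((((n : ℂ) + z) ^ a)⁻¹ * multiSum z s (B.tail n)) +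
        ∑ i ∈ range (s.length + 1), (((n : ℂ) + z) ^ a)⁻¹ * multiSum z (s.take i) (A.tail n) *
          multiSum z (s.drop i) B := by
      intro n
      rw [Mould.tail_mul, multiSum_add z hs.2 (C := C * D) (D := (s.length + 1) * (C * D)),
        multiSum_smul, ih hs.2 (A := A.tail n) fun t => hA _, Mould.mul_apply, mul_add, mul_sum,
        mul_left_comm]
      · congr 1
        refine sum_congr rfl fun i _ => ?_
        rw [mul_assoc]
        rfl
      · intro t _
        rw [Mould.smul_apply, norm_mul]
        exact mul_le_mul (hA _) (hB _) (norm_nonneg _) ((norm_nonneg _).trans (hA []))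
      · intro t ht
        rw [← ht]
        exact Mould.norm_mul_le (A := A.tail n) (fun t => hA _) hB t
    have hsB := summable_multiSum z hs.1 hs.2 (A := B) fun n _ => hB n
    have hsA := fun i => (summable_multiSum z hs.1 (htake i) (A := A) fun n _ => hA n).mul_right
      (multiSum z (s.drop i) B)
    rw [multiSum, tsum_congr h1, (hsB.mul_left _).tsum_add (summable_sum fun i _ => hsA i),
      tsum_mul_left, Summable.tsum_finsetSum fun i _ => hsA i, Mould.mul_cons]
    congr 1
    refine sum_congr rfl fun i _ => ?_
    rw [tsum_mul_right]
    rfl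

/-- The mould obtained from `A` by applying `e` to all letters. -/
def Mould.mapLetters (e : ℤ → ℤ) (A : Mould ℤ) : Mould ℤ := fun n => A (n.map e)

theorem Mould.tail_mapLetters (e : ℤ → ℤ) (A : Mould ℤ) (n : ℤ) :
    (A.mapLetters e).tail n = (A.tail (e n)).mapLetters e := rfl

theorem multiSum_neg (z : ℂ) (s : List ℕ) (A : Mould ℤ) :
    multiSum (-z) s A = (-1) ^ s.sum * multiSum z s (A.mapLetters Neg.neg) := by
  induction s generalizing A with
  | nil => simp [multiSum_nil, Mould.mapLetters]
  | cons a s ih =>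
    rw [multiSum_cons, multiSum_cons, ← tsum_mul_left, ← (Equiv.neg ℤ).tsum_eq]
    refine tsum_congr fun n => ?_
    rw [ih, Equiv.neg_apply, Int.cast_neg, ← neg_add, neg_pow, List.sum_cons, pow_add, mul_inv,
      ← inv_pow, inv_neg, inv_one]
    simp only [Mould.tail_mapLetters]
    ring

theorem multiSum_add_one (z : ℂ) (s : List ℕ) (A : Mould ℤ) :
    multiSum (z + 1) s A = multiSum z s (A.mapLetters (· - 1)) := by
  induction s generalizing A with
  | nil => simp [multiSum_nil, Mould.mapLetters]
  | cons a s ih =>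
    rw [multiSum_cons, multiSum_cons, ← (Equiv.subRight (1 : ℤ)).tsum_eq]
    refine tsum_congr fun n => ?_
    rw [ih, Equiv.subRight_apply]
    simp only [Mould.tail_mapLetters, Int.cast_sub, Int.cast_one]
    congr 3
    ring

theorem summable_prod_inv_pow (z : ℂ) {s : List ℕ} (hs : ∀ a ∈ s, 2 ≤ a) :
    Summable fun n : Fin s.length → ℤ => ‖∏ i, (((n i : ℂ) + z) ^ s.get i)⁻¹‖ := by
  induction s with
  | nil => exact (hasSum_unique (α := ℝ) (β := Fin 0 → ℤ) _).summable
  | cons a s ih =>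
    simp only [List.mem_cons, forall_eq_or_imp] at hs
    refine (Equiv.summable_iff (Fin.consEquiv (n := s.length) fun _ => ℤ)).1 ?_
    refine ((summable_norm_inv_pow z hs.1).mul_of_nonneg (ih hs.2) (fun _ => norm_nonneg _)
      (fun _ => norm_nonneg _)).congr fun p => ?_
    refine (norm_mul _ _).symm.trans (congrArg norm ?_)
    exact (Fin.prod_univ_succ fun i : Fin (s.length + 1) =>
      (((Fin.consEquiv (fun _ => ℤ) p i : ℂ) + z) ^ (a :: s).get i)⁻¹).symm

/-- The iterated series is a series over all words of length `s.length`. -/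
theorem multiSum_eq_tsum (z : ℂ) {s : List ℕ} (hs : ∀ a ∈ s, 2 ≤ a) {A : Mould ℤ} {C : ℝ}
    (hA : ∀ n, n.length = s.length → ‖A n‖ ≤ C) :
    HasSum (fun n : Fin s.length → ℤ => (∏ i, (((n i : ℂ) + z) ^ s.get i)⁻¹) * A (List.ofFn n))
      (multiSum z s A) := by
  induction s generalizing A with
  | nil =>
    convert! hasSum_unique (α := ℂ) (β := Fin 0 → ℤ) _
    simp [multiSum_nil]
  | cons a s ih =>
    have key : Summable fun n : Fin (a :: s).length → ℤ =>
        (∏ i, (((n i : ℂ) + z) ^ (a :: s).get i)⁻¹) * A (List.ofFn n) := by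
      refine Summable.of_norm_bounded ((summable_prod_inv_pow z hs).mul_right C) fun n => ?_
      rw [norm_mul]
      exact mul_le_mul_of_nonneg_left (hA _ (by simp)) (norm_nonneg _)
    simp only [List.mem_cons, forall_eq_or_imp] at hs
    refine key.hasSum_iff.2 ?_
    have key' := (Equiv.summable_iff (Fin.consEquiv (n := s.length) fun _ => ℤ)).2 key
    refine (Equiv.tsum_eq (Fin.consEquiv (n := s.length) fun _ => ℤ) _).symm.trans ?_
    refine key'.tsum_prod.trans ?_
    rw [multiSum_cons]
    refine tsum_congr fun n => ?_
    rw [← (ih hs.2 (A := A.tail n) fun t ht => hA _ (by simp [ht])).tsum_eq, ← tsum_mul_left]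
    refine tsum_congr fun t => ?_
    rw [← mul_assoc]
    refine congrArg₂ (· * ·) (Fin.prod_univ_succ _) ?_
    exact congrArg A (List.ofFn_succ (f := Fin.consEquiv (fun _ => ℤ) (n, t)))

/-! ### The parity of alternal multitangents -/

theorem Ta_eq_multiSum (z : ℂ) {s : List ℕ} (hs : ∀ a ∈ s, 2 ≤ a) :
    Ta z s = multiSum z s (Mould.clusterWeight (· ≥ ·)) := by
  classical
  rw [← (multiSum_eq_tsum z hs fun n _ => Mould.norm_clusterWeight_le _ n).tsum_eq, Ta]
  have h : ∀ n : Fin s.length → ℤ, Mould.clusterWeight (· ≥ ·) (List.ofFn n) =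
      if Antitone n then ∏ m ∈ univ.image n, ((#{i | n i = m})! : ℂ)⁻¹ else 0 := by
    intro n
    rw [Mould.clusterWeight]
    have h1 : (List.ofFn n).Pairwise (· ≥ ·) ↔ Antitone n := by
      rw [List.pairwise_ofFn]
      exact ⟨fun h => antitone_iff_forall_lt.2 fun i j hij => h hij, fun h i j hij => h hij.le⟩
    have h2 : (List.ofFn n).toFinset = univ.image n := by ext; simp
    simp only [h1, h2]
    refine if_congr Iff.rfl (prod_congr rfl fun m _ => ?_) rfl
    have := Fin.card_filter_univ_eq_vector_get_eq_count m (List.Vector.ofFn n)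
    rw [List.Vector.toList_ofFn] at this
    simp only [← this, List.Vector.get_ofFn]
  refine (tsum_subtype {n : Fin s.length → ℤ | Antitone n} (fun n =>
    (∏ i, (((n i : ℂ) + z) ^ s.get i)⁻¹) * ∏ m ∈ univ.image n, ((#{i | n i = m})! : ℂ)⁻¹)).trans ?_
  refine tsum_congr fun n => ?_
  rw [h, Set.indicator_apply]
  simp only [Set.mem_ofPred_eq, mul_ite, mul_zero]

theorem Ta_nil (z : ℂ) : Ta z [] = 1 := by
  rw [Ta_eq_multiSum z (by simp), multiSum_nil, Mould.clusterWeight_nil]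

theorem multiSum_sign (z : ℂ) (s : List ℕ) (A : Mould ℤ) :
    multiSum z s A.sign = (-1) ^ s.length * multiSum z s A := by
  induction s generalizing A with
  | nil => simp [multiSum_nil, Mould.sign]
  | cons a s ih =>
    rw [multiSum_cons, multiSum_cons, ← tsum_mul_left]
    refine tsum_congr fun n => ?_
    have : A.sign.tail n = (-1 : ℂ) • (A.tail n).sign := Mould.ext fun t => by
      simp only [Mould.tail, Mould.sign, Mould.smul_apply, List.length_cons]
      ring
    rw [this, multiSum_smul, ih, List.length_cons]
    ring

theorem multiSum_clusterWeight_le (z : ℂ) (s : List ℕ) :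
    multiSum z s (Mould.clusterWeight (· ≤ ·)) =
      (-1) ^ s.sum * multiSum (-z) s (Mould.clusterWeight (· ≥ ·)) := by
  have h : Mould.clusterWeight (· ≤ ·) = (Mould.clusterWeight (· ≥ ·)).mapLetters Neg.neg :=
    Mould.ext fun n => by
      rw [Mould.mapLetters, Mould.clusterWeight_map neg_injective]
      simp only [ge_iff_le, neg_le_neg_iff]
  rw [multiSum_neg, ← mul_assoc, ← mul_pow, neg_one_mul, neg_neg, one_pow, one_mul, h]

namespace Mould

/-- The product of a mould by the multiplicative character of words given by `c` on letters. -/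
noncomputable def twist (c : ℕ → ℂ) (A : List ℕ → ℂ) : List ℕ → ℂ := fun s => (s.map c).prod * A s

theorem mouldMul_twist (c : ℕ → ℂ) (A B : List ℕ → ℂ) :
    mouldMul (twist c A) (twist c B) = twist c (mouldMul A B) := by
  funext s
  simp only [mouldMul, twist, mul_sum]
  refine sum_congr rfl fun i _ => ?_
  have : (s.map c).prod = ((s.take i).map c).prod * ((s.drop i).map c).prod := by
    rw [← List.prod_append, ← List.map_append, List.take_append_drop]
  rw [this]
  ring

theorem twist_mouldOne (c : ℕ → ℂ) : twist c mouldOne = mouldOne := by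
  funext s
  cases s <;> simp [twist, mouldOne]

theorem mouldLog_twist (c : ℕ → ℂ) (A : List ℕ → ℂ) (s : List ℕ) :
    mouldLog (twist c A) s = (s.map c).prod * mouldLog A s := by
  have h1 : (fun t => twist c A t - mouldOne t) = twist c fun t => A t - mouldOne t := by
    funext t
    conv_lhs => rw [← twist_mouldOne c]
    simp only [twist, mul_sub]
  have h2 : ∀ (B : List ℕ → ℂ) k, mouldPow (twist c B) k = twist c (mouldPow B k) := by
    intro B k
    induction k with
    | zero => exact (twist_mouldOne c).symm
    | succ k ih => simp only [mouldPow, ih, mouldMul_twist]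
  simp only [mouldLog, h1, h2, mul_sum]
  exact sum_congr rfl fun k _ => by rw [twist]; ring

end Mould

/-- The character of words that restricts to the words on which multitangents converge. -/
noncomputable def convergent (a : ℕ) : ℂ := if 2 ≤ a then 1 else 0

theorem prod_convergent {s : List ℕ} (hs : ∀ a ∈ s, 2 ≤ a) : (s.map convergent).prod = 1 :=
  List.prod_eq_one fun x hx => by
    obtain ⟨a, ha, rfl⟩ := List.mem_map.1 hx
    exact if_pos (hs a ha)

theorem prod_convergent_mul {s : List ℕ} (hs : ∀ a ∈ s, 2 ≤ a) :
    (s.map fun a => convergent a * (-1) ^ (a + 1)).prod = (-1) ^ (s.sum + s.length) := by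
  induction s with
  | nil => simp
  | cons a s ih =>
    simp only [List.mem_cons, forall_eq_or_imp] at hs
    rw [List.map_cons, List.prod_cons, ih hs.2, convergent, if_pos hs.1, one_mul, ← pow_add]
    simp only [List.sum_cons, List.length_cons]
    congr 1
    ring

/-- Up to signs, `Ta (-z)` is the inverse of `Ta z` for mould multiplication: the
reflection `n ↦ -n` reverses the order of summation. -/
theorem twist_Ta_mul_twist_Ta_neg (z : ℂ) :
    Mould.of (Mould.twist convergent (Ta z)) *
      Mould.of (Mould.twist (fun a => convergent a * (-1) ^ (a + 1)) (Ta (-z))) = 1 := by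
  refine Mould.ext fun s => ?_
  by_cases hs : ∀ a ∈ s, 2 ≤ a
  · rw [← multiSum_one z s, ← Mould.clusterWeight_ge_mul_sign,
      multiSum_mul z hs (Mould.norm_clusterWeight_le _) (D := 1)]
    · refine sum_congr rfl fun i _ => ?_
      have h1 : ∀ a ∈ s.take i, 2 ≤ a := fun a ha => hs a (List.mem_of_mem_take ha)
      have h2 : ∀ a ∈ s.drop i, 2 ≤ a := fun a ha => hs a (List.mem_of_mem_drop ha)
      simp only [Mould.of_apply, Mould.twist]
      rw [prod_convergent h1, prod_convergent_mul h2, Ta_eq_multiSum z h1, Ta_eq_multiSum (-z) h2,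
        multiSum_sign, multiSum_clusterWeight_le, one_mul]
      ring
    · intro n
      rw [Mould.sign, norm_mul, norm_pow, norm_neg, norm_one, one_pow, one_mul]
      exact Mould.norm_clusterWeight_le _ n
  · push Not at hs
    obtain ⟨a, ha, ha2⟩ := hs
    have h0 : convergent a = 0 := if_neg (by omega)
    rw [show (1 : Mould ℕ) s = 0 by cases s with
      | nil => simp at ha
      | cons b s => rfl]
    refine sum_eq_zero fun i _ => ?_
    simp only [Mould.of_apply, Mould.twist]
    rw [← List.take_append_drop i s, List.mem_append] at ha
    rcases ha with ha | ha
    · rw [List.prod_eq_zero (List.mem_map.2 ⟨a, ha, h0⟩)]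
      simp
    · rw [List.prod_eq_zero (l := (s.drop i).map _) (List.mem_map.2 ⟨a, ha, by rw [h0, zero_mul]⟩)]
      simp

/-- The parity of alternal multitangents. -/
theorem Tan_neg (z : ℂ) {s : List ℕ} (hs : ∀ a ∈ s, 2 ≤ a) :
    Tan (-z) s = (-1) ^ (s.sum + s.length + 1) * Tan z s := by
  have h := Mould.mouldLog_of_mul_eq_one (by simp [Mould.twist, Ta_nil])
    (twist_Ta_mul_twist_Ta_neg z) s
  rw [Mould.mouldLog_twist, Mould.mouldLog_twist, prod_convergent hs, prod_convergent_mul hs,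
    one_mul] at h
  rw [Tan, Tan, h, pow_succ]
  have : ((-1 : ℂ) ^ (s.sum + s.length)) * (-1) ^ (s.sum + s.length) = 1 := by
    rw [← mul_pow]; simp
  linear_combination (-mouldLog (Ta (-z)) s) * this

theorem Ta_conj (z : ℂ) (s : List ℕ) : Ta (conj z) s = conj (Ta z s) := by
  rw [Ta, Ta, Complex.conj_tsum]
  refine tsum_congr fun n => ?_
  simp [map_prod]

theorem mouldLog_conj (M : List ℕ → ℂ) (s : List ℕ) :
    mouldLog (fun t => conj (M t)) s = conj (mouldLog M s) := by
  have h : ∀ (A : List ℕ → ℂ) k s, mouldPow (fun t => conj (A t)) k s = conj (mouldPow A k s) := by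
    intro A k
    induction k with
    | zero => intro s; cases s <;> simp [mouldPow, mouldOne]
    | succ k ih => intro s; simp [mouldPow, mouldMul, ih]
  have h1 : (fun t => conj (M t) - mouldOne t) = fun t => conj (M t - mouldOne t) := by
    funext t
    cases t <;> simp [mouldOne]
  simp only [mouldLog, h1, h, map_sum, map_mul, map_div₀, map_pow, map_neg, map_one, map_natCast]

theorem Tan_conj (z : ℂ) (s : List ℕ) : Tan (conj z) s = conj (Tan z s) := by
  rw [Tan, Tan, ← mouldLog_conj]
  congr 1
  exact funext fun t => Ta_conj z t

/-! ### Estimates for tangent sums -/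

theorem eventually_atVerticalInfinity {p : ℂ → Prop} :
    (∀ᶠ z in atVerticalInfinity, p z) ↔ ∃ K : ℝ, ∀ z : ℂ, K < |z.im| → p z := by
  rw [atVerticalInfinity, eventually_comap]
  constructor
  · intro h
    obtain ⟨K, hK⟩ := eventually_atTop.1 h
    exact ⟨K, fun z hz => hK _ hz.le z rfl⟩
  · rintro ⟨K, hK⟩
    filter_upwards [eventually_gt_atTop K] with y hy z hz
    exact hK z (by rwa [hz])

theorem summable_inv_sq_add_single (c : ℝ) :
    Summable fun n : ℤ => c * (1 / (n : ℝ) ^ 2) + (Pi.single 0 c : ℤ → ℝ) n :=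
  ((Real.summable_one_div_int_pow.2 one_lt_two).mul_left c).add (hasSum_pi_single 0 c).summable

theorem two_div_sq_add_sq_le {y : ℝ} (hy : 1 ≤ y) (n : ℤ) :
    2 / ((n : ℝ) ^ 2 + y ^ 2) ≤ 2 * (1 / (n : ℝ) ^ 2) + (Pi.single 0 2 : ℤ → ℝ) n := by
  by_cases hn : n = 0
  · subst hn
    simp only [Int.cast_zero, Pi.single_eq_same, ne_eq, OfNat.ofNat_ne_zero, not_false_eq_true,
      zero_pow, zero_add, div_zero, mul_zero]
    rw [div_le_iff₀ (by positivity)]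
    nlinarith
  · have hn' : 0 < (n : ℝ) ^ 2 := by positivity
    simp only [Pi.single_eq_of_ne hn, add_zero]
    rw [mul_one_div]
    exact div_le_div_of_nonneg_left two_pos.le hn' (by nlinarith)

theorem tendsto_tsum_inv_sq_add_sq :
    Tendsto (fun y : ℝ => ∑' n : ℤ, 2 / ((n : ℝ) ^ 2 + y ^ 2)) atTop (𝓝 0) := by
  have := tendsto_tsum_of_dominated_convergence (𝓕 := atTop)
    (f := fun (y : ℝ) (n : ℤ) => 2 / ((n : ℝ) ^ 2 + y ^ 2)) (g := fun _ => 0)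
    (summable_inv_sq_add_single 2) ?_ ?_
  · simpa using this
  · intro n
    refine Tendsto.const_div_atTop ?_ 2
    exact tendsto_atTop_add_const_left _ _ (tendsto_pow_atTop two_ne_zero)
  · filter_upwards [eventually_ge_atTop 1] with y hy n
    rw [Real.norm_of_nonneg (by positivity)]
    exact two_div_sq_add_sq_le hy n

/-- The majorant `∑ ‖n + z‖⁻²` tends to zero as `|Im z| → ∞`, uniformly in `Re z`. -/
theorem tendsto_normTangent_two :
    Tendsto (fun z => normTangent z 2) atVerticalInfinity (𝓝 0) := by
  refine squeeze_zero' (Eventually.of_forall fun z => normTangent_nonneg z 2) ?_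
    (tendsto_tsum_inv_sq_add_sq.comp tendsto_comap)
  refine eventually_atVerticalInfinity.2 ⟨2, fun z hz => ?_⟩
  rw [Function.comp_apply, normTangent, ← (Equiv.subRight ⌊z.re⌋).tsum_eq]
  have hy : 2 ≤ |z.im| ^ 2 := by nlinarith
  have hle : ∀ n : ℤ, ‖((((n - ⌊z.re⌋ : ℤ) : ℂ) + z) ^ 2)⁻¹‖ ≤
      2 / ((n : ℝ) ^ 2 + |z.im| ^ 2) := by
    intro n
    rw [norm_inv, norm_pow, ← Complex.normSq_eq_norm_sq, Complex.normSq_apply, ← one_div,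
      div_le_div_iff₀ _ (by positivity)]
    · have h1 := Int.fract_nonneg z.re
      have h2 := (Int.fract_lt_one z.re).le
      rw [Int.fract] at h1 h2
      rw [sq_abs] at hy ⊢
      have h3 : (((n - ⌊z.re⌋ : ℤ) : ℂ) + z).re = n - ⌊z.re⌋ + z.re := by simp
      have h4 : (((n - ⌊z.re⌋ : ℤ) : ℂ) + z).im = z.im := by simp
      rw [h3, h4]
      nlinarith [sq_nonneg ((n : ℝ) + 2 * (z.re - ⌊z.re⌋))]
    · have h4 : (((n - ⌊z.re⌋ : ℤ) : ℂ) + z).im = z.im := by simp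
      rw [h4]
      rw [sq_abs] at hy
      nlinarith [mul_self_nonneg ((((n - ⌊z.re⌋ : ℤ) : ℂ) + z).re)]
  have h2 : Summable fun n : ℤ => 2 / ((n : ℝ) ^ 2 + |z.im| ^ 2) :=
    Summable.of_nonneg_of_le (fun n => by positivity)
      (fun n => two_div_sq_add_sq_le (by linarith) n) (summable_inv_sq_add_single 2)
  have h1 : Summable fun n : ℤ => ‖((((n - ⌊z.re⌋ : ℤ) : ℂ) + z) ^ 2)⁻¹‖ :=
    Summable.of_nonneg_of_le (fun _ => norm_nonneg _) hle h2
  exact h1.tsum_le_tsum hle h2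

theorem tendsto_normTangent {a : ℕ} (ha : 2 ≤ a) :
    Tendsto (fun z => normTangent z a) atVerticalInfinity (𝓝 0) := by
  refine squeeze_zero' (Eventually.of_forall fun z => normTangent_nonneg z a) ?_
    tendsto_normTangent_two
  refine eventually_atVerticalInfinity.2 ⟨1, fun z hz => ?_⟩
  refine (summable_norm_inv_pow z ha).tsum_le_tsum (fun n => ?_) (summable_norm_inv_pow z le_rfl)
  have h1 : 1 ≤ ‖(n : ℂ) + z‖ := by
    refine hz.le.trans ?_
    have := Complex.abs_im_le_norm ((n : ℂ) + z)
    simpa using this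
  rw [norm_inv, norm_inv, norm_pow, norm_pow]
  exact inv_anti₀ (by positivity) (pow_le_pow_right₀ h1 ha)

/-- Near the origin the terms with `n ≠ 0` of a monotangent are dominated by those of a convergent
series. -/
theorem norm_inv_pow_le {z : ℂ} (hz : ‖z‖ ≤ 1 / 2) {a : ℕ} (ha : 2 ≤ a) {n : ℤ} (hn : n ≠ 0) :
    ‖(((n : ℂ) + z) ^ a)⁻¹‖ ≤ 2 ^ a * (1 / (n : ℝ) ^ 2) := by
  have h1 : (1 : ℝ) ≤ |(n : ℝ)| := by exact_mod_cast Int.one_le_abs hn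
  have h2 : |(n : ℝ)| / 2 ≤ ‖(n : ℂ) + z‖ := by
    have := norm_sub_le_norm_add (n : ℂ) z
    rw [Complex.norm_intCast] at this
    linarith
  rw [norm_inv, norm_pow, ← sq_abs (n : ℝ)]
  calc (‖(n : ℂ) + z‖ ^ a)⁻¹ ≤ ((|(n : ℝ)| / 2) ^ a)⁻¹ :=
        inv_anti₀ (by positivity) (pow_le_pow_left₀ (by positivity) h2 a)
    _ = 2 ^ a * (1 / |(n : ℝ)| ^ a) := by rw [div_pow, inv_div, mul_one_div]
    _ ≤ 2 ^ a * (1 / |(n : ℝ)| ^ 2) := by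
        gcongr

/-- `∑ ‖(n + z)^(-a)‖` has at most a pole of order `a` at the origin. -/
theorem normTangent_mul_le {a : ℕ} (ha : 2 ≤ a) : ∃ C : ℝ, ∀ z : ℂ, ‖z‖ ≤ 1 / 2 → z ≠ 0 →
    ‖z‖ ^ a * normTangent z a ≤ C := by
  have hs : Summable fun n : ℤ => 1 / (n : ℝ) ^ 2 + (Pi.single 0 1 : ℤ → ℝ) n :=
    (Real.summable_one_div_int_pow.2 one_lt_two).add (hasSum_pi_single 0 1).summable
  refine ⟨∑' n : ℤ, (1 / (n : ℝ) ^ 2 + (Pi.single 0 1 : ℤ → ℝ) n), fun z hz hz0 => ?_⟩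
  rw [normTangent, ← tsum_mul_left]
  refine ((summable_norm_inv_pow z ha).mul_left _).tsum_le_tsum (fun n => ?_) hs
  have hz0 : ‖z‖ ≠ 0 := norm_ne_zero_iff.2 hz0
  by_cases hn : n = 0
  · subst hn
    simp [hz0]
  · rw [Pi.single_eq_of_ne hn, add_zero]
    calc ‖z‖ ^ a * ‖(((n : ℂ) + z) ^ a)⁻¹‖ ≤ (1 / 2) ^ a * (2 ^ a * (1 / (n : ℝ) ^ 2)) := by
          gcongr
          exact norm_inv_pow_le hz ha hn
      _ = 1 / (n : ℝ) ^ 2 := by rw [← mul_assoc, ← mul_pow]; norm_num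

/-- The complement of the integers in the complex plane. -/
def nonIntegers : Set ℂ := {z | ∀ n : ℤ, z ≠ n}

theorem isOpen_nonIntegers : IsOpen nonIntegers := by
  have : nonIntegers = (Set.range ((↑) : ℤ → ℂ))ᶜ := by
    ext z
    simp [nonIntegers, eq_comm]
  rw [this]
  exact Complex.isOpen_compl_range_intCast

/-- Around a point that is not an integer, the terms of all tangent sums are bounded, up to a
factor, by their values at the point. -/
theorem exists_ball_norm_inv_pow_le {w : ℂ} (hw : w ∈ nonIntegers) : ∃ r > 0,
    Metric.ball w r ⊆ nonIntegers ∧ ∀ z ∈ Metric.ball w r, ∀ (n : ℤ) (a : ℕ),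
      ‖(((n : ℂ) + z) ^ a)⁻¹‖ ≤ 2 ^ a * ‖(((n : ℂ) + w) ^ a)⁻¹‖ := by
  obtain ⟨d, hd, hball⟩ := Metric.isOpen_iff.1 isOpen_nonIntegers w hw
  refine ⟨d / 2, by positivity, (Metric.ball_subset_ball (by linarith)).trans hball,
    fun z hz n a => ?_⟩
  have h1 : d ≤ ‖(n : ℂ) + w‖ := by
    by_contra! h
    refine hball (a := ((-n : ℤ) : ℂ)) ?_ (-n) rfl
    rw [Metric.mem_ball, dist_comm, dist_eq_norm]
    push_cast
    rwa [sub_neg_eq_add, add_comm]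
  have h3 : 0 < ‖(n : ℂ) + w‖ := hd.trans_le h1
  rw [Metric.mem_ball, dist_eq_norm] at hz
  have h2 : ‖(n : ℂ) + w‖ / 2 ≤ ‖(n : ℂ) + z‖ := by
    have := norm_sub_norm_le ((n : ℂ) + w) (w - z)
    rw [show (n : ℂ) + w - (w - z) = n + z by ring, norm_sub_rev w z] at this
    linarith
  rw [norm_inv, norm_inv, norm_pow, norm_pow]
  calc (‖(n : ℂ) + z‖ ^ a)⁻¹ ≤ ((‖(n : ℂ) + w‖ / 2) ^ a)⁻¹ :=
        inv_anti₀ (by positivity) (pow_le_pow_left₀ (by positivity) h2 a)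
    _ = 2 ^ a * (‖(n : ℂ) + w‖ ^ a)⁻¹ := by rw [div_pow, inv_div, div_eq_mul_inv]

theorem differentiableOn_inv_pow (n : ℤ) (a : ℕ) :
    DifferentiableOn ℂ (fun z : ℂ => (((n : ℂ) + z) ^ a)⁻¹) nonIntegers := by
  intro z hz
  refine DifferentiableAt.differentiableWithinAt ?_
  refine DifferentiableAt.inv (by fun_prop) (pow_ne_zero _ fun h => hz (-n) ?_)
  push_cast
  linear_combination h

theorem differentiableOn_multiSum {s : List ℕ} (hs : ∀ a ∈ s, 2 ≤ a) {A : Mould ℤ} {C : ℝ}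
    (hA : ∀ n, n.length = s.length → ‖A n‖ ≤ C) :
    DifferentiableOn ℂ (fun z => multiSum z s A) nonIntegers := by
  induction s generalizing A with
  | nil => exact differentiableOn_const _
  | cons a s ih =>
    simp only [List.mem_cons, forall_eq_or_imp] at hs
    intro w hw
    obtain ⟨r, hr, hsub, hle⟩ := exists_ball_norm_inv_pow_le hw
    refine DifferentiableAt.differentiableWithinAt ?_
    refine DifferentiableOn.differentiableAt (s := Metric.ball w r) ?_ (Metric.ball_mem_nhds _ hr)
    have hT : ∀ z ∈ Metric.ball w r, ∀ b, 2 ≤ b →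
        normTangent z b ≤ 2 ^ b * normTangent w b := fun z hz b hb => by
      rw [normTangent, normTangent, ← tsum_mul_left]
      exact (summable_norm_inv_pow z hb).tsum_le_tsum (fun n => hle z hz n b)
        ((summable_norm_inv_pow w hb).mul_left _)
    have hprod : ∀ z ∈ Metric.ball w r, ∀ s : List ℕ, (∀ b ∈ s, 2 ≤ b) →
        (s.map (normTangent z)).prod ≤ (s.map fun b => 2 ^ b * normTangent w b).prod ∧
          0 ≤ (s.map (normTangent z)).prod := by
      intro z hz s hs
      refine ⟨?_, List.prod_nonneg fun x hx => ?_⟩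
      · exact List.prod_map_le_prod_map₀ _ _ (fun b _ => normTangent_nonneg z b)
          fun b hb => hT z hz b (hs b hb)
      · obtain ⟨b, _, rfl⟩ := List.mem_map.1 hx
        exact normTangent_nonneg z b
    have hC : 0 ≤ C := (norm_nonneg _).trans (hA (List.replicate (a :: s).length 0) (by simp))
    refine Complex.differentiableOn_tsum_of_summable_norm (u := fun n : ℤ =>
      2 ^ a * ‖(((n : ℂ) + w) ^ a)⁻¹‖ * (C * (s.map fun b => 2 ^ b * normTangent w b).prod))
      (((summable_norm_inv_pow w hs.1).mul_left _).mul_right _) (fun n => ?_) Metric.isOpen_ball ?_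
    · exact ((differentiableOn_inv_pow n a).mono hsub).mul
        ((ih hs.2 (A := A.tail n) fun t ht => hA _ (by simp [ht])).mono hsub)
    · intro n z hz
      rw [norm_mul]
      refine mul_le_mul (hle z hz n a) ?_ (norm_nonneg _) (by positivity)
      refine (norm_multiSum_le z hs.2 (A := A.tail n) fun t ht => hA _ (by simp [ht])).trans ?_
      exact mul_le_mul_of_nonneg_left (hprod z hz s hs.2).1 hC

/-! ### Periodic functions with poles at the integers -/

/-- The functions that are holomorphic outside the integers, have period one and at most a pole at
the origin, and tend to zero as `|Im z| → ∞`. -/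
structure IsTangential (F : ℂ → ℂ) : Prop where
  differentiableOn : DifferentiableOn ℂ F nonIntegers
  periodic : ∀ z, F (z + 1) = F z
  pole : ∃ N : ℕ, (fun z => z ^ N * F z) =O[𝓝[≠] 0] fun _ => (1 : ℂ)
  tendsto : Tendsto F atVerticalInfinity (𝓝 0)

theorem isBigO_pow_mul_of_le {F : ℂ → ℂ} {N M : ℕ} (h : N ≤ M)
    (hF : (fun z => z ^ N * F z) =O[𝓝[≠] 0] fun _ => (1 : ℂ)) :
    (fun z => z ^ M * F z) =O[𝓝[≠] 0] fun _ => (1 : ℂ) := by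
  have h1 : (fun z : ℂ => z ^ (M - N)) =O[𝓝[≠] 0] fun _ => (1 : ℂ) :=
    (Continuous.tendsto (by fun_prop) 0 : Tendsto (fun z : ℂ => z ^ (M - N)) (𝓝 0) _).isBigO_one ℂ
      |>.mono nhdsWithin_le_nhds
  refine ((h1.mul hF).congr_left fun z => ?_).congr_right fun z => by simp
  rw [← mul_assoc, ← pow_add, Nat.sub_add_cancel h]

namespace IsTangential

variable {F G : ℂ → ℂ}

theorem add (hF : IsTangential F) (hG : IsTangential G) : IsTangential fun z => F z + G z where
  differentiableOn := hF.differentiableOn.add hG.differentiableOn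
  periodic z := by rw [hF.periodic, hG.periodic]
  pole := by
    obtain ⟨N, hN⟩ := hF.pole
    obtain ⟨M, hM⟩ := hG.pole
    refine ⟨max N M, ?_⟩
    simp only [mul_add]
    exact (isBigO_pow_mul_of_le (le_max_left _ _) hN).add
      (isBigO_pow_mul_of_le (le_max_right _ _) hM)
  tendsto := by simpa using hF.tendsto.add hG.tendsto

theorem const_mul (hF : IsTangential F) (c : ℂ) : IsTangential fun z => c * F z where
  differentiableOn := hF.differentiableOn.const_mul c
  periodic z := by rw [hF.periodic]
  pole := by
    obtain ⟨N, hN⟩ := hF.pole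
    exact ⟨N, (hN.const_mul_left c).congr_left fun z => by ring⟩
  tendsto := by simpa using hF.tendsto.const_mul c

theorem mul (hF : IsTangential F) (hG : IsTangential G) : IsTangential fun z => F z * G z where
  differentiableOn := hF.differentiableOn.mul hG.differentiableOn
  periodic z := by rw [hF.periodic, hG.periodic]
  pole := by
    obtain ⟨N, hN⟩ := hF.pole
    obtain ⟨M, hM⟩ := hG.pole
    exact ⟨N + M, ((hN.mul hM).congr_left fun z => by ring).congr_right fun z => by simp⟩
  tendsto := by simpa using hF.tendsto.mul hG.tendsto

theorem zero : IsTangential fun _ => 0 where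
  differentiableOn := differentiableOn_const _
  periodic _ := rfl
  pole := ⟨0, by simpa using Asymptotics.isBigO_zero (E' := ℂ) (fun _ : ℂ => (1 : ℂ)) (𝓝[≠] (0 : ℂ))⟩
  tendsto := tendsto_const_nhds

theorem sum {ι : Type*} {s : Finset ι} {f : ι → ℂ → ℂ} (h : ∀ i ∈ s, IsTangential (f i)) :
    IsTangential fun z => ∑ i ∈ s, f i z := by
  classical
  induction s using Finset.induction_on with
  | empty => simpa using zero
  | insert a s ha ih =>
    simp only [sum_insert ha]
    exact (h a (mem_insert_self _ _)).add (ih fun i hi => h i (mem_insert_of_mem hi))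

end IsTangential

theorem mapLetters_clusterWeight_ge :
    (Mould.clusterWeight (· ≥ ·)).mapLetters (· - 1) = Mould.clusterWeight (· ≥ ·) :=
  Mould.ext fun n => by
    rw [Mould.mapLetters, Mould.clusterWeight_map (sub_left_injective)]
    simp only [ge_iff_le, sub_le_sub_iff_right]

theorem isTangential_multiSum {s : List ℕ} (hs : ∀ a ∈ s, 2 ≤ a) (hs0 : s ≠ []) :
    IsTangential fun z => multiSum z s (Mould.clusterWeight (· ≥ ·)) where
  differentiableOn := differentiableOn_multiSum hs fun n _ => Mould.norm_clusterWeight_le _ n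
  periodic z := by rw [multiSum_add_one, mapLetters_clusterWeight_ge]
  pole := by
    have h : ∃ C : ℝ, ∀ z : ℂ, ‖z‖ ≤ 1 / 2 → z ≠ 0 →
        ‖z‖ ^ s.sum * (s.map (normTangent z)).prod ≤ C := by
      clear hs0
      induction s with
      | nil => exact ⟨1, fun z _ _ => by simp⟩
      | cons a s ih =>
        simp only [List.mem_cons, forall_eq_or_imp] at hs
        obtain ⟨C, hC⟩ := ih hs.2
        obtain ⟨D, hD⟩ := normTangent_mul_le hs.1
        refine ⟨D * C, fun z hz hz0 => ?_⟩
        rw [List.sum_cons, List.map_cons, List.prod_cons, pow_add, mul_mul_mul_comm]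
        have h0 : 0 ≤ (s.map (normTangent z)).prod := List.prod_nonneg fun x hx => by
          obtain ⟨b, _, rfl⟩ := List.mem_map.1 hx
          exact normTangent_nonneg z b
        have h1 := normTangent_nonneg z a
        exact mul_le_mul (hD z hz hz0) (hC z hz hz0) (by positivity)
          (le_trans (by positivity) (hD z hz hz0))
    obtain ⟨C, hC⟩ := h
    refine ⟨s.sum, Asymptotics.IsBigO.of_bound C ?_⟩
    rw [eventually_nhdsWithin_iff]
    filter_upwards [Metric.closedBall_mem_nhds (0 : ℂ) (by norm_num : (0 : ℝ) < 1 / 2)] with z hz hz0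
    rw [norm_mul, norm_pow, norm_one, mul_one]
    refine le_trans ?_ (hC z (by simpa using hz) hz0)
    gcongr
    simpa using norm_multiSum_le z hs fun n _ => Mould.norm_clusterWeight_le _ n
  tendsto := by
    have h1 : Tendsto (fun z => (s.map fun a => normTangent z a).prod) atVerticalInfinity
        (𝓝 (s.map fun _ => (0 : ℝ)).prod) :=
      tendsto_list_prod (f := fun a z => normTangent z a) s fun a ha =>
        tendsto_normTangent (hs a ha)
    rw [List.prod_eq_zero (by
      obtain ⟨a, ha⟩ := List.exists_mem_of_ne_nil s hs0
      exact List.mem_map.2 ⟨a, ha, rfl⟩)] at h1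
    refine squeeze_zero_norm (fun z => ?_) h1
    simpa using norm_multiSum_le z hs fun n _ => Mould.norm_clusterWeight_le _ n

theorem isTangential_Ta_sub {s : List ℕ} (hs : ∀ a ∈ s, 2 ≤ a) :
    IsTangential fun z => Ta z s - mouldOne s := by
  simp only [fun z => Ta_eq_multiSum z hs]
  cases s with
  | nil => simpa [multiSum_nil, Mould.clusterWeight_nil, mouldOne] using IsTangential.zero
  | cons a s => simpa [mouldOne] using isTangential_multiSum hs (by simp)

theorem isTangential_Tan {s : List ℕ} (hs : ∀ a ∈ s, 2 ≤ a) : IsTangential fun z => Tan z s := by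
  have hpow : ∀ k, ∀ t : List ℕ, (∀ a ∈ t, 2 ≤ a) →
      IsTangential fun z => mouldPow (fun t => Ta z t - mouldOne t) (k + 1) t := by
    intro k
    induction k with
    | zero =>
      intro t ht
      simp only [mouldPow, mouldMul]
      refine IsTangential.sum fun i _ => ?_
      simpa only [mul_comm] using
        (isTangential_Ta_sub fun a ha => ht a (List.mem_of_mem_take (i := i) ha)).const_mul
          (mouldOne (t.drop i))
    | succ k ih =>
      intro t ht
      rw [show (fun z => mouldPow (fun t => Ta z t - mouldOne t) (k + 1 + 1) t) = fun z =>
        ∑ i ∈ range (t.length + 1), (Ta z (t.take i) - mouldOne (t.take i)) *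
          mouldPow (fun t => Ta z t - mouldOne t) (k + 1) (t.drop i) from rfl]
      exact IsTangential.sum fun i _ =>
        (isTangential_Ta_sub fun a ha => ht a (List.mem_of_mem_take ha)).mul
          (ih _ fun a ha => ht a (List.mem_of_mem_drop ha))
  simp only [Tan, mouldLog]
  refine IsTangential.sum fun k hk => IsTangential.const_mul ?_ _
  obtain ⟨j, rfl⟩ : ∃ j, k = j + 1 := ⟨k - 1, by rw [mem_Icc] at hk; omega⟩
  exact hpow j s hs

theorem isTangential_monotangent {a : ℕ} (ha : 2 ≤ a) : IsTangential (monotangent a) := by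
  have h : monotangent a = fun z => multiSum z [a] (Mould.clusterWeight (· ≥ ·)) := by
    funext z
    rw [multiSum_cons, monotangent]
    refine tsum_congr fun n => ?_
    simp [multiSum_nil, Mould.tail, Mould.clusterWeight]
  rw [h]
  exact isTangential_multiSum (by simpa using ha) (by simp)

/-- The principal part of `monotangent a` at the origin is `z ^ (-a)`. -/
theorem pow_mul_monotangent_sub_one {a : ℕ} (ha : 2 ≤ a) :
    (fun z => z ^ a * monotangent a z - 1) =O[𝓝[≠] 0] fun z : ℂ => z ^ a := by
  refine Asymptotics.IsBigO.of_bound (∑' n : ℤ, 2 ^ a * (1 / (n : ℝ) ^ 2)) ?_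
  rw [eventually_nhdsWithin_iff]
  filter_upwards [Metric.closedBall_mem_nhds (0 : ℂ) (by norm_num : (0 : ℝ) < 1 / 2)] with z hz hz0
  have hz : ‖z‖ ≤ 1 / 2 := by simpa using hz
  have hz0 : z ≠ 0 := hz0
  have h1 : z ^ a * monotangent a z - 1 =
      (∑' n : ℤ, if n = 0 then 0 else (((n : ℂ) + z) ^ a)⁻¹) * z ^ a := by
    rw [monotangent, (summable_inv_pow z ha).tsum_eq_add_tsum_ite 0, Int.cast_zero, zero_add,
      mul_add, mul_inv_cancel₀ (pow_ne_zero _ hz0)]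
    ring
  rw [h1, norm_mul]
  gcongr
  refine tsum_of_norm_bounded (((Real.summable_one_div_int_pow.2 one_lt_two).mul_left _).hasSum)
    fun n => ?_
  split_ifs with hn
  · simp [hn]
  · exact norm_inv_pow_le hz ha hn

theorem monotangent_neg (a : ℕ) (z : ℂ) : monotangent a (-z) = (-1) ^ a * monotangent a z := by
  rw [monotangent, monotangent, ← tsum_mul_left, ← (Equiv.neg ℤ).tsum_eq]
  refine tsum_congr fun n => ?_
  rw [Equiv.neg_apply, Int.cast_neg, ← neg_add, neg_pow, mul_inv, ← inv_pow, inv_neg, inv_one]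

theorem monotangent_conj (a : ℕ) (z : ℂ) : monotangent a (conj z) = conj (monotangent a z) := by
  rw [monotangent, monotangent, Complex.conj_tsum]
  exact tsum_congr fun n => by simp

/-! ### Reduction to monotangents -/

theorem eventually_nonIntegers : ∀ᶠ z : ℂ in 𝓝[≠] 0, z ∈ nonIntegers := by
  rw [eventually_nhdsWithin_iff]
  filter_upwards [Metric.ball_mem_nhds (0 : ℂ) one_pos] with z hz hz0 n hn
  rw [Metric.mem_ball, dist_zero_right, hn, Complex.norm_intCast] at hz
  have : n = 0 := Int.abs_lt_one_iff.1 (by exact_mod_cast hz)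
  exact hz0 (by simp [hn, this])

/-- A singularity at the origin weaker than a simple pole is removable. -/
theorem exists_differentiableAt_update {H : ℂ → ℂ} (hd : DifferentiableOn ℂ H nonIntegers)
    (hb : Tendsto (fun z => z * H z) (𝓝[≠] 0) (𝓝 0)) :
    ∃ h : ℂ, DifferentiableAt ℂ (Function.update H 0 h) 0 := by
  refine ⟨limUnder (𝓝[≠] 0) H, ?_⟩
  have h0 : nonIntegers ∈ 𝓝[≠] (0 : ℂ) := eventually_nonIntegers
  refine (Complex.differentiableOn_update_limUnder_insert_of_isLittleO h0 hd ?_).differentiableAt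
    (insert_mem_nhds_iff.2 h0)
  rw [Asymptotics.isLittleO_iff_tendsto']
  · have h1 : Tendsto (fun z : ℂ => z * H 0) (𝓝[≠] 0) (𝓝 0) := by
      have : Tendsto (fun z : ℂ => z * H 0) (𝓝 0) (𝓝 (0 * H 0)) :=
        (continuous_id.mul continuous_const).tendsto 0
      rw [zero_mul] at this
      exact this.mono_left nhdsWithin_le_nhds
    have := hb.sub h1
    rw [sub_zero] at this
    refine this.congr fun z => ?_
    rw [sub_zero, div_inv_eq_mul]
    ring
  · rw [eventually_nhdsWithin_iff]
    exact Eventually.of_forall fun z hz h => absurd h (by simpa using hz)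

/-- A holomorphic function that is bounded near the origin has a limit there, which is
approached at a linear rate. -/
theorem exists_isBigO_sub_of_bounded {H : ℂ → ℂ} (hd : DifferentiableOn ℂ H nonIntegers)
    (hb : H =O[𝓝[≠] 0] fun _ => (1 : ℂ)) :
    ∃ h : ℂ, (fun z => H z - h) =O[𝓝[≠] 0] fun z => z := by
  have hid : Tendsto (fun z : ℂ => z) (𝓝[≠] 0) (𝓝 0) := nhdsWithin_le_nhds
  obtain ⟨h, hh⟩ := exists_differentiableAt_update hd
    (((Asymptotics.isBigO_refl (fun z : ℂ => z) _).mul hb).trans_tendsto (by simpa using hid))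
  refine ⟨h, ?_⟩
  have := hh.isBigO_sub.mono (nhdsWithin_le_nhds (s := {0}ᶜ))
  refine (this.congr' ?_ ?_)
  · rw [EventuallyEq, eventually_nhdsWithin_iff]
    exact Eventually.of_forall fun z hz => by simp [Function.update_of_ne hz]
  · simp

/-- The function `1 / (exp (2πiz) - 1)` plays the role of the missing monotangent of index one. -/
noncomputable def expPole (z : ℂ) : ℂ := (Complex.exp (2 * Real.pi * Complex.I * z) - 1)⁻¹

theorem differentiableOn_expPole : DifferentiableOn ℂ expPole nonIntegers := by
  intro z hz
  refine DifferentiableAt.differentiableWithinAt (DifferentiableAt.inv (by fun_prop) fun h => ?_)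
  obtain ⟨n, hn⟩ := Complex.exp_eq_one_iff.1 (sub_eq_zero.1 h)
  refine hz n (mul_left_cancel₀ Complex.two_pi_I_ne_zero ?_)
  rw [hn]
  ring

theorem expPole_add_one (z : ℂ) : expPole (z + 1) = expPole z := by
  rw [expPole, mul_add, mul_one, Complex.exp_periodic, expPole]

theorem tendsto_mul_expPole :
    Tendsto (fun z => z * expPole z) (𝓝[≠] 0) (𝓝 (2 * Real.pi * Complex.I)⁻¹) := by
  have h : HasDerivAt (fun z : ℂ => Complex.exp (2 * Real.pi * Complex.I * z))
      (2 * Real.pi * Complex.I) 0 := by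
    have := ((hasDerivAt_id (0 : ℂ)).const_mul (2 * Real.pi * Complex.I)).cexp
    simpa using this
  have h2 := (hasDerivAt_iff_tendsto_slope.1 h).inv₀ Complex.two_pi_I_ne_zero
  refine h2.congr fun z => ?_
  rw [slope_def_field, expPole]
  simp only [mul_zero, Complex.exp_zero, sub_zero, inv_div]
  rw [div_eq_mul_inv]

theorem norm_exp_two_pi (z : ℂ) :
    ‖Complex.exp (2 * Real.pi * Complex.I * z)‖ = Real.exp (-(2 * Real.pi * z.im)) := by
  rw [Complex.norm_exp]
  congr 1
  simp [Complex.mul_re, Complex.mul_im]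

theorem norm_expPole_le {z : ℂ} (hz : 1 < |z.im|) : ‖expPole z‖ ≤ 2 := by
  have h1 : 1 / 2 ≤ ‖Complex.exp (2 * Real.pi * Complex.I * z) - 1‖ := by
    have h2 := abs_norm_sub_norm_le (Complex.exp (2 * Real.pi * Complex.I * z)) 1
    rw [norm_exp_two_pi, norm_one] at h2
    refine le_trans ?_ h2
    have hpi := Real.pi_gt_three
    rcases lt_abs.1 hz with h | h
    · have h3 : Real.exp (-(2 * Real.pi * z.im)) ≤ Real.exp (-1) :=
        Real.exp_le_exp.2 (by nlinarith)
      have h4 : Real.exp (-1) < 1 / 2 := by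
        have := Real.exp_neg_one_lt_d9
        linarith
      rw [abs_sub_comm]
      exact le_trans (by linarith) (le_abs_self _)
    · have h3 := Real.add_one_le_exp (-(2 * Real.pi * z.im))
      exact le_trans (by nlinarith) (le_abs_self _)
  rw [expPole, norm_inv]
  exact (inv_anti₀ (by norm_num) h1).trans (by norm_num)

theorem tendsto_expPole_top :
    Tendsto (fun t : ℝ => expPole (t * Complex.I)) atTop (𝓝 (-1)) := by
  have h1 : Tendsto (fun t : ℝ => Complex.exp (2 * Real.pi * Complex.I * (t * Complex.I))) atTop
      (𝓝 0) := by
    rw [tendsto_zero_iff_norm_tendsto_zero]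
    simp only [norm_exp_two_pi]
    refine Real.tendsto_exp_neg_atTop_nhds_zero.comp ?_
    simpa using (tendsto_id (α := ℝ)).const_mul_atTop Real.two_pi_pos
  have h2 := (h1.sub_const 1).inv₀ (by norm_num)
  refine (h2.congr fun t => rfl).trans (by norm_num)

theorem tendsto_expPole_bot :
    Tendsto (fun t : ℝ => expPole (-t * Complex.I)) atTop (𝓝 0) := by
  have h1 : Tendsto (fun t : ℝ => ‖Complex.exp (2 * Real.pi * Complex.I * (-t * Complex.I)) - 1‖)
      atTop atTop := by
    have h2 : Tendsto (fun t : ℝ => Real.exp (2 * Real.pi * t) - 1) atTop atTop :=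
      tendsto_atTop_add_const_right _ _
        (Real.tendsto_exp_atTop.comp ((tendsto_id (α := ℝ)).const_mul_atTop Real.two_pi_pos))
    refine tendsto_atTop_mono (fun t => ?_) h2
    have h3 := norm_sub_norm_le (Complex.exp (2 * Real.pi * Complex.I * (-t * Complex.I))) 1
    rw [norm_exp_two_pi, norm_one] at h3
    simpa using h3
  rw [tendsto_zero_iff_norm_tendsto_zero]
  simp only [expPole, norm_inv]
  exact tendsto_inv_atTop_zero.comp h1

theorem tendsto_mul_I_atVerticalInfinity {c : ℝ} (hc : |c| = 1) :
    Tendsto (fun t : ℝ => ((c * t : ℝ) : ℂ) * Complex.I) atTop atVerticalInfinity := by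
  rw [atVerticalInfinity, tendsto_comap_iff]
  refine tendsto_abs_atTop_atTop.congr fun t => ?_
  simp [abs_mul, hc]

theorem mem_nonIntegers_of_im_ne_zero {z : ℂ} (hz : z.im ≠ 0) : z ∈ nonIntegers := by
  rintro n rfl
  simp at hz

/-- A tangential function with at most simple poles vanishes: after subtraction of
a multiple of `1 / (exp (2πiz) - 1)` it is entire and bounded, and the limits at both ends of
the imaginary axis force the residue to vanish. -/
theorem IsTangential.eq_zero_of_simple_pole {F : ℂ → ℂ} (hF : IsTangential F)
    (hb : (fun z => z * F z) =O[𝓝[≠] 0] fun _ => (1 : ℂ)) {z : ℂ} (hz : z ∈ nonIntegers) :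
    F z = 0 := by
  classical
  have hid : Tendsto (fun z : ℂ => z) (𝓝[≠] 0) (𝓝 0) := nhdsWithin_le_nhds
  obtain ⟨h, hh⟩ := exists_isBigO_sub_of_bounded
    (differentiableOn_id.mul hF.differentiableOn) hb
  have hlim : Tendsto (fun z => z * F z) (𝓝[≠] 0) (𝓝 h) := by
    have := (hh.trans_tendsto hid).add_const h
    rw [zero_add] at this
    exact this.congr fun z => by simp
  set c : ℂ := 2 * Real.pi * Complex.I * h with hc
  -- The residue of `expPole` is `(2πi)⁻¹`, so that `G₀` has a removable singularity at the origin.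
  set G₀ : ℂ → ℂ := fun z => F z - c * expPole z with hG₀
  have hG₀d : DifferentiableOn ℂ G₀ nonIntegers :=
    hF.differentiableOn.sub (differentiableOn_expPole.const_mul c)
  have hG₀p : Function.Periodic G₀ 1 := fun z => by
    simp only [hG₀, hF.periodic, expPole_add_one]
  have hG₀l : Tendsto (fun z => z * G₀ z) (𝓝[≠] 0) (𝓝 0) := by
    have h1 := hlim.sub (tendsto_mul_expPole.const_mul c)
    have h2 : h - c * (2 * Real.pi * Complex.I)⁻¹ = 0 := by
      rw [hc, mul_right_comm, mul_inv_cancel₀ Complex.two_pi_I_ne_zero, one_mul, sub_self]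
    rw [h2] at h1
    refine h1.congr fun z => ?_
    simp only [hG₀]
    ring
  obtain ⟨L, hL⟩ := exists_differentiableAt_update hG₀d hG₀l
  set G : ℂ → ℂ := fun z => if z ∈ nonIntegers then G₀ z else L with hG
  have hGp : Function.Periodic G 1 := fun z => by
    have : z + 1 ∈ nonIntegers ↔ z ∈ nonIntegers := by
      refine ⟨fun h n hn => h (n + 1) (by simp [hn]), fun h n hn => h (n - 1) ?_⟩
      push_cast
      rw [← hn]
      ring
    simp only [hG, this, hG₀p z]
  have hGd0 : DifferentiableAt ℂ G 0 := by
    refine hL.congr_of_eventuallyEq ?_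
    filter_upwards [eventually_nhdsWithin_iff.1 eventually_nonIntegers] with w hw
    by_cases h0 : w = 0
    · subst h0
      have : (0 : ℂ) ∉ nonIntegers := fun h => h 0 (by simp)
      simp [hG, this]
    · simp [hG, hw h0, Function.update_of_ne h0]
  have hGd : Differentiable ℂ G := by
    intro w
    by_cases hw : w ∈ nonIntegers
    · refine (hG₀d.differentiableAt (isOpen_nonIntegers.mem_nhds hw)).congr_of_eventuallyEq ?_
      filter_upwards [isOpen_nonIntegers.mem_nhds hw] with u hu
      simp [hG, hu]
    · obtain ⟨n, rfl⟩ : ∃ n : ℤ, w = n := by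
        by_contra! h
        exact hw h
      have h1 : G = fun u => G (u - n) := by
        funext u
        have := hGp.sub_int_mul_eq n (x := u)
        rw [mul_one] at this
        exact this.symm
      rw [h1]
      refine DifferentiableAt.comp (g := G) (f := fun u : ℂ => u - n) _ ?_ (by fun_prop)
      simpa using hGd0
  have hGb : Bornology.IsBounded (Set.range G) := by
    -- By periodicity, only a strip of width one matters: a compact rectangle and two ends.
    obtain ⟨K, hK⟩ := eventually_atVerticalInfinity.1
      (hF.tendsto.norm.eventually (gt_mem_nhds (by simp : ‖(0 : ℂ)‖ < 1)))
    have hcomp : IsCompact (Set.Icc (0 : ℝ) 1 ×ℂ Set.Icc (-max K 1) (max K 1)) :=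
      isCompact_Icc.reProdIm isCompact_Icc
    obtain ⟨B, hB⟩ := hcomp.exists_bound_of_continuousOn hGd.continuous.continuousOn
    refine (Metric.isBounded_closedBall (x := (0 : ℂ)) (r := max B (1 + ‖c‖ * 2))).subset ?_
    rintro _ ⟨u, rfl⟩
    rw [mem_closedBall_zero_iff]
    by_cases hu : |u.im| ≤ max K 1
    · refine le_trans ?_ (le_max_left _ _)
      have h1 := hGp.sub_int_mul_eq ⌊u.re⌋ (x := u)
      rw [mul_one] at h1
      rw [← h1]
      refine hB _ ⟨?_, ?_⟩
      · have h2 := Int.fract_nonneg u.re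
        have h3 := (Int.fract_lt_one u.re).le
        rw [Int.fract] at h2 h3
        rw [Set.mem_preimage, show (u - (⌊u.re⌋ : ℂ)).re = u.re - ⌊u.re⌋ by simp]
        exact ⟨h2, h3⟩
      · have := abs_le.1 hu
        simpa using this
    · refine le_trans ?_ (le_max_right _ _)
      push Not at hu
      have h1 : K < |u.im| := (le_max_left _ _).trans_lt hu
      have h2 : 1 < |u.im| := (le_max_right _ _).trans_lt hu
      have h3 : u ∈ nonIntegers := mem_nonIntegers_of_im_ne_zero fun h => by
        rw [h, abs_zero] at h2
        linarith
      simp only [hG, h3, if_true, hG₀]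
      refine (norm_sub_le _ _).trans (add_le_add (hK u h1).le ?_)
      rw [norm_mul]
      exact mul_le_mul_of_nonneg_left (norm_expPole_le h2) (norm_nonneg _)
  have hconst : ∀ u v, G u = G v := fun u v => hGd.apply_eq_apply_of_bounded hGb u v
  -- `expPole` tends to `-1` at `+i∞` and to `0` at `-i∞`.
  have htop : Tendsto (fun t : ℝ => G (((1 * t : ℝ) : ℂ) * Complex.I)) atTop (𝓝 c) := by
    have h1 := (hF.tendsto.comp (tendsto_mul_I_atVerticalInfinity (c := 1) (by simp))).sub
      (tendsto_expPole_top.const_mul c)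
    rw [zero_sub, mul_neg_one, neg_neg] at h1
    refine h1.congr' ?_
    filter_upwards [eventually_gt_atTop 0] with t ht
    have h3 : (((1 * t : ℝ) : ℂ) * Complex.I) ∈ nonIntegers :=
      mem_nonIntegers_of_im_ne_zero (by simpa using ht.ne')
    simp only [hG, h3, if_true, hG₀]
    simp
  have hbot : Tendsto (fun t : ℝ => G (((-1 * t : ℝ) : ℂ) * Complex.I)) atTop (𝓝 0) := by
    have h1 := (hF.tendsto.comp (tendsto_mul_I_atVerticalInfinity (c := -1) (by simp))).sub
      (tendsto_expPole_bot.const_mul c)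
    rw [zero_sub, mul_zero, neg_zero] at h1
    refine h1.congr' ?_
    filter_upwards [eventually_gt_atTop 0] with t ht
    have h3 : (((-1 * t : ℝ) : ℂ) * Complex.I) ∈ nonIntegers :=
      mem_nonIntegers_of_im_ne_zero (by simpa using ht.ne')
    simp only [hG, h3, if_true, hG₀]
    simp
  have hc1 : G 0 = c := tendsto_nhds_unique (tendsto_const_nhds.congr fun t => hconst 0 _) htop
  have hc2 : G 0 = 0 := tendsto_nhds_unique (tendsto_const_nhds.congr fun t => hconst 0 _) hbot
  have hfin := hconst z 0
  rw [hc2] at hfin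
  simp only [hG, hz, if_true, hG₀] at hfin
  rw [← hc1, hc2] at hfin
  simpa using hfin

/-- The finite combination of monotangents with the coefficients of `p`. -/
noncomputable def monotangentSum (p : Polynomial ℂ) (z : ℂ) : ℂ :=
  p.sum fun a c => c * monotangent a z

theorem monotangentSum_add (p q : Polynomial ℂ) (z : ℂ) :
    monotangentSum (p + q) z = monotangentSum p z + monotangentSum q z :=
  Polynomial.sum_add_index p q _ (fun _ => by simp) fun _ _ _ => by ring

theorem monotangentSum_monomial (a : ℕ) (c z : ℂ) :
    monotangentSum (Polynomial.monomial a c) z = c * monotangent a z :=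
  Polynomial.sum_monomial_index _ _ (by simp)

/-- Existence of the reduction to monotangents, by removing the leading terms of the principal
part at the origin one by one. -/
theorem exists_isMonotangentReduction_of_pole (N : ℕ) : ∀ F : ℂ → ℂ, IsTangential F →
    ((fun z => z ^ N * F z) =O[𝓝[≠] 0] fun _ => (1 : ℂ)) →
    ∃ p, IsMonotangentReduction F p := by
  have hzero : ∀ F : ℂ → ℂ, IsTangential F →
      ((fun z => z * F z) =O[𝓝[≠] 0] fun _ => (1 : ℂ)) → ∃ p, IsMonotangentReduction F p :=
    fun F hF hb => ⟨0, by simp, by simp, fun z hz => by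
      rw [hF.eq_zero_of_simple_pole hb hz, Polynomial.sum_zero_index]⟩
  induction N with
  | zero =>
    intro F hF hb
    exact hzero F hF (by simpa using isBigO_pow_mul_of_le (zero_le_one) hb)
  | succ N ih =>
    intro F hF hb
    rcases Nat.eq_zero_or_pos N with rfl | hN
    · exact hzero F hF (by simpa using hb)
    have ha : 2 ≤ N + 1 := by omega
    obtain ⟨h, hh⟩ := exists_isBigO_sub_of_bounded
      ((differentiableOn_id.pow (N + 1)).mul hF.differentiableOn) hb
    have hT := isTangential_monotangent ha
    have hF' : IsTangential fun z => F z + (-h) * monotangent (N + 1) z :=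
      hF.add (hT.const_mul (-h))
    have hpow : (fun z : ℂ => z ^ (N + 1)) =O[𝓝[≠] 0] fun z => z := by
      have h1 := isBigO_pow_mul_of_le (F := fun _ => 1) (Nat.zero_le N)
        (by simpa using Asymptotics.isBigO_refl (fun _ => (1 : ℂ)) (𝓝[≠] (0 : ℂ)))
      refine ((h1.mul (Asymptotics.isBigO_refl (fun z : ℂ => z) _)).congr_left fun z => ?_).congr_right
        fun z => by simp
      rw [mul_one, pow_succ]
    have h2 := hh.sub (((pow_mul_monotangent_sub_one ha).trans hpow).const_mul_left h)
    have h3 : (fun z => z ^ N * (F z + (-h) * monotangent (N + 1) z)) =O[𝓝[≠] 0]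
        fun _ => (1 : ℂ) := by
      refine ((Asymptotics.isBigO_refl (fun z : ℂ => z⁻¹) _).mul h2).congr' ?_ ?_
      · rw [EventuallyEq, eventually_nhdsWithin_iff]
        refine Eventually.of_forall fun z (hz : z ≠ 0) => ?_
        simp only [Pi.mul_apply, Pi.pow_apply]
        field_simp
        ring
      · rw [EventuallyEq, eventually_nhdsWithin_iff]
        exact Eventually.of_forall fun z (hz : z ≠ 0) => inv_mul_cancel₀ hz
    obtain ⟨p, hp0, hp1, hp⟩ := ih _ hF' h3
    refine ⟨p + Polynomial.monomial (N + 1) h, ?_, ?_, fun z hz => ?_⟩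
    · simp [hp0, Polynomial.coeff_monomial]
    · simp [hp1, Polynomial.coeff_monomial, hN.ne']
    · refine Eq.trans ?_ (monotangentSum_add p _ z).symm
      rw [monotangentSum_monomial, monotangentSum, ← hp z hz]
      ring

/-- The coefficient of highest degree can be read off from the pole at the origin. -/
theorem isBigO_pow_mul_monotangentSum {p : Polynomial ℂ} (h0 : p.coeff 0 = 0) (h1 : p.coeff 1 = 0)
    {N : ℕ} (hN : p.natDegree ≤ N + 1) (hN1 : 1 ≤ N) :
    (fun z => z ^ (N + 1) * monotangentSum p z - p.coeff (N + 1)) =O[𝓝[≠] 0] fun z => z := by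
  have hpow : ∀ k, 1 ≤ k → (fun z : ℂ => z ^ k) =O[𝓝[≠] 0] fun z => z := by
    intro k hk
    have h1 := isBigO_pow_mul_of_le (F := fun _ => 1) (Nat.zero_le (k - 1))
      (by simpa using Asymptotics.isBigO_refl (fun _ => (1 : ℂ)) (𝓝[≠] (0 : ℂ)))
    refine ((h1.mul (Asymptotics.isBigO_refl (fun z : ℂ => z) _)).congr_left fun z => ?_).congr_right
      fun z => by simp
    rw [mul_one, ← pow_succ, Nat.sub_add_cancel hk]
  have hbd : ∀ a, 2 ≤ a → (fun z => z ^ a * monotangent a z) =O[𝓝[≠] 0] fun _ => (1 : ℂ) := by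
    intro a ha
    have h1 : (fun z : ℂ => z) =O[𝓝[≠] 0] fun _ => (1 : ℂ) :=
      Tendsto.isBigO_one (F := ℂ) (f' := fun z : ℂ => z) (c := 0) nhdsWithin_le_nhds
    have h2 := ((pow_mul_monotangent_sub_one ha).trans (hpow a (by omega))).trans h1
    simpa using h2.add (Asymptotics.isBigO_refl (fun _ => (1 : ℂ)) _)
  have hsum : ∀ z, z ^ (N + 1) * monotangentSum p z - p.coeff (N + 1) =
      (∑ a ∈ range (N + 1), p.coeff a * (z ^ (N + 1) * monotangent a z)) +
        p.coeff (N + 1) * (z ^ (N + 1) * monotangent (N + 1) z - 1) := by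
    intro z
    rw [monotangentSum, Polynomial.sum_over_range' p (fun _ => by simp) (N + 2) (by omega),
      sum_range_succ, mul_add, mul_sum]
    rw [sum_congr rfl fun a _ => mul_left_comm (z ^ (N + 1)) (p.coeff a) (monotangent a z)]
    ring
  simp only [hsum]
  refine Asymptotics.IsBigO.add (Asymptotics.IsBigO.fun_sum fun a ha => ?_) ?_
  · rw [mem_range] at ha
    rcases (by omega : a = 0 ∨ a = 1 ∨ 2 ≤ a) with rfl | rfl | ha2
    · simpa [h0] using Asymptotics.isBigO_zero (E' := ℂ) (fun z : ℂ => z) (𝓝[≠] (0 : ℂ))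
    · simpa [h1] using Asymptotics.isBigO_zero (E' := ℂ) (fun z : ℂ => z) (𝓝[≠] (0 : ℂ))
    · refine Asymptotics.IsBigO.const_mul_left ?_ _
      refine (((hpow (N + 1 - a) (by omega)).mul (hbd a ha2)).congr_left fun z => ?_).congr_right
        fun z => mul_one z
      rw [← mul_assoc, ← pow_add, Nat.sub_add_cancel (by omega)]
  · exact ((pow_mul_monotangent_sub_one (by omega)).trans (hpow _ (by omega))).const_mul_left _

/-- The monotangents of index at least two are linearly independent. -/
theorem eq_zero_of_monotangentSum_eq_zero {p : Polynomial ℂ} (h0 : p.coeff 0 = 0)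
    (h1 : p.coeff 1 = 0) (h : ∀ z ∈ nonIntegers, monotangentSum p z = 0) : p = 0 := by
  by_contra hp
  have hd : 2 ≤ p.natDegree := by
    by_contra! hlt
    apply hp
    ext a
    rcases (by omega : a = 0 ∨ a = 1 ∨ 2 ≤ a) with rfl | rfl | ha
    · simpa using h0
    · simpa using h1
    · exact Polynomial.coeff_eq_zero_of_natDegree_lt (by omega)
  obtain ⟨N, hN⟩ : ∃ N, p.natDegree = N + 1 := ⟨p.natDegree - 1, by omega⟩
  have h2 := isBigO_pow_mul_monotangentSum h0 h1 hN.le (by omega)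
  have h3 : Tendsto (fun _ : ℂ => -p.coeff (N + 1)) (𝓝[≠] (0 : ℂ)) (𝓝 0) := by
    refine (h2.trans_tendsto nhdsWithin_le_nhds).congr' ?_
    filter_upwards [eventually_nonIntegers] with z hz
    rw [h z hz, mul_zero, zero_sub]
  have h4 := tendsto_nhds_unique h3 tendsto_const_nhds
  rw [← hN, zero_eq_neg] at h4
  exact hp (Polynomial.leadingCoeff_eq_zero.1 h4)

theorem monotangentReduction_unique {F : ℂ → ℂ} {p q : Polynomial ℂ}
    (hp : IsMonotangentReduction F p) (hq : IsMonotangentReduction F q) : p = q := by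
  have hneg : ∀ z, monotangentSum (-q) z = -monotangentSum q z := fun z => by
    rw [eq_neg_iff_add_eq_zero, ← monotangentSum_add]
    simp [monotangentSum]
  rw [← sub_eq_zero]
  refine eq_zero_of_monotangentSum_eq_zero (by simp [hp.1, hq.1]) (by simp [hp.2.1, hq.2.1])
    fun z hz => ?_
  rw [sub_eq_add_neg, monotangentSum_add, hneg]
  exact add_neg_eq_zero.2 ((hp.2.2 z hz).symm.trans (hq.2.2 z hz))

theorem existsUnique_isMonotangentReduction {F : ℂ → ℂ} (hF : IsTangential F) :
    ∃! p, IsMonotangentReduction F p := by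
  obtain ⟨N, hN⟩ := hF.pole
  obtain ⟨p, hp⟩ := exists_isMonotangentReduction_of_pole N F hF hN
  exact ⟨p, hp, fun q hq => monotangentReduction_unique hq hp⟩

/-! ### The two symmetries -/

/-- The ring homomorphism `χ` is the identity or complex conjugation, so that `z ↦ -χ z` is
the symmetry that underlies reflexivity or counitariness. -/
def IsIdOrConj (χ : ℂ →+* ℂ) : Prop := χ = RingHom.id ℂ ∨ χ = starRingEnd ℂ

namespace IsIdOrConj

variable {χ : ℂ →+* ℂ}

theorem apply_apply (hχ : IsIdOrConj χ) (z : ℂ) : χ (χ z) = z := by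
  rcases hχ with rfl | rfl <;> simp

theorem norm_apply (hχ : IsIdOrConj χ) (z : ℂ) : ‖χ z‖ = ‖z‖ := by
  rcases hχ with rfl | rfl <;> simp

theorem abs_im_apply (hχ : IsIdOrConj χ) (z : ℂ) : |(χ z).im| = |z.im| := by
  rcases hχ with rfl | rfl <;> simp

theorem continuous (hχ : IsIdOrConj χ) : Continuous χ := by
  rcases hχ with rfl | rfl
  · exact continuous_id
  · exact Complex.continuous_conj

theorem neg_mem_nonIntegers (hχ : IsIdOrConj χ) {z : ℂ} (hz : z ∈ nonIntegers) :
    -χ z ∈ nonIntegers := fun n hn => hz (-n) (by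
  rw [← hχ.apply_apply z, ← neg_neg (χ z), hn]
  simp)

end IsIdOrConj

/-- Invariance of a function on `ℂ ∖ ℤ` under the symmetry attached to `χ`. -/
def HasParityFun (χ : ℂ →+* ℂ) (F : ℂ → ℂ) : Prop := ∀ z ∈ nonIntegers, χ (F (-χ z)) = F z

/-- Invariance of a coefficient sequence under the symmetry attached to `χ`. -/
def HasParitySeq (χ : ℂ →+* ℂ) (c : ℕ → ℂ) : Prop := ∀ d, χ (c d) = (-1) ^ d * c d

theorem hasParityFun_id_iff {F : ℂ → ℂ} : HasParityFun (RingHom.id ℂ) F ↔ IsEvenFun F := Iff.rfl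

theorem hasParityFun_conj_iff {F : ℂ → ℂ} : HasParityFun (starRingEnd ℂ) F ↔ IsCoevenFun F :=
  Iff.rfl

theorem hasParitySeq_id_iff {c : ℕ → ℂ} : HasParitySeq (RingHom.id ℂ) c ↔ IsEvenSeq c := by
  refine forall_congr' fun d => ?_
  rcases Nat.even_or_odd d with h | h
  · simp [h.neg_one_pow, Nat.not_odd_iff_even.2 h]
  · simp only [RingHom.id_apply, h.neg_one_pow, neg_one_mul, h, true_imp_iff]
    exact self_eq_neg

theorem hasParitySeq_conj_iff {c : ℕ → ℂ} : HasParitySeq (starRingEnd ℂ) c ↔ IsCoevenSeq c := by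
  refine forall_congr' fun d => ?_
  rcases Nat.even_or_odd d with h | h
  · simp [h.neg_one_pow, Nat.not_odd_iff_even.2 h, h, Complex.conj_eq_iff_im]
  · simp only [h.neg_one_pow, neg_one_mul, h, Nat.not_even_iff_odd.2 h, true_imp_iff,
      false_imp_iff, true_and]
    rw [Complex.ext_iff]
    simp [self_eq_neg]

/-! ### Parity of the infinitesimal collector -/

/-- The polynomial whose coefficients are the numbers `deltaCoeff` is homogeneous of degree
`r - 1`. -/
theorem sum_eq_of_deltaCoeff_ne_zero {r : ℕ} {l : Fin r → ℕ} (h : deltaCoeff l ≠ 0) :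
    ∑ i, l i = r - 1 := by
  have h1 : (∏ j ∈ univ.filter (fun j : Fin r => (j : ℕ) + 1 < r),
      ∑ i ∈ Iic j, (MvPolynomial.X i : MvPolynomial (Fin r) ℤ)).IsHomogeneous
        (∑ j ∈ univ.filter (fun j : Fin r => (j : ℕ) + 1 < r), 1) :=
    MvPolynomial.IsHomogeneous.prod _ _ _ fun j _ =>
      MvPolynomial.IsHomogeneous.sum _ _ _ fun i _ => MvPolynomial.isHomogeneous_X _ _
  have h2 := h1 h
  rw [Finsupp.weight_apply, Finsupp.sum_fintype _ _ (by simp)] at h2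
  simp only [Finsupp.equivFunOnFinite_symm_apply_apply, Pi.one_apply, smul_eq_mul, mul_one,
    sum_const] at h2
  rw [h2]
  cases r with
  | zero => rfl
  | succ r =>
    simp only [add_lt_add_iff_right, add_tsub_cancel_right]
    simp [Fin.card_filter_val_lt]

theorem Tan_nil (z : ℂ) : Tan z [] = 0 := by simp [Tan, mouldLog]

theorem map_Tan_neg {χ : ℂ →+* ℂ} (hχ : IsIdOrConj χ) (z : ℂ) (s : List ℕ) :
    χ (Tan (-χ z) s) = Tan (-z) s := by
  rcases hχ with rfl | rfl
  · rfl
  · rw [← map_neg, Tan_conj, Complex.conj_conj]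

/-- The coefficients of index `0` and `1` of the generator vanish, so that only the alternal
multitangents with all indices at least `2`, which converge, contribute. -/
theorem collectorTerm_eq_zero {v : PowerSeries ℂ} (h0 : PowerSeries.coeff 0 v = 0)
    (h1 : PowerSeries.coeff 1 v = 0) {r : ℕ} {d l : Fin r → ℕ} (h : ¬ ∀ i, 2 ≤ d i) (z : ℂ) :
    collectorTerm v d l z = 0 := by
  push Not at h
  obtain ⟨i, hi⟩ := h
  rw [collectorTerm, prod_eq_zero (mem_univ i), mul_zero]
  rcases (by omega : d i = 0 ∨ d i = 1) with h | h
  · rw [h, h0, mul_zero]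
  · rw [h, h1, mul_zero]

/-- For a term with indices `d` and `l`, the coefficients of `v` contribute the sign
`(-1) ^ ∑ d`, and `Tan` the sign `(-1) ^ (∑ d + ∑ l + r + 1)`; since `∑ l = r - 1`, these
cancel. -/
theorem hasParityFun_collectorTerm {v : PowerSeries ℂ} (h0 : PowerSeries.coeff 0 v = 0)
    (h1 : PowerSeries.coeff 1 v = 0) {χ : ℂ →+* ℂ} (hχ : IsIdOrConj χ)
    (hv : HasParitySeq χ fun d => PowerSeries.coeff d v) {r : ℕ} (d l : Fin r → ℕ) :
    HasParityFun χ (collectorTerm v d l) := by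
  intro z hz
  by_cases hd : ∀ i, 2 ≤ d i
  swap
  · rw [collectorTerm_eq_zero h0 h1 hd, collectorTerm_eq_zero h0 h1 hd, map_zero]
  by_cases hl : deltaCoeff l = 0
  · simp [collectorTerm, hl]
  rcases Nat.eq_zero_or_pos r with rfl | hr
  · simp [collectorTerm, Tan_nil]
  have hs : ∀ a ∈ List.ofFn fun i => d i + l i, 2 ≤ a := by
    intro a ha
    obtain ⟨i, rfl⟩ := List.mem_ofFn.1 ha
    exact (hd i).trans (Nat.le_add_right _ _)
  have hsum : (List.ofFn fun i => d i + l i).sum = ∑ i, d i + (r - 1) := by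
    rw [List.sum_ofFn, sum_add_distrib, sum_eq_of_deltaCoeff_ne_zero hl]
  have hprod : ∏ i, (-1 : ℂ) ^ d i = (-1) ^ (∑ i, d i) := prod_pow_eq_pow_sum _ _ _
  have hP : ∀ i, χ (((d i + l i - 1)! : ℂ) / ((d i - 1)! : ℂ) * PowerSeries.coeff (d i) v) =
      (-1) ^ d i * (((d i + l i - 1)! : ℂ) / ((d i - 1)! : ℂ) * PowerSeries.coeff (d i) v) := by
    intro i
    have : χ (PowerSeries.coeff (d i) v) = (-1) ^ d i * PowerSeries.coeff (d i) v := hv (d i)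
    rw [map_mul, this, map_div₀, map_natCast, map_natCast]
    ring
  have hsign : (-1 : ℂ) ^ (∑ i, d i + (r - 1) + r + 1) * (-1) ^ (∑ i, d i) = 1 := by
    rw [← pow_add]
    exact Even.neg_one_pow ⟨∑ i, d i + r, by omega⟩
  rw [collectorTerm, collectorTerm, map_mul, map_mul, map_mul, map_prod, prod_congr rfl fun i _ =>
    hP i, prod_mul_distrib, hprod, map_Tan_neg hχ, Tan_neg z hs, hsum, List.length_ofFn, map_pow,
    map_neg, map_one, map_intCast]
  generalize ∏ i, (((d i + l i - 1)! : ℂ) / ((d i - 1)! : ℂ) * PowerSeries.coeff (d i) v) = Q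
  linear_combination ((-1 : ℂ) ^ (r - 1) * (deltaCoeff l : ℂ) *
    Tan z (List.ofFn fun i => d i + l i) * Q) * hsign

theorem hasParityFun_collectorPart {v : PowerSeries ℂ} (h0 : PowerSeries.coeff 0 v = 0)
    (h1 : PowerSeries.coeff 1 v = 0) {χ : ℂ →+* ℂ} (hχ : IsIdOrConj χ)
    (hv : HasParitySeq χ fun d => PowerSeries.coeff d v) (w : ℕ) :
    HasParityFun χ (collectorPart v w) := by
  intro z hz
  simp only [collectorPart, map_sum]
  exact sum_congr rfl fun r _ => sum_congr rfl fun d _ => sum_congr rfl fun l _ =>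
    hasParityFun_collectorTerm h0 h1 hχ hv d l z hz

theorem isTangential_collectorPart {v : PowerSeries ℂ} (h0 : PowerSeries.coeff 0 v = 0)
    (h1 : PowerSeries.coeff 1 v = 0) (w : ℕ) : IsTangential (collectorPart v w) := by
  refine IsTangential.sum fun r _ => IsTangential.sum fun d _ => IsTangential.sum fun l _ => ?_
  by_cases hd : ∀ i, 2 ≤ d i
  · have hs : ∀ a ∈ List.ofFn fun i => d i + l i, 2 ≤ a := by
      intro a ha
      obtain ⟨i, rfl⟩ := List.mem_ofFn.1 ha
      exact (hd i).trans (Nat.le_add_right _ _)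
    have := (isTangential_Tan hs).const_mul ((-1 : ℂ) ^ (r - 1) * (deltaCoeff l : ℂ) *
      ∏ i, (((d i + l i - 1)! : ℂ) / ((d i - 1)! : ℂ) * PowerSeries.coeff (d i) v))
    convert! this using 2 with z
    rw [collectorTerm]
    ring
  · have : collectorTerm v d l = fun _ => 0 := funext (collectorTerm_eq_zero h0 h1 hd)
    rw [this]
    exact IsTangential.zero

/-- A reduction to monotangents inherits the parity of the function. -/
theorem hasParitySeq_of_isMonotangentReduction {χ : ℂ →+* ℂ} (hχ : IsIdOrConj χ) {F : ℂ → ℂ}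
    (hF : HasParityFun χ F) {p : Polynomial ℂ} (hp : IsMonotangentReduction F p) :
    HasParitySeq χ p.coeff := by
  -- The mirror image `q` of `p` is a reduction of the mirror image of `F`, which is `F` itself.
  set q : Polynomial ℂ := ∑ a ∈ range (p.natDegree + 1),
    Polynomial.monomial a ((-1) ^ a * χ (p.coeff a)) with hq
  have hqc : ∀ a, q.coeff a = (-1) ^ a * χ (p.coeff a) := fun a => by
    rw [hq, Polynomial.finsetSum_coeff]
    simp only [Polynomial.coeff_monomial, sum_ite_eq', mem_range]
    split_ifs with ha
    · rfl
    · rw [Polynomial.coeff_eq_zero_of_natDegree_lt (by omega), map_zero, mul_zero]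
  have hdeg : q.natDegree ≤ p.natDegree :=
    Polynomial.natDegree_le_iff_coeff_eq_zero.2 fun a ha => by
      rw [hqc, Polynomial.coeff_eq_zero_of_natDegree_lt ha, map_zero, mul_zero]
  have hmono : ∀ a z, χ (monotangent a (-χ z)) = (-1) ^ a * monotangent a z := by
    intro a z
    rw [← monotangent_neg]
    rcases hχ with rfl | rfl
    · rfl
    · rw [← map_neg, monotangent_conj, Complex.conj_conj]
  have hqF : IsMonotangentReduction F q := by
    refine ⟨by simp [hqc, hp.1], by simp [hqc, hp.2.1], fun z hz => ?_⟩
    rw [← hF z hz, hp.2.2 _ (hχ.neg_mem_nonIntegers hz),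
      Polynomial.sum_over_range p (fun _ => by simp),
      Polynomial.sum_over_range' q (fun _ => by simp) (p.natDegree + 1) (by omega), map_sum]
    refine sum_congr rfl fun a _ => ?_
    rw [map_mul, hmono, hqc]
    ring
  intro d
  have h := hqc d
  rw [← monotangentReduction_unique hp hqF] at h
  have hsq : (-1 : ℂ) ^ d * (-1) ^ d = 1 := by rw [← mul_pow]; simp
  linear_combination (-(-1 : ℂ) ^ d) * h - χ (p.coeff d) * hsq

/-! ### Exponentials of operators on formal power series -/

namespace FormalExp

open PowerSeries

/-- The operator `T` on power series raises the order by at least one. -/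
def Raises (T : Module.End ℂ (PowerSeries ℂ)) : Prop :=
  ∀ n u, (X : PowerSeries ℂ) ^ n ∣ u → X ^ (n + 1) ∣ T u

variable {T S D : Module.End ℂ (PowerSeries ℂ)}

theorem Raises.X_pow_dvd_pow (hT : Raises T) (k : ℕ) {n : ℕ} {u : PowerSeries ℂ}
    (hu : (X : PowerSeries ℂ) ^ n ∣ u) : (X : PowerSeries ℂ) ^ (n + k) ∣ (T ^ k) u := by
  induction k with
  | zero => simpa using hu
  | succ k ih =>
    rw [pow_succ', Module.End.mul_apply]
    exact hT _ _ ih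

theorem Raises.coeff_pow_eq_zero (hT : Raises T) {n k : ℕ} (h : n < k) (u : PowerSeries ℂ) :
    coeff n ((T ^ k) u) = 0 :=
  X_pow_dvd_iff.1 (hT.X_pow_dvd_pow k (n := 0) (by simp)) n (by omega)

/-- The exponential series of `T`, applied to `u`. For an operator that raises the order the
omitted terms have no coefficient of degree `n`. -/
noncomputable def opExp (T : Module.End ℂ (PowerSeries ℂ)) (u : PowerSeries ℂ) : PowerSeries ℂ :=
  mk fun n => ∑ k ∈ range (n + 1), coeff n ((T ^ k) u) / (k ! : ℂ)

theorem coeff_opExp (hT : Raises T) {n M : ℕ} (h : n ≤ M) (u : PowerSeries ℂ) :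
    coeff n (opExp T u) = ∑ k ∈ range (M + 1), coeff n ((T ^ k) u) / (k ! : ℂ) := by
  rw [opExp, coeff_mk]
  refine sum_subset (range_mono (by omega)) fun k _ hk => ?_
  rw [mem_range] at hk
  rw [hT.coeff_pow_eq_zero (by omega), zero_div]

theorem opExp_sub (T : Module.End ℂ (PowerSeries ℂ)) (u v : PowerSeries ℂ) :
    opExp T (u - v) = opExp T u - opExp T v := by
  ext n
  simp [opExp, sub_div, sum_sub_distrib]

theorem opExp_eq_zero_of_dvd (hT : Raises T) {n : ℕ} {u : PowerSeries ℂ}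
    (hu : (X : PowerSeries ℂ) ^ n ∣ u) : (X : PowerSeries ℂ) ^ n ∣ opExp T u := by
  refine X_pow_dvd_iff.2 fun m hm => ?_
  rw [opExp, coeff_mk]
  refine sum_eq_zero fun k _ => ?_
  rw [X_pow_dvd_iff.1 (hT.X_pow_dvd_pow k hu) m (by omega), zero_div]

/-- A truncation of the exponential series. -/
noncomputable def opExpTrunc (T : Module.End ℂ (PowerSeries ℂ)) (M : ℕ) (u : PowerSeries ℂ) :
    PowerSeries ℂ := ∑ k ∈ range (M + 1), (k ! : ℂ)⁻¹ • (T ^ k) u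

theorem X_pow_dvd_opExp_sub (hT : Raises T) (M : ℕ) (u : PowerSeries ℂ) :
    (X : PowerSeries ℂ) ^ (M + 1) ∣ opExp T u - opExpTrunc T M u := by
  refine X_pow_dvd_iff.2 fun n hn => ?_
  rw [map_sub, coeff_opExp hT (M := M) (by omega), opExpTrunc, map_sum, sub_eq_zero]
  refine sum_congr rfl fun k _ => ?_
  rw [map_smul, smul_eq_mul, div_eq_inv_mul]

theorem sum_range_sum_range_eq {A : Type*} [AddCommMonoid A] (M : ℕ) (a : ℕ → ℕ → A)
    (ha : ∀ i j, M < i + j → a i j = 0) :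
    ∑ i ∈ range (M + 1), ∑ j ∈ range (M + 1), a i j =
      ∑ k ∈ range (M + 1), ∑ i ∈ range (k + 1), a i (k - i) := by
  rw [← sum_product']
  rw [sum_sigma']
  refine sum_bij_ne_zero (fun p _ _ => ⟨p.1 + p.2, p.1⟩) ?_ ?_ ?_ ?_
  · rintro ⟨i, j⟩ h1 h2
    have : ¬ M < i + j := fun h => h2 (ha i j h)
    simp
    omega
  · rintro ⟨i, j⟩ _ _ ⟨i', j'⟩ _ _ h
    simp only [Sigma.mk.injEq, heq_eq_eq] at h
    ext <;> simp <;> omega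
  · rintro ⟨k, i⟩ h1 h2
    simp only [mem_sigma, mem_range] at h1
    refine ⟨(i, k - i), by simp; omega, h2, ?_⟩
    simp
    omega
  · rintro ⟨i, j⟩ _ _
    simp

/-- The Leibniz formula for a pair of operators related to a third one by a product rule. -/
theorem pow_apply_mul (h : ∀ u v, D (u * v) = T u * v + u * S v) (k : ℕ) (u v : PowerSeries ℂ) :
    (D ^ k) (u * v) = ∑ i ∈ range (k + 1), k.choose i • ((T ^ i) u * (S ^ (k - i)) v) := by
  induction k generalizing u v with
  | zero => simp
  | succ k ih =>
    rw [pow_succ, Module.End.mul_apply, h, map_add, ih, ih,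
      sum_choose_succ_nsmul (fun i j => (T ^ i) u * (S ^ j) v), add_comm]
    congr 1
    refine sum_congr rfl fun i hi => ?_
    rw [mem_range] at hi
    rw [← Module.End.mul_apply, ← pow_succ, show k - i + 1 = k + 1 - i by omega]

/-- The exponential turns a product rule into multiplicativity. -/
theorem opExp_mul (hT : Raises T) (hS : Raises S) (hD : Raises D)
    (h : ∀ u v, D (u * v) = T u * v + u * S v) (u v : PowerSeries ℂ) :
    opExp D (u * v) = opExp T u * opExp S v := by
  ext n
  have h1 : (X : PowerSeries ℂ) ^ (n + 1) ∣
      opExp T u * opExp S v - opExpTrunc T n u * opExpTrunc S n v := by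
    rw [show opExp T u * opExp S v - opExpTrunc T n u * opExpTrunc S n v =
      (opExp T u - opExpTrunc T n u) * opExp S v +
        opExpTrunc T n u * (opExp S v - opExpTrunc S n v) by ring]
    exact dvd_add (Dvd.dvd.mul_right (X_pow_dvd_opExp_sub hT n u) _)
      (Dvd.dvd.mul_left (X_pow_dvd_opExp_sub hS n v) _)
  have h2 := X_pow_dvd_iff.1 h1 n (by omega)
  rw [map_sub, sub_eq_zero] at h2
  rw [h2, coeff_opExp hD le_rfl, opExpTrunc, opExpTrunc, sum_mul_sum, map_sum]
  simp only [map_sum]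
  rw [sum_range_sum_range_eq]
  · refine sum_congr rfl fun k _ => ?_
    rw [pow_apply_mul h, map_sum, sum_div]
    refine sum_congr rfl fun i hi => ?_
    have hi : i ≤ k := by rw [mem_range] at hi; omega
    rw [smul_mul_smul_comm, map_nsmul, map_smul, nsmul_eq_mul, Nat.cast_choose ℂ hi]
    have := Nat.cast_ne_zero (R := ℂ).2 (Nat.factorial_ne_zero k)
    simp only [smul_eq_mul]
    field_simp
  · intro i j hij
    rw [smul_mul_smul_comm, map_smul]
    have h3 : (X : PowerSeries ℂ) ^ (i + j) ∣ (T ^ i) u * (S ^ j) v := by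
      rw [pow_add]
      exact mul_dvd_mul (by simpa using hT.X_pow_dvd_pow i (n := 0) (u := u) (by simp))
        (by simpa using hS.X_pow_dvd_pow j (n := 0) (u := v) (by simp))
    rw [X_pow_dvd_iff.1 h3 n hij, smul_zero]

theorem Raises.neg (hT : Raises T) : Raises (-T) := fun n u hu => by
  rw [LinearMap.neg_apply]
  exact (hT n u hu).neg_right

theorem opExp_opExp_neg (hT : Raises T) (u : PowerSeries ℂ) : opExp T (opExp (-T) u) = u := by
  ext n
  have h1 : (X : PowerSeries ℂ) ^ (n + 1) ∣
      opExp T (opExp (-T) u) - opExpTrunc T n (opExpTrunc (-T) n u) := by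
    rw [show opExp T (opExp (-T) u) - opExpTrunc T n (opExpTrunc (-T) n u) =
      opExp T (opExp (-T) u - opExpTrunc (-T) n u) +
        (opExp T (opExpTrunc (-T) n u) - opExpTrunc T n (opExpTrunc (-T) n u)) by
        rw [opExp_sub]; ring]
    exact dvd_add (opExp_eq_zero_of_dvd hT (X_pow_dvd_opExp_sub hT.neg n u))
      (X_pow_dvd_opExp_sub hT n _)
  have h2 := X_pow_dvd_iff.1 h1 n (by omega)
  rw [map_sub, sub_eq_zero] at h2
  rw [h2, opExpTrunc, opExpTrunc, map_sum]
  simp only [map_sum, map_smul, smul_sum]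
  rw [sum_range_sum_range_eq]
  · rw [sum_eq_single 0]
    · simp
    · intro k _ hk
      have h3 : ∀ i ∈ range (k + 1), (i ! : ℂ)⁻¹ • ((k - i)! : ℂ)⁻¹ •
          coeff n ((T ^ i) (((-T) ^ (k - i)) u)) =
          (1 : ℂ) ^ i * (-1) ^ (k - i) * (k.choose i) * ((k ! : ℂ)⁻¹ * coeff n ((T ^ k) u)) := by
        intro i hi
        have hi : i ≤ k := by rw [mem_range] at hi; omega
        have h4 : (T ^ i) (((-T) ^ (k - i)) u) = (-1 : ℂ) ^ (k - i) • (T ^ k) u := by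
          rw [← neg_one_smul ℂ T, smul_pow, LinearMap.smul_apply, map_smul, ← Module.End.mul_apply,
            ← pow_add, Nat.add_sub_cancel' hi]
        rw [h4, map_smul, Nat.cast_choose ℂ hi]
        have := Nat.cast_ne_zero (R := ℂ).2 (Nat.factorial_ne_zero k)
        simp only [smul_eq_mul]
        field_simp
        simp
      rw [sum_congr rfl h3, ← sum_mul, ← add_pow]
      simp [hk]
    · simp
  · intro i j hij
    rw [hT.neg.X_pow_dvd_pow |> fun h5 => X_pow_dvd_iff.1 (hT.X_pow_dvd_pow i
      (h5 j (n := 0) (u := u) (by simp))) n (by omega)]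
    simp

/-! ### Exponentials of formal vector fields -/

/-- The derivation `∂_z` raises the order of power series in `z⁻¹`. -/
theorem X_pow_dvd_zDeriv {n : ℕ} {u : PowerSeries ℂ} (hu : (X : PowerSeries ℂ) ^ n ∣ u) :
    (X : PowerSeries ℂ) ^ (n + 1) ∣ zDeriv u := by
  refine Dvd.dvd.neg_right (X_pow_dvd_iff.2 fun m hm => ?_)
  rcases m with _ | _ | m
  · rw [pow_two, mul_assoc]; simp
  · rw [pow_two, mul_assoc, ← pow_one (X : PowerSeries ℂ)]; simp [coeff_succ_X_mul]
  · rw [show m + 1 + 1 = m + 2 from rfl, coeff_X_pow_mul, coeff_derivative, X_pow_dvd_iff.1 hu _ (by omega), zero_mul]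

/-- The operator `v ∂_z`. -/
noncomputable def vectorField (v : PowerSeries ℂ) : Module.End ℂ (PowerSeries ℂ) where
  toFun u := v * zDeriv u
  map_add' u w := by simp [zDeriv]; ring
  map_smul' c u := by
    simp [zDeriv]

theorem vectorField_apply (v u : PowerSeries ℂ) : vectorField v u = v * zDeriv u := rfl

theorem raises_vectorField (v : PowerSeries ℂ) : Raises (vectorField v) := fun _ _ hu =>
  (X_pow_dvd_zDeriv hu).mul_left v

/-- Multiplication by a series, as an operator. -/
noncomputable def mulOp (w : PowerSeries ℂ) : Module.End ℂ (PowerSeries ℂ) := LinearMap.mulLeft ℂ w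

theorem raises_mulOp (w : PowerSeries ℂ) : Raises (mulOp (X * w)) := fun n u hu => by
  rw [mulOp, LinearMap.mulLeft_apply, pow_succ, mul_comm (X ^ n) X, mul_assoc]
  exact mul_dvd_mul_left X (hu.mul_left w)

theorem Raises.add (hT : Raises T) (hS : Raises S) : Raises (T + S) := fun n u hu => by
  rw [LinearMap.add_apply]
  exact dvd_add (hT n u hu) (hS n u hu)

theorem vectorField_mul (v a b : PowerSeries ℂ) :
    vectorField v (a * b) = vectorField v a * b + a * vectorField v b := by
  simp only [vectorField_apply, zDeriv, Derivation.leibniz, smul_eq_mul]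
  ring

theorem vectorField_X (v : PowerSeries ℂ) : vectorField v X = -(X ^ 2 * v) := by
  simp only [vectorField_apply, zDeriv, derivative_X]
  ring

theorem expGenerator_eq (v : PowerSeries ℂ) :
    expGenerator v = mk fun n => ∑ k ∈ range (n + 1),
      coeff n ((vectorField v ^ k) v) / ((k + 1)! : ℂ) := by
  have : ∀ k, (fun ψ => v * zDeriv ψ)^[k] v = (vectorField v ^ k) v := fun k => by
    rw [Module.End.pow_apply]
    rfl
  simp only [expGenerator, this]

/-- `exp(v ∂_z)` acts multiplicatively. -/
theorem opExp_vectorField_mul (v a b : PowerSeries ℂ) :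
    opExp (vectorField v) (a * b) = opExp (vectorField v) a * opExp (vectorField v) b :=
  opExp_mul (raises_vectorField v) (raises_vectorField v) (raises_vectorField v)
    (vectorField_mul v) a b

theorem opExp_one (v : PowerSeries ℂ) : opExp (vectorField v) 1 = 1 := by
  ext n
  rw [opExp, coeff_mk, sum_eq_single 0]
  · simp
  · intro k _ hk
    obtain ⟨j, rfl⟩ := Nat.exists_eq_succ_of_ne_zero hk
    have : vectorField v 1 = 0 := by simp [vectorField_apply, zDeriv]
    rw [pow_succ, Module.End.mul_apply, this, map_zero, map_zero, zero_div]
  · simp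

/-- The formal form of `exp(v ∂_z) z⁻¹ = (exp(v ∂_z) z)⁻¹`. The operators `v ∂_z ∓ v z⁻¹` are the
conjugates of `v ∂_z` by the multiplications with `z⁻¹` and `z`; they replace the series in
which `z` itself occurs. -/
theorem opExp_X_mul (v : PowerSeries ℂ) :
    opExp (vectorField v) X * (1 + X * expGenerator v) = X := by
  set D := vectorField v with hD
  set T := D + mulOp (X * -v) with hT
  set S := D + mulOp (X * v) with hS
  have hTr : Raises T := (raises_vectorField v).add (raises_mulOp _)
  have hSr : Raises S := (raises_vectorField v).add (raises_mulOp _)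
  have hTS : opExp T 1 * opExp S 1 = 1 := by
    rw [← opExp_mul hTr hSr (raises_vectorField v) (fun a b => ?_), mul_one, opExp_one]
    rw [vectorField_mul]
    simp only [hT, hS, mulOp, LinearMap.add_apply, LinearMap.mulLeft_apply]
    ring
  have hTk : ∀ k, (D ^ k) X = X * (T ^ k) 1 := by
    intro k
    induction k with
    | zero => simp
    | succ k ih =>
      rw [pow_succ', Module.End.mul_apply, ih, vectorField_mul, vectorField_X, pow_succ' T,
        Module.End.mul_apply]
      simp only [hT, mulOp, LinearMap.add_apply, LinearMap.mulLeft_apply]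
      ring
  have hSk : ∀ k, (S ^ (k + 1)) 1 = X * (D ^ k) v := by
    intro k
    induction k with
    | zero =>
      simp [hS, hD, mulOp, vectorField_apply, zDeriv]
    | succ k ih =>
      rw [pow_succ', Module.End.mul_apply, ih, pow_succ' D, Module.End.mul_apply]
      simp only [hS, mulOp, LinearMap.add_apply, LinearMap.mulLeft_apply]
      rw [vectorField_mul, vectorField_X]
      ring
  have h1 : opExp D X = X * opExp T 1 := by
    ext n
    rw [opExp, coeff_mk]
    simp only [hTk]
    cases n with
    | zero => simp
    | succ n =>
      simp only [coeff_succ_X_mul]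
      rw [coeff_opExp hTr (Nat.le_succ n)]
  have h2 : opExp S 1 = 1 + X * expGenerator v := by
    ext n
    rw [opExp, coeff_mk, sum_range_succ', expGenerator_eq]
    cases n with
    | zero => simp
    | succ n =>
      simp only [hSk, coeff_succ_X_mul, map_add, coeff_mk]
      simp [coeff_one, hD]
  rw [h1, ← h2, mul_assoc, hTS, mul_one]

/-- The formal flows of `v` and of `-v` are inverse to each other for composition. -/
theorem expGenerator_add_opExp (v : PowerSeries ℂ) :
    expGenerator v + opExp (vectorField v) (expGenerator (-v)) = 0 := by
  set y := opExp (vectorField v) X with hy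
  have hneg : vectorField (-v) = -vectorField v := by
    ext1 u
    simp [vectorField_apply]
  have h1 : y * (1 + X * expGenerator v) = X := opExp_X_mul v
  have h2 : X * (1 + y * opExp (vectorField v) (expGenerator (-v))) = y := by
    have := congrArg (opExp (vectorField v)) (opExp_X_mul (-v))
    rw [opExp_vectorField_mul, hneg, opExp_opExp_neg (raises_vectorField v)] at this
    refine Eq.trans (congrArg (X * ·) ?_) this
    have h3 : opExp (vectorField v) (1 + X * expGenerator (-v)) =
        opExp (vectorField v) 1 + opExp (vectorField v) (X * expGenerator (-v)) := by
      have := opExp_sub (vectorField v) (1 + X * expGenerator (-v)) (X * expGenerator (-v))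
      rw [add_sub_cancel_right] at this
      rw [this]
      ring
    rw [h3, opExp_one, opExp_vectorField_mul]
  have hy0 : y ≠ 0 := by
    rintro h
    rw [h, zero_mul] at h1
    exact X_ne_zero h1.symm
  refine (mul_eq_zero.1 (?_ : X * y * _ = 0)).resolve_left (mul_ne_zero X_ne_zero hy0)
  linear_combination h1 + h2

theorem opExp_injective (v : PowerSeries ℂ) : Function.Injective (opExp (vectorField v)) := by
  intro a b h
  have hneg := opExp_opExp_neg (raises_vectorField v).neg
  rw [neg_neg] at hneg
  rw [← hneg a, ← hneg b, h]

/-- The higher terms of `exp(v ∂_z) z` at a given order depend on `v` at lower orders only. -/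
theorem X_pow_dvd_expGenerator_sub {n : ℕ} {v w : PowerSeries ℂ}
    (h : (X : PowerSeries ℂ) ^ n ∣ v - w) :
    (X : PowerSeries ℂ) ^ (n + 1) ∣ (expGenerator v - v) - (expGenerator w - w) := by
  have step : ∀ a b, (X : PowerSeries ℂ) ^ n ∣ a - b →
      (X : PowerSeries ℂ) ^ (n + 1) ∣ vectorField v a - vectorField w b := by
    intro a b hab
    have h1 : vectorField v a - vectorField w b =
        (v - w) * zDeriv a + vectorField w (a - b) := by
      rw [map_sub, vectorField_apply, vectorField_apply, vectorField_apply]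
      ring
    rw [h1, pow_succ]
    refine dvd_add (mul_dvd_mul h ?_) ?_
    · simpa using X_pow_dvd_zDeriv (n := 0) (u := a) (by simp)
    · rw [← pow_succ]
      exact raises_vectorField w _ _ hab
  have key : ∀ k, (X : PowerSeries ℂ) ^ (n + 1) ∣
      (vectorField v ^ (k + 1)) v - (vectorField w ^ (k + 1)) w := by
    intro k
    induction k with
    | zero => simpa using step v w h
    | succ k ih =>
      rw [pow_succ' (vectorField v), pow_succ' (vectorField w), Module.End.mul_apply, Module.End.mul_apply]
      exact step _ _ ((pow_dvd_pow X (Nat.le_succ n)).trans ih)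
  refine X_pow_dvd_iff.2 fun m hm => ?_
  have h2 : ∀ u : PowerSeries ℂ, coeff m (expGenerator u - u) =
      ∑ k ∈ range m, coeff m ((vectorField u ^ (k + 1)) u) / ((k + 1 + 1)! : ℂ) := by
    intro u
    rw [map_sub, expGenerator_eq, coeff_mk, sum_range_succ']
    simp
  rw [map_sub, h2, h2, sub_eq_zero]
  refine sum_congr rfl fun k _ => ?_
  have := X_pow_dvd_iff.1 (key k) m hm
  rw [map_sub, sub_eq_zero] at this
  rw [this]

theorem coeff_zero_expGenerator (v : PowerSeries ℂ) :
    coeff 0 (expGenerator v) = coeff 0 v := by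
  simp [expGenerator_eq]

theorem coeff_one_expGenerator (v : PowerSeries ℂ) :
    coeff 1 (expGenerator v) = coeff 1 v := by
  have h : (X : PowerSeries ℂ) ^ 2 ∣ vectorField v v :=
    ((Dvd.intro _ rfl).neg_right : X ^ 2 ∣ zDeriv v).mul_left v
  rw [expGenerator_eq, coeff_mk, sum_range_succ, sum_range_one, pow_one,
    X_pow_dvd_iff.1 h 1 one_lt_two]
  simp

theorem expGenerator_injective : Function.Injective expGenerator := by
  intro v w h
  have key : ∀ n, (X : PowerSeries ℂ) ^ n ∣ v - w := by
    intro n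
    induction n with
    | zero => simp
    | succ n ih =>
      have := X_pow_dvd_expGenerator_sub ih
      rw [h, sub_sub_sub_cancel_left] at this
      rw [← neg_sub]
      exact this.neg_right
  ext n
  have := X_pow_dvd_iff.1 (key (n + 1)) n (by omega)
  rwa [map_sub, sub_eq_zero] at this

theorem expGenerator_surjective : Function.Surjective expGenerator := by
  intro c
  let step : PowerSeries ℂ → PowerSeries ℂ := fun v => c - (expGenerator v - v)
  let s : ℕ → PowerSeries ℂ := fun m => step^[m] 0
  have hs : ∀ m, s (m + 1) = c - (expGenerator (s m) - s m) := fun m =>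
    Function.iterate_succ_apply' step m 0
  have hstep : ∀ m, (X : PowerSeries ℂ) ^ m ∣ s (m + 1) - s m := by
    intro m
    induction m with
    | zero => simp
    | succ m ih =>
      rw [hs (m + 1), hs m, sub_sub_sub_cancel_left, ← neg_sub, ← hs m]
      exact (X_pow_dvd_expGenerator_sub ih).neg_right
  have hlim : ∀ m k, (X : PowerSeries ℂ) ^ m ∣ s (m + k) - s m := by
    intro m k
    induction k with
    | zero => simp
    | succ k ih =>
      rw [show s (m + (k + 1)) - s m = (s (m + k + 1) - s (m + k)) + (s (m + k) - s m) by
        rw [← add_assoc]; ring]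
      exact dvd_add ((pow_dvd_pow X (by omega)).trans (hstep (m + k))) ih
  set v : PowerSeries ℂ := mk fun n => coeff n (s (n + 1)) with hv
  have hvs : ∀ m, (X : PowerSeries ℂ) ^ m ∣ v - s m := by
    intro m
    refine X_pow_dvd_iff.2 fun n hn => ?_
    obtain ⟨k, rfl⟩ : ∃ k, m = n + 1 + k := ⟨m - (n + 1), by omega⟩
    have := X_pow_dvd_iff.1 (hlim (n + 1) k) n (by omega)
    rw [map_sub] at this ⊢
    rw [hv, coeff_mk]
    linear_combination -this
  refine ⟨v, ?_⟩
  ext n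
  have h1 := X_pow_dvd_iff.1 (X_pow_dvd_expGenerator_sub (hvs n)) n (by omega)
  have h2 := X_pow_dvd_iff.1 (hvs (n + 1)) n (by omega)
  rw [hs n] at h2
  simp only [map_sub] at h1 h2
  linear_combination h1 + h2

end FormalExp

/-! ### Asymptotic expansions at infinity -/

/-- The formal power series `a` in `z⁻¹` is an asymptotic expansion of `F` at infinity. -/
def HasAsymptotics (F : ℂ → ℂ) (a : PowerSeries ℂ) : Prop :=
  ∀ N : ℕ, ∃ p : Polynomial ℂ, PowerSeries.X ^ N ∣ a - (p : PowerSeries ℂ) ∧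
    (fun z => F z - p.eval z⁻¹) =O[atInfinity] fun z => z⁻¹ ^ N

instance : NeBot atInfinity := inferInstanceAs (Bornology.cobounded ℂ).NeBot

theorem tendsto_inv_atInfinity : Tendsto (fun z : ℂ => z⁻¹) atInfinity (𝓝 0) :=
  tendsto_inv₀_cobounded

theorem eventually_ne_zero_atInfinity : ∀ᶠ z : ℂ in atInfinity, z ≠ 0 :=
  Bornology.eventually_ne_cobounded 0

theorem isBigO_eval_inv_one (p : Polynomial ℂ) :
    (fun z => p.eval z⁻¹) =O[atInfinity] fun _ => (1 : ℂ) :=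
  ((p.continuous.tendsto 0).comp tendsto_inv_atInfinity).isBigO_one ℂ

theorem isBigO_eval_inv {p : Polynomial ℂ} {N : ℕ} (h : PowerSeries.X ^ N ∣ (p : PowerSeries ℂ)) :
    (fun z => p.eval z⁻¹) =O[atInfinity] fun z => z⁻¹ ^ N := by
  have h1 : (Polynomial.X : Polynomial ℂ) ^ N ∣ p := by
    rw [Polynomial.X_pow_dvd_iff]
    intro d hd
    rw [← Polynomial.coeff_coe]
    exact PowerSeries.X_pow_dvd_iff.1 h d hd
  obtain ⟨q, rfl⟩ := h1
  refine (((Asymptotics.isBigO_refl (fun z : ℂ => z⁻¹ ^ N) atInfinity).mul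
    (isBigO_eval_inv_one q)).congr_left fun z => ?_).congr_right fun z => mul_one _
  simp

theorem HasAsymptotics.isBigO {F : ℂ → ℂ} {a : PowerSeries ℂ} (h : HasAsymptotics F a) {N : ℕ}
    {p : Polynomial ℂ} (hp : PowerSeries.X ^ N ∣ a - (p : PowerSeries ℂ)) :
    (fun z => F z - p.eval z⁻¹) =O[atInfinity] fun z => z⁻¹ ^ N := by
  obtain ⟨q, hq, hF⟩ := h N
  have h1 : PowerSeries.X ^ N ∣ ((q - p : Polynomial ℂ) : PowerSeries ℂ) := by
    rw [Polynomial.coe_sub]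
    have := dvd_sub hp hq
    rwa [sub_sub_sub_cancel_left] at this
  refine (hF.add (isBigO_eval_inv h1)).congr_left fun z => ?_
  rw [Polynomial.eval_sub]
  ring

theorem exists_polynomial_dvd_sub (a : PowerSeries ℂ) (N : ℕ) :
    ∃ p : Polynomial ℂ, PowerSeries.X ^ N ∣ a - (p : PowerSeries ℂ) := by
  refine ⟨PowerSeries.trunc N a, PowerSeries.X_pow_dvd_iff.2 fun m hm => ?_⟩
  rw [map_sub, Polynomial.coeff_coe, PowerSeries.coeff_trunc, if_pos hm, sub_self]

/-- It suffices to approximate to every order by functions with asymptotic expansions. -/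
theorem HasAsymptotics.of_approx {F : ℂ → ℂ} {a : PowerSeries ℂ}
    (h : ∀ N : ℕ, ∃ G a', HasAsymptotics G a' ∧ PowerSeries.X ^ N ∣ a - a' ∧
      (fun z => F z - G z) =O[atInfinity] fun z => z⁻¹ ^ N) : HasAsymptotics F a := by
  intro N
  obtain ⟨G, a', h1, h2, h3⟩ := h N
  obtain ⟨p, hp, hF⟩ := h1 N
  refine ⟨p, ?_, ?_⟩
  · have := dvd_add h2 hp
    rwa [sub_add_sub_cancel] at this
  · exact (h3.add hF).congr_left fun z => by ring

theorem HasAsymptotics.congr {F ψ : ℂ → ℂ} {a : PowerSeries ℂ} (h : HasAsymptotics F a)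
    (hψ : F =ᶠ[atInfinity] ψ) : HasAsymptotics ψ a := fun N => by
  obtain ⟨p, hp, hF⟩ := h N
  refine ⟨p, hp, hF.congr' ?_ EventuallyEq.rfl⟩
  filter_upwards [hψ] with z hz
  rw [hz]

theorem hasAsymptotics_eval (p : Polynomial ℂ) : HasAsymptotics (fun z => p.eval z⁻¹) p := fun N =>
  ⟨p, by simp, by simpa using Asymptotics.isBigO_zero (E' := ℂ) (fun z : ℂ => z⁻¹ ^ N) atInfinity⟩

theorem hasAsymptotics_const (c : ℂ) : HasAsymptotics (fun _ => c) (PowerSeries.C c) := by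
  simpa using hasAsymptotics_eval (Polynomial.C c)

theorem hasAsymptotics_inv : HasAsymptotics (fun z => z⁻¹) PowerSeries.X := by
  simpa using hasAsymptotics_eval Polynomial.X

theorem HasAsymptotics.isBigO_one {F : ℂ → ℂ} {a : PowerSeries ℂ} (h : HasAsymptotics F a) :
    F =O[atInfinity] fun _ => (1 : ℂ) := by
  obtain ⟨p, _, hp⟩ := h 0
  simp only [pow_zero] at hp
  exact (hp.add (isBigO_eval_inv_one p)).congr_left fun z => sub_add_cancel _ _

theorem HasAsymptotics.add {F ψ : ℂ → ℂ} {a b : PowerSeries ℂ} (hF : HasAsymptotics F a)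
    (hψ : HasAsymptotics ψ b) : HasAsymptotics (fun z => F z + ψ z) (a + b) := fun N => by
  obtain ⟨p, hp, hpF⟩ := hF N
  obtain ⟨q, hq, hqψ⟩ := hψ N
  refine ⟨p + q, ?_, (hpF.add hqψ).congr_left fun z => ?_⟩
  · rw [Polynomial.coe_add, add_sub_add_comm]
    exact dvd_add hp hq
  · rw [Polynomial.eval_add]
    ring

theorem HasAsymptotics.mul {F ψ : ℂ → ℂ} {a b : PowerSeries ℂ} (hF : HasAsymptotics F a)
    (hψ : HasAsymptotics ψ b) : HasAsymptotics (fun z => F z * ψ z) (a * b) := fun N => by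
  obtain ⟨p, hp, hpF⟩ := hF N
  obtain ⟨q, hq, hqψ⟩ := hψ N
  refine ⟨p * q, ?_, ?_⟩
  · rw [Polynomial.coe_mul, show a * b - (p : PowerSeries ℂ) * q = (a - p) * b + p * (b - q) by ring]
    exact dvd_add (hp.mul_right _) (hq.mul_left _)
  · have h1 := (hpF.mul hψ.isBigO_one).congr_right fun z => mul_one _
    have h2 := ((isBigO_eval_inv_one p).mul hqψ).congr_right fun z => one_mul _
    refine (h1.add h2).congr_left fun z => ?_
    rw [Polynomial.eval_mul]
    ring

theorem HasAsymptotics.tendsto {F : ℂ → ℂ} {a : PowerSeries ℂ} (h : HasAsymptotics F a) :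
    Tendsto F atInfinity (𝓝 (PowerSeries.coeff 0 a)) := by
  have h1 := h.isBigO (N := 1) (p := Polynomial.C (PowerSeries.coeff 0 a)) (by
    rw [pow_one, PowerSeries.X_dvd_iff]
    simp)
  simp only [Polynomial.eval_C, pow_one] at h1
  simpa using (h1.trans_tendsto tendsto_inv_atInfinity).add_const (PowerSeries.coeff 0 a)

theorem HasAsymptotics.eq_zero {a : PowerSeries ℂ} (h : HasAsymptotics (fun _ => 0) a) : a = 0 := by
  have key : ∀ N, (PowerSeries.X : PowerSeries ℂ) ^ N ∣ a := by
    intro N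
    induction N with
    | zero => simp
    | succ N ih =>
      obtain ⟨b, rfl⟩ := ih
      obtain ⟨p, hp⟩ := exists_polynomial_dvd_sub b 1
      have h1 := h.isBigO (N := N + 1) (p := Polynomial.X ^ N * p) (by
        rw [Polynomial.coe_mul, Polynomial.coe_pow, Polynomial.coe_X, ← mul_sub, pow_succ]
        exact mul_dvd_mul_left _ (by simpa using hp))
      have h2 : (fun z => p.eval z⁻¹) =O[atInfinity] fun z => z⁻¹ := by
        refine ((Asymptotics.isBigO_refl (fun z : ℂ => z ^ N) atInfinity).mul
          h1.neg_left).congr' ?_ ?_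
        · filter_upwards [eventually_ne_zero_atInfinity] with z hz
          simp only [Polynomial.eval_mul, Polynomial.eval_pow, Polynomial.eval_X, inv_pow, zero_sub,
            neg_neg]
          rw [mul_inv_cancel_left₀ (pow_ne_zero N hz)]
        · filter_upwards [eventually_ne_zero_atInfinity] with z hz
          rw [pow_succ, inv_pow, mul_inv_cancel_left₀ (pow_ne_zero N hz)]
      have h3 : p.eval 0 = 0 := tendsto_nhds_unique
        ((p.continuous.tendsto 0).comp tendsto_inv_atInfinity)
        (h2.trans_tendsto tendsto_inv_atInfinity)
      have h4 : PowerSeries.X ∣ b := by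
        rw [PowerSeries.X_dvd_iff]
        rw [pow_one, PowerSeries.X_dvd_iff, map_sub, Polynomial.constantCoeff_coe,
          Polynomial.coeff_zero_eq_eval_zero, h3, sub_zero] at hp
        exact hp
      rw [pow_succ]
      exact mul_dvd_mul_left _ h4
  ext n
  exact PowerSeries.X_pow_dvd_iff.1 (key (n + 1)) n (by omega)

theorem HasAsymptotics.inv {m : ℂ → ℂ} {a b : PowerSeries ℂ} (h : HasAsymptotics m a)
    (hab : a * b = 1) : HasAsymptotics (fun z => (m z)⁻¹) b := by
  have h0 : PowerSeries.coeff 0 a ≠ 0 := by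
    intro h
    have := congrArg (PowerSeries.coeff 0) hab
    simp [PowerSeries.coeff_zero_eq_constantCoeff] at this h
    rw [h, zero_mul] at this
    exact zero_ne_one this
  intro N
  obtain ⟨p, hp⟩ := exists_polynomial_dvd_sub b N
  refine ⟨p, hp, ?_⟩
  have h1 := (h.mul (hasAsymptotics_eval p)).isBigO (N := N) (p := 1) (by
    rw [Polynomial.coe_one, ← hab, ← mul_sub, ← neg_sub, mul_neg]
    exact (hp.mul_left a).neg_right)
  have h2 : (fun z => (m z)⁻¹) =O[atInfinity] fun _ => (1 : ℂ) := (h.tendsto.inv₀ h0).isBigO_one ℂ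
  refine ((h2.mul h1).neg_left.congr' ?_ EventuallyEq.rfl).congr_right fun z => one_mul _
  filter_upwards [h.tendsto.eventually_ne h0] with z hz
  rw [Polynomial.eval_one]
  field_simp
  ring

theorem HasAsymptotics.eval {y : ℂ → ℂ} {b : PowerSeries ℂ} (h : HasAsymptotics y b)
    (p : Polynomial ℂ) : HasAsymptotics (fun z => p.eval (y z)) (Polynomial.aeval b p) := by
  induction p using Polynomial.induction_on' with
  | add p q hp hq => simpa using hp.add hq
  | monomial n c =>
    have hpow : HasAsymptotics (fun z => y z ^ n) (b ^ n) := by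
      induction n with
      | zero => simpa using hasAsymptotics_const 1
      | succ n ih => simpa only [pow_succ] using ih.mul h
    have := (hasAsymptotics_const c).mul hpow
    simpa [Polynomial.aeval_monomial, PowerSeries.algebraMap_apply] using this

section Substitution

open FormalExp

theorem opExp_coe (v : PowerSeries ℂ) (p : Polynomial ℂ) :
    opExp (vectorField v) (p : PowerSeries ℂ) =
      Polynomial.aeval (opExp (vectorField v) PowerSeries.X) p := by
  have hadd : ∀ a b, opExp (vectorField v) (a + b) =
      opExp (vectorField v) a + opExp (vectorField v) b := fun a b => by
    ext n
    simp [opExp, add_div, sum_add_distrib]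
  have hsmul : ∀ (c : ℂ) a, opExp (vectorField v) (c • a) = c • opExp (vectorField v) a :=
    fun c a => by
      ext n
      simp [opExp, mul_sum, mul_div_assoc]
  induction p using Polynomial.induction_on' with
  | add p q hp hq => rw [Polynomial.coe_add, hadd, hp, hq, map_add]
  | monomial n c =>
    have hpow : opExp (vectorField v) (PowerSeries.X ^ n) =
        opExp (vectorField v) PowerSeries.X ^ n := by
      induction n with
      | zero => simpa using opExp_one v
      | succ n ih => rw [pow_succ, opExp_vectorField_mul, ih, pow_succ]
    rw [← mul_one c, ← smul_eq_mul, ← Polynomial.smul_monomial, Polynomial.coe_smul, hsmul,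
      map_smul, ← Polynomial.X_pow_eq_monomial, Polynomial.coe_pow, Polynomial.coe_X, hpow,
      map_pow, Polynomial.aeval_X]

theorem tendsto_atInfinity_of_sub {w : ℂ → ℂ} {e : PowerSeries ℂ}
    (hw : HasAsymptotics (fun z => w z - z) e) : Tendsto w atInfinity atInfinity := by
  have h1 := hw.tendsto.norm
  refine tendsto_norm_atTop_iff_cobounded.1 ?_
  have h2 : Tendsto (fun z : ℂ => ‖z‖ + -(‖w z - z‖)) atInfinity atTop :=
    tendsto_norm_cobounded_atTop.atTop_add h1.neg
  refine tendsto_atTop_mono (fun z => ?_) h2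
  have := norm_sub_norm_le z (z - w z)
  rw [sub_sub_cancel, norm_sub_rev] at this
  linarith

/-- Composition with a germ `w z = z + e(z⁻¹)` acts on asymptotic expansions as the exponential of
the formal vector field whose time-one flow is `w`. -/
theorem HasAsymptotics.comp {ψ w : ℂ → ℂ} {c v : PowerSeries ℂ} (hψ : HasAsymptotics ψ c)
    (hw : HasAsymptotics (fun z => w z - z) (expGenerator v)) :
    HasAsymptotics (fun z => ψ (w z)) (opExp (vectorField v) c) := by
  set y := opExp (vectorField v) PowerSeries.X with hy
  set m : PowerSeries ℂ := 1 + PowerSeries.X * expGenerator v with hm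
  have hm0 : PowerSeries.constantCoeff m ≠ 0 := by simp [hm]
  have hym : y = PowerSeries.X * m⁻¹ := by
    rw [← opExp_X_mul v, mul_assoc, PowerSeries.mul_inv_cancel _ hm0, mul_one]
  have hmf : HasAsymptotics (fun z => 1 + z⁻¹ * (w z - z)) m := by
    simpa using (hasAsymptotics_const 1).add (hasAsymptotics_inv.mul hw)
  have hwinv : HasAsymptotics (fun z => (w z)⁻¹) y := by
    rw [hym]
    refine (hasAsymptotics_inv.mul (hmf.inv (PowerSeries.mul_inv_cancel _ hm0))).congr ?_
    filter_upwards [eventually_ne_zero_atInfinity] with z hz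
    rw [← mul_inv, mul_add, mul_one, mul_inv_cancel_left₀ hz, add_sub_cancel]
  have hwO : (fun z => (w z)⁻¹) =O[atInfinity] fun z => z⁻¹ := by
    have := hwinv.isBigO (N := 1) (p := 0) (by
      rw [Polynomial.coe_zero, sub_zero, pow_one, hym]
      exact Dvd.intro _ rfl)
    simpa using this
  refine HasAsymptotics.of_approx fun N => ?_
  obtain ⟨p, hp, hpO⟩ := hψ N
  refine ⟨_, _, hwinv.eval p, ?_, ?_⟩
  · rw [hy, ← opExp_coe, ← opExp_sub]
    exact opExp_eq_zero_of_dvd (raises_vectorField v) hp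
  · exact (hpO.comp_tendsto (tendsto_atInfinity_of_sub hw)).trans (hwO.pow N)

end Substitution

namespace IdentityTangent

/-! ### Convergent expansions at infinity -/

theorem eventually_atInfinity {p : ℂ → Prop} :
    (∀ᶠ z in atInfinity, p z) ↔ ∃ R : ℝ, ∀ z, R < ‖z‖ → p z := by
  rw [atInfinity, ← comap_norm_atTop, eventually_comap, eventually_atTop]
  constructor
  · rintro ⟨R, hR⟩
    exact ⟨R, fun z hz => hR _ hz.le z rfl⟩
  · rintro ⟨R, hR⟩
    exact ⟨R + 1, fun b hb z hz => hR z (by linarith)⟩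

/-- The germ at zero, in the variable `x = z⁻¹`, of a function with a convergent expansion at
infinity. -/
theorem HasExpansionAtInfty.exists_hasFPowerSeriesAt {f : ℂ → ℂ} {α : ℂ} {a : PowerSeries ℂ}
    (h : HasExpansionAtInfty f α a) : ∃ F : ℂ → ℂ, F 0 = PowerSeries.coeff 0 a ∧
      (∀ᶠ z in atInfinity, f z - α * z = F z⁻¹) ∧
      HasFPowerSeriesAt F (FormalMultilinearSeries.ofScalars ℂ fun n => PowerSeries.coeff n a) 0 := by
  obtain ⟨R, hR⟩ := h
  refine ⟨Function.update (fun x => f x⁻¹ - α * x⁻¹) 0 (PowerSeries.coeff 0 a), by simp, ?_, ?_⟩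
  · filter_upwards [eventually_ne_zero_atInfinity] with z hz
    rw [Function.update_of_ne (inv_ne_zero hz), inv_inv]
  · rw [hasFPowerSeriesAt_iff]
    have h1 : ∀ᶠ z : ℂ in 𝓝[≠] 0, R < ‖z⁻¹‖ :=
      (tendsto_norm_cobounded_atTop.comp tendsto_inv₀_nhdsNE_zero).eventually_gt_atTop R
    rw [eventually_nhdsWithin_iff] at h1
    filter_upwards [h1] with z hz
    rw [zero_add]
    rcases eq_or_ne z 0 with rfl | h0
    · rw [Function.update_self]
      refine (hasSum_ite_eq 0 (PowerSeries.coeff 0 a)).congr_fun fun n => ?_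
      split_ifs with hn
      · simp [hn, FormalMultilinearSeries.coeff_ofScalars]
      · simp [hn]
    · rw [Function.update_of_ne h0]
      refine (hR _ (hz h0)).congr_fun fun n => ?_
      rw [FormalMultilinearSeries.coeff_ofScalars, inv_inv, smul_eq_mul, mul_comm]

theorem exists_hasExpansionAtInfty {f F : ℂ → ℂ} {α : ℂ} (hF : AnalyticAt ℂ F 0)
    (h : ∀ᶠ z in atInfinity, f z - α * z = F z⁻¹) :
    ∃ a, HasExpansionAtInfty f α a ∧ PowerSeries.coeff 0 a = F 0 ∧
      PowerSeries.coeff 1 a = deriv F 0 := by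
  obtain ⟨p, hp⟩ := hF
  refine ⟨PowerSeries.mk p.coeff, ?_, ?_, ?_⟩
  · have h1 := tendsto_inv_atInfinity.eventually (hasFPowerSeriesAt_iff.1 hp)
    obtain ⟨R, hR⟩ := eventually_atInfinity.1 (h1.and h)
    refine ⟨R, fun z hz => ?_⟩
    obtain ⟨h2, h3⟩ := hR z hz
    rw [h3, ← zero_add z⁻¹]
    refine h2.congr_fun fun n => ?_
    rw [PowerSeries.coeff_mk, smul_eq_mul, mul_comm, zero_add]
  · rw [PowerSeries.coeff_mk, ← hp.coeff_zero 1]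
    rfl
  · rw [PowerSeries.coeff_mk, hp.deriv]
    rfl

theorem HasExpansionAtInfty.hasAsymptotics {f : ℂ → ℂ} {α : ℂ} {a : PowerSeries ℂ}
    (h : HasExpansionAtInfty f α a) : HasAsymptotics (fun z => f z - α * z) a := by
  obtain ⟨F, -, hfF, hF⟩ := h.exists_hasFPowerSeriesAt
  intro N
  refine ⟨PowerSeries.trunc N a, PowerSeries.X_pow_dvd_iff.2 fun m hm => ?_, ?_⟩
  · rw [map_sub, Polynomial.coeff_coe, PowerSeries.coeff_trunc, if_pos hm, sub_self]
  have h1 := ((hF.isBigO_sub_partialSum_pow N).comp_tendsto tendsto_inv_atInfinity).trans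
    (Asymptotics.isBigO_of_le atInfinity (g := fun z : ℂ => z⁻¹ ^ N) fun z => by simp)
  refine h1.congr' ?_ EventuallyEq.rfl
  filter_upwards [hfF] with z hz
  simp only [Function.comp_apply, zero_add]
  rw [hz, Polynomial.eval, PowerSeries.eval₂_trunc_eq_sum_range, FormalMultilinearSeries.partialSum]
  congr 1
  refine sum_congr rfl fun n _ => ?_
  simp [FormalMultilinearSeries.ofScalars, mul_comm]

theorem HasExpansionAtInfty.unique {f : ℂ → ℂ} {α : ℂ} {a b : PowerSeries ℂ}
    (ha : HasExpansionAtInfty f α a) (hb : HasExpansionAtInfty f α b) : a = b := by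
  have h := ha.hasAsymptotics.add ((hasAsymptotics_const (-1)).mul hb.hasAsymptotics)
  have h1 := (h.congr (ψ := fun _ => 0) (Eventually.of_forall fun z => by ring)).eq_zero
  rw [map_neg, map_one, neg_one_mul, ← sub_eq_add_neg, sub_eq_zero] at h1
  exact h1

/-! ### Infinitesimal generators and symmetries -/

/-- The conjugate of `f` by `z ↦ -χ z`. -/
def symConj (χ : ℂ →+* ℂ) (f : ℂ → ℂ) : ℂ → ℂ := fun z => -χ (f (-χ z))

/-- The action on power series in `z⁻¹` of the substitution of `-z` for `z`, together with `χ` on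
the coefficients. -/
noncomputable def symSeries (χ : ℂ →+* ℂ) : PowerSeries ℂ →+* PowerSeries ℂ :=
  (PowerSeries.rescale (-1)).comp (PowerSeries.map χ)

theorem coeff_symSeries (χ : ℂ →+* ℂ) (n : ℕ) (u : PowerSeries ℂ) :
    PowerSeries.coeff n (symSeries χ u) = (-1) ^ n * χ (PowerSeries.coeff n u) := by
  simp [symSeries, PowerSeries.coeff_rescale]

theorem symSeries_zDeriv (χ : ℂ →+* ℂ) (u : PowerSeries ℂ) :
    symSeries χ (zDeriv u) = -zDeriv (symSeries χ u) := by
  have h1 : symSeries χ (PowerSeries.derivative ℂ u) =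
      -PowerSeries.derivative ℂ (symSeries χ u) := by
    ext n
    simp only [coeff_symSeries, PowerSeries.coeff_derivative, map_neg, map_mul, map_add, map_one,
      map_natCast]
    ring
  have h2 : symSeries χ (PowerSeries.X ^ 2) = PowerSeries.X ^ 2 := by
    have : symSeries χ PowerSeries.X = -PowerSeries.X := by
      simp [symSeries, PowerSeries.rescale_X]
    rw [map_pow, this, neg_sq]
  rw [zDeriv, zDeriv, map_neg, map_mul, h1, h2, mul_neg]

section

open FormalExp

/-- Conjugation by `z ↦ -χ z` sends the flow of `v` to the flow of the mirror image of `v`. -/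
theorem expGenerator_neg_symSeries (χ : ℂ →+* ℂ) (v : PowerSeries ℂ) :
    expGenerator (-symSeries χ v) = -symSeries χ (expGenerator v) := by
  have key : ∀ k, (vectorField (-symSeries χ v) ^ k) (-symSeries χ v) =
      -symSeries χ ((vectorField v ^ k) v) := by
    intro k
    induction k with
    | zero => rfl
    | succ k ih =>
      rw [pow_succ', pow_succ', Module.End.mul_apply, Module.End.mul_apply, ih, map_neg,
        vectorField_apply, vectorField_apply, map_mul, symSeries_zDeriv]
      ring
  ext n
  simp only [expGenerator_eq, key, PowerSeries.coeff_mk, map_neg, coeff_symSeries, map_sum,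
    mul_sum, ← sum_neg_distrib, map_div₀, map_natCast]
  refine sum_congr rfl fun k _ => ?_
  ring

end

variable {χ : ℂ →+* ℂ}

theorem HasExpansionAtInfty.conj_sym (hχ : IsIdOrConj χ) {g : ℂ → ℂ} {c : PowerSeries ℂ}
    (h : HasExpansionAtInfty g 1 c) : HasExpansionAtInfty (symConj χ g) 1 (-symSeries χ c) := by
  obtain ⟨R, hR⟩ := h
  refine ⟨R, fun z hz => ?_⟩
  have h1 := ((hR (-χ z) (by rwa [norm_neg, hχ.norm_apply])).map χ hχ.continuous).neg
  have h2 : symConj χ g z - 1 * z = -χ (g (-χ z) - 1 * -χ z) := by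
    simp only [symConj, map_sub, map_mul, map_neg, hχ.apply_apply, map_one]
    ring
  rw [h2]
  refine h1.congr_fun fun n => ?_
  simp only [Function.comp_apply, map_mul, map_pow, map_inv₀, map_neg, hχ.apply_apply,
    coeff_symSeries, inv_neg, neg_pow z⁻¹]
  ring

/-- If a germ is the inverse of its conjugate by `z ↦ -χ z`, then its infinitesimal generator
is invariant. -/
theorem IsGenerator.hasParitySeq (hχ : IsIdOrConj χ) {g : ℂ → ℂ} {v : PowerSeries ℂ}
    (hv : IsGenerator g v) (hg : ∀ᶠ z in atInfinity, g (symConj χ g z) = z) :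
    HasParitySeq χ fun d => PowerSeries.coeff d v := by
  have h1 : HasAsymptotics (fun z => symConj χ g z - z) (expGenerator (-symSeries χ v)) := by
    rw [expGenerator_neg_symSeries]
    simpa using (hv.2.conj_sym hχ).hasAsymptotics
  have h2 : HasAsymptotics (fun z => g z - z) (expGenerator v) := by
    simpa using hv.2.hasAsymptotics
  have h3 := (((h2.comp h1).add h1).congr (ψ := fun _ => 0) (by
    filter_upwards [hg] with z hz
    rw [hz]
    ring)).eq_zero
  -- The flow of `v` and the inverse of the flow of the mirrored field `-symSeries χ v` agree.
  have h4 := FormalExp.expGenerator_injective <| FormalExp.opExp_injective (-symSeries χ v) <|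
    add_right_cancel <| h3.trans
      ((add_comm _ _).trans (FormalExp.expGenerator_add_opExp (-symSeries χ v))).symm
  rw [neg_neg] at h4
  intro d
  have h5 := congrArg (PowerSeries.coeff d) h4
  rw [coeff_symSeries] at h5
  have h6 : ((-1 : ℂ) ^ d) ^ 2 = 1 := by rw [← pow_mul, mul_comm, pow_mul]; simp
  linear_combination -(-1) ^ d * h5 - χ (PowerSeries.coeff d v) * h6

theorem tendsto_add_const_atInfinity (c : ℂ) : Tendsto (· + c) atInfinity atInfinity :=
  tendsto_atInfinity_of_sub (e := PowerSeries.C c)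
    ((hasAsymptotics_const c).congr (Eventually.of_forall fun z => by simp))

/-- The factor `g` inherits the symmetry of `f`, because the half-translations on its two sides are
exchanged by conjugation with `z ↦ -χ z` and inversion. -/
theorem eventually_symmetricFactor_symConj {f : ℂ → ℂ}
    (h : ∀ᶠ z in atInfinity, f (symConj χ f z) = z) :
    ∀ᶠ z in atInfinity, symmetricFactor f (symConj χ (symmetricFactor f) z) = z := by
  filter_upwards [(tendsto_add_const_atInfinity (1 / 2)).eventually h] with z hz
  have h2 : χ (1 / 2) = 1 / 2 := by simp [map_ofNat]
  have h1 : symConj χ (symmetricFactor f) z = symConj χ f (z + 1 / 2) + 1 / 2 := by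
    simp only [symConj, symmetricFactor, map_sub, map_add, h2]
    ring_nf
  rw [h1, symmetricFactor, add_sub_cancel_right, hz, add_sub_cancel_right]

/-- The translation inside `f` is absorbed by the change of coordinate
`(z - 1/2)⁻¹ = x / (1 - x/2)`, with `x = z⁻¹`. -/
theorem IsStandardDiffeo.hasExpansionAtInfty_symmetricFactor {f : ℂ → ℂ} (hf : IsStandardDiffeo f) :
    ∃ c, HasExpansionAtInfty (symmetricFactor f) 1 c ∧ PowerSeries.coeff 0 c = 0 ∧
      PowerSeries.coeff 1 c = 0 := by
  obtain ⟨a, ha0, ha1, ha⟩ := hf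
  obtain ⟨F, hF0, hfF, hF⟩ := ha.exists_hasFPowerSeriesAt
  have hm : HasDerivAt (fun x : ℂ => x / (1 - x / 2)) 1 0 := by
    have := (hasDerivAt_id' (0 : ℂ)).fun_div (((hasDerivAt_id' (0 : ℂ)).div_const 2).const_sub 1)
      (by simp)
    simpa using this
  have hF' : HasDerivAt F 0 0 := by
    have := hF.hasDerivAt
    simpa [FormalMultilinearSeries.ofScalars, ha1] using this
  have hG : AnalyticAt ℂ (fun x : ℂ => F (x / (1 - x / 2)) - 1) 0 := by
    refine AnalyticAt.sub (AnalyticAt.fun_comp (g := F) (f := fun x : ℂ => x / (1 - x / 2)) ?_ ?_)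
      analyticAt_const
    · simpa using hF.analyticAt
    · exact analyticAt_id.div (analyticAt_const.sub (analyticAt_id.div analyticAt_const (by simp)))
        (by simp)
  obtain ⟨c, hc, hc0, hc1⟩ := exists_hasExpansionAtInfty (f := symmetricFactor f) (α := 1) hG (by
    have h1 := (tendsto_add_const_atInfinity (-(1 / 2))).eventually hfF
    filter_upwards [h1, eventually_ne_zero_atInfinity,
      Bornology.eventually_ne_cobounded (1 / 2 : ℂ)] with z hz h0 h2
    have h3 : z⁻¹ / (1 - z⁻¹ / 2) = (z + -(1 / 2))⁻¹ := by
      rw [div_eq_iff, ← sub_eq_add_neg]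
      · have : z - 1 / 2 ≠ 0 := sub_ne_zero.2 h2
        have h4 : z * 2 - 1 ≠ 0 := fun h4 => this (by linear_combination h4 / 2)
        field_simp
      · intro h
        field_simp at h
        refine h2 ?_
        linear_combination h / 2
    rw [h3, ← hz, symmetricFactor]
    ring_nf)
  refine ⟨c, hc, by simp [hc0, hF0, ha0], ?_⟩
  rw [hc1]
  have h1 : HasDerivAt F 0 ((fun x : ℂ => x / (1 - x / 2)) 0) := by simpa using hF'
  simpa using ((h1.comp 0 hm).sub_const 1).deriv

theorem IsStandardDiffeo.existsUnique_isGenerator {f : ℂ → ℂ} (hf : IsStandardDiffeo f) :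
    ∃! v, IsGenerator (symmetricFactor f) v := by
  obtain ⟨c, hc, hc0, -⟩ := hf.hasExpansionAtInfty_symmetricFactor
  obtain ⟨v, rfl⟩ := FormalExp.expGenerator_surjective c
  rw [FormalExp.coeff_zero_expGenerator] at hc0
  exact ⟨v, ⟨hc0, hc⟩, fun w hw => FormalExp.expGenerator_injective (hw.2.unique hc)⟩

/-- The absence of a term in `z⁻¹` in a standard diffeo is inherited by the generator. -/
theorem IsStandardDiffeo.coeff_one_generator {f : ℂ → ℂ} (hf : IsStandardDiffeo f)
    {v : PowerSeries ℂ} (hv : IsGenerator (symmetricFactor f) v) : PowerSeries.coeff 1 v = 0 := by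
  obtain ⟨c, hc, -, hc1⟩ := hf.hasExpansionAtInfty_symmetricFactor
  rw [← FormalExp.coeff_one_expGenerator, hv.2.unique hc, hc1]

end IdentityTangent

namespace IdentityTangent

/-! ### Iterates of standard diffeos in the vertical direction -/

/-- In the coordinate `z⁻¹`, the remainder `f z - z` is analytic at the origin. -/
theorem HasExpansionAtInfty.exists_lipschitz {f : ℂ → ℂ} {a : PowerSeries ℂ}
    (h : HasExpansionAtInfty f 1 a) : ∃ C R : ℝ, 0 ≤ C ∧ ∀ x y : ℂ, R < ‖x‖ → R < ‖y‖ →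
      ‖(f x - x) - (f y - y)‖ ≤ C * (‖x‖⁻¹ * ‖y‖⁻¹) * ‖x - y‖ := by
  obtain ⟨F, -, hfF, hF⟩ := h.exists_hasFPowerSeriesAt
  obtain ⟨C, t, ht, hC⟩ := (hF.analyticAt.contDiffAt (n := 1)).exists_lipschitzOnWith
  obtain ⟨R, hR⟩ := eventually_atInfinity.1
    ((hfF.and (tendsto_inv_atInfinity.eventually ht)).and eventually_ne_zero_atInfinity)
  refine ⟨C, R, C.2, fun x y hx hy => ?_⟩
  obtain ⟨⟨hx1, hx2⟩, hx0⟩ := hR x hx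
  obtain ⟨⟨hy1, hy2⟩, hy0⟩ := hR y hy
  rw [one_mul] at hx1 hy1
  rw [hx1, hy1]
  refine (hC.norm_sub_le hx2 hy2).trans_eq ?_
  rw [inv_sub_inv hx0 hy0, norm_div, norm_mul, norm_sub_rev]
  ring

theorem IsStandardDiffeo.exists_norm_sub_le {f : ℂ → ℂ} (hf : IsStandardDiffeo f) :
    ∃ C R : ℝ, ∀ z : ℂ, R < ‖z‖ → ‖f z - z - 1‖ ≤ C * (‖z‖⁻¹) ^ 2 := by
  obtain ⟨a, ha0, ha1, ha⟩ := hf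
  have h := ha.hasAsymptotics.isBigO (N := 2) (p := 1) (PowerSeries.X_pow_dvd_iff.2 fun m hm => by
    interval_cases m
    · rw [map_sub, ha0]
      simp
    · simp [ha1, PowerSeries.coeff_one])
  obtain ⟨C, hC⟩ := h.bound
  obtain ⟨R, hR⟩ := eventually_atInfinity.1 hC
  exact ⟨C, R, fun z hz => by simpa using hR z hz⟩

/-- The estimates on which the study of the iterates of `f` rests. In the last one `normTangent z 2`
bounds the sum of `‖z + k‖⁻²` over all `k`, so that an orbit in `|Im z| > K` stays close to
the orbit of the unit translation. -/
structure IterationBounds (f : ℂ → ℂ) (C K : ℝ) : Prop where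
  nonneg : 0 ≤ C
  two_le : 2 ≤ K
  norm_sub_le : ∀ z : ℂ, K - 1 < ‖z‖ → ‖f z - z - 1‖ ≤ C * (‖z‖⁻¹) ^ 2
  lipschitz : ∀ x y : ℂ, K - 1 < ‖x‖ → K - 1 < ‖y‖ →
    ‖(f x - x) - (f y - y)‖ ≤ C * (‖x‖⁻¹ * ‖y‖⁻¹) * ‖x - y‖
  small : ∀ z : ℂ, K < |z.im| → 4 * C * normTangent z 2 ≤ 1

theorem IsStandardDiffeo.exists_iterationBounds {f : ℂ → ℂ} (hf : IsStandardDiffeo f) :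
    ∃ C K, IterationBounds f C K := by
  obtain ⟨C₁, R₁, h1⟩ := hf.exists_norm_sub_le
  obtain ⟨a, -, -, ha⟩ := hf
  obtain ⟨C₂, R₂, hC₂, h2⟩ := ha.exists_lipschitz
  set C := max C₁ C₂
  have hlim : Tendsto (fun z => 4 * C * normTangent z 2) atVerticalInfinity (𝓝 0) := by
    simpa using tendsto_normTangent_two.const_mul (4 * C)
  obtain ⟨K, hK⟩ := eventually_atVerticalInfinity.1 (hlim.eventually_le_const one_pos)
  refine ⟨C, max (max 2 K) (max R₁ R₂ + 1), hC₂.trans (le_max_right _ _),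
    (le_max_left _ _).trans (le_max_left _ _), fun z hz => ?_, fun x y hx hy => ?_, fun z hz => ?_⟩
  · refine (h1 z ?_).trans (mul_le_mul_of_nonneg_right (le_max_left _ _) (by positivity))
    have := le_max_right (max 2 K) (max R₁ R₂ + 1)
    have := le_max_left R₁ R₂
    linarith
  · have h3 := le_max_right (max 2 K) (max R₁ R₂ + 1)
    have h4 := le_max_right R₁ R₂
    refine (h2 x y (by linarith) (by linarith)).trans ?_
    gcongr
    exact le_max_right _ _
  · exact hK z (((le_max_right _ _).trans (le_max_left _ _)).trans_lt hz)

theorem lt_abs_im_of_norm_sub_le {w z : ℂ} {K r : ℝ} (h : ‖w - z‖ ≤ r) (hz : K + r < |z.im|) :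
    K < |w.im| := by
  have h1 := (Complex.abs_im_le_norm _).trans h
  rw [Complex.sub_im, abs_sub_comm] at h1
  have := abs_sub_abs_le_abs_sub z.im w.im
  linarith

theorem sum_range_le_normTangent (z : ℂ) (k : ℕ) :
    ∑ i ∈ range k, (‖z + i‖⁻¹) ^ 2 ≤ normTangent z 2 := by
  have h := (summable_norm_inv_pow z le_rfl).sum_le_tsum ((range k).map Nat.castEmbedding)
    fun i _ => norm_nonneg _
  refine (le_of_eq ?_).trans h
  rw [sum_map]
  refine sum_congr rfl fun i _ => ?_
  simp [add_comm]

theorem summable_inv_sq (z : ℂ) : Summable fun k : ℕ => (‖z + k‖⁻¹) ^ 2 :=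
  summable_of_sum_range_le (fun _ => by positivity) (sum_range_le_normTangent z)

namespace IterationBounds

variable {f : ℂ → ℂ} {C K : ℝ}

/-- An orbit in `|Im z| > K` stays within distance `1` of the orbit of the unit translation, so that
the bounds on `f` apply along it. -/
theorem norm_iterate_sub_le_sum (h : IterationBounds f C K) {z : ℂ} (hz : K < |z.im|) (k : ℕ) :
    ‖f^[k] z - (z + k)‖ ≤ 4 * C * ∑ i ∈ range k, (‖z + i‖⁻¹) ^ 2 ∧
      ‖z + k‖ ≤ 2 * ‖f^[k] z‖ ∧ K - 1 < ‖f^[k] z‖ := by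
  have hC := h.nonneg
  have hK := h.two_le
  have key : ∀ k : ℕ, ‖f^[k] z - (z + k)‖ ≤ 4 * C * ∑ i ∈ range k, (‖z + i‖⁻¹) ^ 2 →
      ‖z + k‖ ≤ 2 * ‖f^[k] z‖ ∧ K - 1 < ‖f^[k] z‖ := by
    intro k hk
    have h1 : ‖f^[k] z - (z + k)‖ ≤ 1 := hk.trans <|
      (mul_le_mul_of_nonneg_left (sum_range_le_normTangent z k) (by positivity)).trans
        (h.small z hz)
    have h2 : |z.im| ≤ ‖z + k‖ := by simpa using Complex.abs_im_le_norm (z + k)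
    have h3 := norm_sub_norm_le (z + k) (f^[k] z)
    rw [norm_sub_rev] at h3
    constructor <;> linarith
  suffices h0 : ‖f^[k] z - (z + k)‖ ≤ 4 * C * ∑ i ∈ range k, (‖z + i‖⁻¹) ^ 2 from ⟨h0, key k h0⟩
  induction k with
  | zero => simp
  | succ k ih =>
    obtain ⟨h1, h2⟩ := key k ih
    have h3 : 0 < ‖z + k‖ := by
      have : |z.im| ≤ ‖z + k‖ := by simpa using Complex.abs_im_le_norm (z + k)
      linarith
    have h4 := h.norm_sub_le _ h2
    have h5 : ‖f^[k] z‖⁻¹ ≤ 2 * ‖z + k‖⁻¹ := by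
      rw [← div_eq_mul_inv, le_div_iff₀ h3, inv_mul_le_iff₀ (by linarith)]
      linarith
    have h6 : C * (‖f^[k] z‖⁻¹) ^ 2 ≤ C * (2 * ‖z + k‖⁻¹) ^ 2 := by gcongr
    rw [Function.iterate_succ_apply', sum_range_succ, mul_add]
    calc ‖f (f^[k] z) - (z + ↑(k + 1))‖
        = ‖(f^[k] z - (z + k)) + (f (f^[k] z) - f^[k] z - 1)‖ := by push_cast; ring_nf
      _ ≤ _ := (norm_add_le _ _).trans (add_le_add ih (h4.trans (h6.trans_eq (by ring))))

theorem norm_iterate_sub_le (h : IterationBounds f C K) {z : ℂ} (hz : K < |z.im|) (k : ℕ) :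
    ‖f^[k] z - (z + k)‖ ≤ 4 * C * normTangent z 2 :=
  (h.norm_iterate_sub_le_sum hz k).1.trans <| mul_le_mul_of_nonneg_left
    (sum_range_le_normTangent z k) (mul_nonneg (by norm_num) h.nonneg)

theorem inv_norm_iterate_le (h : IterationBounds f C K) {z : ℂ} (hz : K < |z.im|) (k : ℕ) :
    ‖f^[k] z‖⁻¹ ≤ 2 * ‖z + k‖⁻¹ := by
  obtain ⟨-, h1, h2⟩ := h.norm_iterate_sub_le_sum hz k
  have hK := h.two_le
  have h3 : 0 < ‖z + k‖ := by
    have : |z.im| ≤ ‖z + k‖ := by simpa using Complex.abs_im_le_norm (z + k)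
    linarith
  rw [← div_eq_mul_inv, le_div_iff₀ h3, inv_mul_le_iff₀ (by linarith)]
  linarith

/-- All iterates are Lipschitz with the same constant. -/
theorem norm_iterate_sub_iterate_le (h : IterationBounds f C K) {x y : ℂ} (hx : K < |x.im|)
    (hy : K < |y.im|) (k : ℕ) : ‖f^[k] x - f^[k] y‖ ≤ Real.exp 1 * ‖x - y‖ := by
  have hC := h.nonneg
  have key : ‖f^[k] x - f^[k] y‖ ≤ Real.exp (2 * C * (∑ i ∈ range k, (‖x + i‖⁻¹) ^ 2 +
      ∑ i ∈ range k, (‖y + i‖⁻¹) ^ 2)) * ‖x - y‖ := by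
    induction k with
    | zero => simp
    | succ k ih =>
      rw [sum_range_succ, sum_range_succ, Function.iterate_succ_apply',
        Function.iterate_succ_apply']
      set X := f^[k] x
      set Y := f^[k] y
      set s := ‖x + k‖⁻¹
      set t := ‖y + k‖⁻¹
      have h1 := h.lipschitz X Y (h.norm_iterate_sub_le_sum hx k).2.2
        (h.norm_iterate_sub_le_sum hy k).2.2
      have h2 : ‖X‖⁻¹ * ‖Y‖⁻¹ ≤ (2 * s) * (2 * t) :=
        mul_le_mul (h.inv_norm_iterate_le hx k) (h.inv_norm_iterate_le hy k) (by positivity)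
          (by positivity)
      have h3 : C * (‖X‖⁻¹ * ‖Y‖⁻¹) ≤ 2 * C * (s ^ 2 + t ^ 2) := by
        have := mul_le_mul_of_nonneg_left (h2.trans
          (by nlinarith [sq_nonneg (s - t)] : _ ≤ 2 * (s ^ 2 + t ^ 2))) hC
        linarith
      calc ‖f X - f Y‖ = ‖(X - Y) + ((f X - X) - (f Y - Y))‖ := by ring_nf
        _ ≤ ‖X - Y‖ + C * (‖X‖⁻¹ * ‖Y‖⁻¹) * ‖X - Y‖ := (norm_add_le _ _).trans (by gcongr)
        _ ≤ (2 * C * (s ^ 2 + t ^ 2) + 1) * ‖X - Y‖ := by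
          nlinarith [mul_le_mul_of_nonneg_right h3 (norm_nonneg (X - Y))]
        _ ≤ Real.exp (2 * C * (s ^ 2 + t ^ 2)) * ‖X - Y‖ := by
          gcongr
          exact Real.add_one_le_exp _
        _ ≤ Real.exp (2 * C * (s ^ 2 + t ^ 2)) * _ :=
          mul_le_mul_of_nonneg_left ih (Real.exp_nonneg _)
        _ = _ := by
          rw [← mul_assoc, ← Real.exp_add]
          ring_nf
  refine key.trans ?_
  gcongr
  have h1 := h.small x hx
  have h2 := h.small y hy
  have h3 := mul_le_mul_of_nonneg_left (sum_range_le_normTangent x k) hC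
  have h4 := mul_le_mul_of_nonneg_left (sum_range_le_normTangent y k) hC
  linarith

theorem exists_isDirectIteratorValue (h : IterationBounds f C K) {z : ℂ} (hz : K < |z.im|) :
    ∃ w, IsDirectIteratorValue f z w := by
  have hC := h.nonneg
  refine cauchySeq_tendsto_of_complete (cauchySeq_of_dist_le_of_summable _ (fun k => ?_)
    ((summable_inv_sq z).mul_left (4 * C)))
  have h1 := h.norm_sub_le _ (h.norm_iterate_sub_le_sum hz k).2.2
  have h2 : C * (‖f^[k] z‖⁻¹) ^ 2 ≤ C * (2 * ‖z + k‖⁻¹) ^ 2 := by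
    gcongr
    exact h.inv_norm_iterate_le hz k
  rw [dist_comm, dist_eq_norm, Nat.succ_eq_add_one, Function.iterate_succ_apply', Nat.cast_succ]
  calc ‖f (f^[k] z) - (k + 1) - (f^[k] z - k)‖ = ‖f (f^[k] z) - f^[k] z - 1‖ := by ring_nf
    _ ≤ _ := h1.trans (h2.trans_eq (by ring))

theorem exists_isReciprocalIteratorValue (h : IterationBounds f C K) {z : ℂ}
    (hz : K + 1 < |z.im|) : ∃ w, IsReciprocalIteratorValue f z w := by
  have hC := h.nonneg
  have hs : Summable fun k : ℕ => (‖z - ↑(k + 1)‖⁻¹) ^ 2 := by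
    have := (summable_nat_add_iff 1).2 (summable_inv_sq (-z))
    refine this.congr fun k => ?_
    rw [← norm_neg, neg_add, neg_neg, sub_eq_add_neg]
  refine cauchySeq_tendsto_of_complete (cauchySeq_of_dist_le_of_summable _ (fun k => ?_)
    ((hs.mul_left C).mul_left (Real.exp 1)))
  set w := z - ↑(k + 1) with hw
  have him : w.im = z.im := by simp [hw]
  have hwK : K < |w.im| := by rw [him]; linarith
  have h1 : ‖f w - (w + 1)‖ ≤ 1 := by
    simpa using (h.norm_iterate_sub_le hwK 1).trans (h.small w hwK)
  have h2 : K < |(f w).im| := lt_abs_im_of_norm_sub_le h1 (by simpa [him] using hz)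
  have h4 : K < |(z - k).im| := by
    simp only [Complex.sub_im, Complex.natCast_im, sub_zero]
    linarith
  rw [dist_comm, dist_eq_norm, Nat.succ_eq_add_one, Function.iterate_succ_apply]
  refine (h.norm_iterate_sub_iterate_le h2 h4 k).trans ?_
  gcongr
  refine (le_of_eq ?_).trans (h.norm_sub_le w ?_)
  · rw [hw]
    push_cast
    ring_nf
  · linarith [Complex.abs_im_le_norm w]

end IterationBounds

/-- The limits that define the connector exist for `|Im z|` large: both sequences are Cauchy. -/
theorem IsStandardDiffeo.exists_isConnector {f : ℂ → ℂ} (hf : IsStandardDiffeo f) :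
    ∃ P, IsConnector f P := by
  obtain ⟨C, K, h⟩ := hf.exists_iterationBounds
  have key : ∀ z : ℂ, ∃ w : ℂ, K + 1 < |z.im| →
      ∃ u, IsReciprocalIteratorValue f z u ∧ IsDirectIteratorValue f u w := by
    intro z
    by_cases hz : K + 1 < |z.im|
    · obtain ⟨u, hu⟩ := h.exists_isReciprocalIteratorValue hz
      have hzu : ‖u - z‖ ≤ 1 := by
        refine le_of_tendsto (hu.sub_const z).norm (Eventually.of_forall fun k => ?_)
        have h1 : K < |(z - k).im| := by
          simp only [Complex.sub_im, Complex.natCast_im, sub_zero]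
          linarith
        simpa using (h.norm_iterate_sub_le h1 k).trans (h.small _ h1)
      obtain ⟨w, hw⟩ := h.exists_isDirectIteratorValue 
        (lt_abs_im_of_norm_sub_le hzu hz)
      exact ⟨w, fun _ => ⟨u, hu, hw⟩⟩
    · exact ⟨0, fun h => absurd h hz⟩
  choose P hP using key
  exact ⟨P, eventually_atVerticalInfinity.2 ⟨K + 1, hP⟩⟩

end IdentityTangent

namespace IdentityTangent

/-! ### Connectors -/

variable {f : ℂ → ℂ} {C K : ℝ} {χ : ℂ →+* ℂ}

theorem IterationBounds.mono (h : IterationBounds f C K) {K' : ℝ} (hK : K ≤ K') :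
    IterationBounds f C K' where
  nonneg := h.nonneg
  two_le := h.two_le.trans hK
  norm_sub_le z hz := h.norm_sub_le z (by linarith)
  lipschitz x y hx hy := h.lipschitz x y (by linarith) (by linarith)
  small z hz := h.small z (by linarith)

theorem IterationBounds.norm_direct_sub_le (h : IterationBounds f C K) {z w : ℂ}
    (hz : K < |z.im|) (hw : IsDirectIteratorValue f z w) : ‖w - z‖ ≤ 4 * C * normTangent z 2 := by
  refine le_of_tendsto (hw.sub_const z).norm (Eventually.of_forall fun k => ?_)
  refine (le_of_eq ?_).trans (h.norm_iterate_sub_le hz k)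
  ring_nf

theorem IterationBounds.norm_iterate_sub_natCast_sub_le (h : IterationBounds f C K) {z : ℂ}
    (hz : K < |z.im|) {ε : ℝ} (hε : ∀ y : ℂ, y.im = z.im → 4 * C * normTangent y 2 ≤ ε) (k i : ℕ) :
    ‖f^[i] (z - k) - (z - k + i)‖ ≤ ε := by
  have h1 : (z - k).im = z.im := by simp
  exact (h.norm_iterate_sub_le (by rwa [h1]) i).trans (hε _ h1)

theorem IterationBounds.norm_reciprocal_sub_le (h : IterationBounds f C K) {z w : ℂ}
    (hz : K < |z.im|) (hw : IsReciprocalIteratorValue f z w) {ε : ℝ}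
    (hε : ∀ y : ℂ, y.im = z.im → 4 * C * normTangent y 2 ≤ ε) : ‖w - z‖ ≤ ε := by
  refine le_of_tendsto (hw.sub_const z).norm (Eventually.of_forall fun k => ?_)
  simpa using h.norm_iterate_sub_natCast_sub_le hz hε k k

theorem IsConnector.tendsto_sub {P : ℂ → ℂ} (hf : IsStandardDiffeo f) (hP : IsConnector f P) :
    Tendsto (fun z => P z - z) atVerticalInfinity (𝓝 0) := by
  obtain ⟨C, K, h⟩ := hf.exists_iterationBounds
  refine NormedAddGroup.tendsto_nhds_zero.2 fun ε hε => ?_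
  have hlim : Tendsto (fun z => 4 * C * normTangent z 2) atVerticalInfinity (𝓝 0) := by
    simpa using tendsto_normTangent_two.const_mul (4 * C)
  obtain ⟨K₁, hK₁⟩ := eventually_atVerticalInfinity.1 (hlim.eventually_le_const (u := ε / 3)
    (by positivity))
  obtain ⟨K₂, hK₂⟩ := eventually_atVerticalInfinity.1 hP
  refine eventually_atVerticalInfinity.2 ⟨max (max K K₁) K₂ + ε, fun z hz => ?_⟩
  have h1 := (le_max_left K K₁).trans (le_max_left _ K₂)
  have h2 := (le_max_right K K₁).trans (le_max_left _ K₂)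
  have h3 := le_max_right (max K K₁) K₂
  obtain ⟨x, hx, hw⟩ := hK₂ z (by linarith)
  have h4 : ‖x - z‖ ≤ ε / 3 := h.norm_reciprocal_sub_le (by linarith) hx fun y hy =>
    hK₁ y (by rw [hy]; linarith)
  have h5 : max (max K K₁) K₂ < |x.im| := lt_abs_im_of_norm_sub_le h4 (by linarith)
  have h6 := (h.norm_direct_sub_le (by linarith) hw).trans (hK₁ x (by linarith))
  have h7 := norm_add_le (P z - x) (x - z)
  rw [sub_add_sub_cancel] at h7
  linarith

/-! ### Germs that conjugate the mirror image to the inverse -/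

theorem symConj_iterate (hχ : IsIdOrConj χ) (f : ℂ → ℂ) (k : ℕ) (z : ℂ) :
    (symConj χ f)^[k] z = -χ (f^[k] (-χ z)) := by
  induction k with
  | zero => simp [hχ.apply_apply]
  | succ k ih =>
    rw [Function.iterate_succ_apply', Function.iterate_succ_apply', ih, symConj, map_neg,
      hχ.apply_apply, neg_neg]

theorem HasExpansionAtInfty.tendsto_atInfinity {h : ℂ → ℂ} {α : ℂ} {b : PowerSeries ℂ}
    (hα : α ≠ 0) (hb : HasExpansionAtInfty h α b) : Tendsto h atInfinity atInfinity := by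
  have h1 : Tendsto (fun z => α⁻¹ * h z) atInfinity atInfinity := by
    refine tendsto_atInfinity_of_sub (e := PowerSeries.C α⁻¹ * b)
      (((hasAsymptotics_const _).mul hb.hasAsymptotics).congr (Eventually.of_forall fun z => ?_))
    simp only
    field_simp
  refine ((tendsto_mul_left_cobounded hα).comp h1).congr fun z => ?_
  simp [hα]

theorem ConjugatesToInverse.eventually_eq {h u : ℂ → ℂ} {b : PowerSeries ℂ}
    (H : ConjugatesToInverse h b u f) : ∀ᶠ z in atInfinity, f (h (u z)) = h z := by
  obtain ⟨⟨α, hα, hb⟩, finv, ⟨h1, -⟩, h2⟩ := H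
  filter_upwards [(hb.tendsto_atInfinity hα).eventually h1, h2] with z hz1 hz2
  rw [hz2, hz1]

/-- A germ that conjugates `symConj χ f` to the inverse of `f` has linear part `1`: as `z → ∞`, the
difference `h (symConj χ f z) - h z` tends to `-α`, whereas it equals `w - f w` with
`w = h (symConj χ f z)`, which tends to `-1`. -/
theorem ConjugatesToInverse.hasExpansionAtInfty (hχ : IsIdOrConj χ) (hf : IsStandardDiffeo f)
    {h : ℂ → ℂ} {b : PowerSeries ℂ} (H : ConjugatesToInverse h b (symConj χ f) f) :
    HasExpansionAtInfty h 1 b := by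
  have hev := H.eventually_eq
  obtain ⟨⟨α, hα, hb⟩, -⟩ := H
  obtain ⟨a, ha0, -, ha⟩ := hf
  have hu : HasAsymptotics (fun z => symConj χ f z - z) (-symSeries χ a) := by
    simpa using (ha.conj_sym hχ).hasAsymptotics
  have hu0 := hu.tendsto
  rw [map_neg, coeff_symSeries, ha0, map_one, pow_zero, mul_one] at hu0
  have hu1 := tendsto_atInfinity_of_sub hu
  have hη := hb.hasAsymptotics.tendsto
  have hh : Tendsto (fun z => h (symConj χ f z) - h z) atInfinity (𝓝 (-α)) := by
    have h1 := (hu0.const_mul α).add ((hη.comp hu1).sub hη)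
    rw [sub_self, add_zero, mul_neg_one] at h1
    refine h1.congr fun z => ?_
    simp only [Function.comp_apply]
    ring
  have hf1 := ha.hasAsymptotics.tendsto.comp ((hb.tendsto_atInfinity hα).comp hu1)
  have h2 := hf1.add hh
  rw [ha0] at h2
  have h3 : (1 : ℂ) + -α = 0 := by
    refine tendsto_nhds_unique_of_eventuallyEq h2 tendsto_const_nhds ?_
    filter_upwards [hev] with z hz
    simp only [Function.comp_apply]
    rw [hz]
    ring
  rwa [← sub_eq_zero.1 ((sub_eq_add_neg _ _).trans h3)] at hb

/-- The estimates for a germ `h z = z + β + O(z⁻¹)` that conjugates `symConj χ f` to the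
inverse of `f`. -/
structure ConjugationBounds (χ : ℂ →+* ℂ) (f h : ℂ → ℂ) (β : ℂ) (C K L : ℝ) : Prop
    extends IterationBounds f C K where
  semiconj : ∀ z : ℂ, K < ‖z‖ → f (h (symConj χ f z)) = h z
  norm_sub_sub_le : ∀ z : ℂ, K < ‖z‖ → ‖h z - (z + β)‖ ≤ 1
  tendsto : Tendsto (fun z => h z - z) atInfinity (𝓝 β)
  norm_apply_sub_le : ∀ x y : ℂ, K < ‖x‖ → K < ‖y‖ → ‖h x - h y‖ ≤ L * ‖x - y‖

theorem ConjugatesToInverse.exists_conjugationBounds (hχ : IsIdOrConj χ)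
    (hf : IsStandardDiffeo f) {h : ℂ → ℂ} {b : PowerSeries ℂ}
    (H : ConjugatesToInverse h b (symConj χ f) f) (K₀ : ℝ) :
    ∃ C K L, K₀ ≤ K ∧ ConjugationBounds χ f h (PowerSeries.coeff 0 b) C K L := by
  have hb := H.hasExpansionAtInfty hχ hf
  obtain ⟨C, K₁, h1⟩ := hf.exists_iterationBounds
  obtain ⟨L, R, hL, h2⟩ := hb.exists_lipschitz
  have h3 : Tendsto (fun z => h z - z) atInfinity (𝓝 (PowerSeries.coeff 0 b)) := by
    simpa using hb.hasAsymptotics.tendsto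
  obtain ⟨R', h4⟩ := eventually_atInfinity.1
    (H.eventually_eq.and (Metric.tendsto_nhds.1 h3 1 one_pos))
  set K := max (max K₀ K₁) (max R R')
  have hK₀ : K₀ ≤ K := (le_max_left _ _).trans (le_max_left _ _)
  have hK₁ : K₁ ≤ K := (le_max_right _ _).trans (le_max_left _ _)
  have hR : R ≤ K := (le_max_left _ _).trans (le_max_right _ _)
  have hR' : R' ≤ K := (le_max_right _ _).trans (le_max_right _ _)
  refine ⟨C, K, L + 1, hK₀, h1.mono hK₁, fun z hz => (h4 z (by linarith)).1, fun z hz => ?_, h3,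
    fun x y hx hy => ?_⟩
  · have := (h4 z (by linarith)).2.le
    rwa [dist_eq_norm, sub_sub] at this
  · have h5 := h2 x y (by linarith) (by linarith)
    have hK := h1.two_le.trans hK₁
    have h6 : ‖x‖⁻¹ * ‖y‖⁻¹ ≤ 1 := mul_le_one₀ (inv_le_one_of_one_le₀ (by linarith))
      (by positivity) (inv_le_one_of_one_le₀ (by linarith))
    calc ‖h x - h y‖ = ‖(h x - x - (h y - y)) + (x - y)‖ := by ring_nf
      _ ≤ L * (‖x‖⁻¹ * ‖y‖⁻¹) * ‖x - y‖ + ‖x - y‖ := (norm_add_le _ _).trans (by gcongr)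
      _ ≤ L * 1 * ‖x - y‖ + ‖x - y‖ := by gcongr
      _ = _ := by ring

namespace ConjugationBounds

variable {h : ℂ → ℂ} {β : ℂ} {L : ℝ}

/-- The conjugacy relation, iterated. -/
theorem iterate_eq (H : ConjugationBounds χ f h β C K L) (hχ : IsIdOrConj χ) {x : ℂ} {k : ℕ}
    (hx : ∀ i < k, K < ‖f^[i] x‖) : f^[k] (h (-χ (f^[k] x))) = h (-χ x) := by
  have hu : ∀ i, -χ (f^[i] x) = (symConj χ f)^[i] (-χ x) := fun i => by
    rw [symConj_iterate hχ, map_neg, hχ.apply_apply, neg_neg]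
  induction k with
  | zero => rfl
  | succ k ih =>
    rw [hu, Function.iterate_succ_apply (f := f), Function.iterate_succ_apply', H.semiconj, ← hu,
      ih fun i hi => hx i (by omega)]
    rw [← hu, norm_neg, hχ.norm_apply]
    exact hx k (by omega)

theorem lt_abs_im (H : ConjugationBounds χ f h β C K L) (hχ : IsIdOrConj χ) {x : ℂ}
    (hx : K + 1 + ‖β‖ < |x.im|) : K < |(h (-χ x)).im| := by
  have him : |(-χ x).im| = |x.im| := by rw [Complex.neg_im, abs_neg, hχ.abs_im_apply]
  have h1 := H.norm_sub_sub_le (-χ x) (by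
    have := Complex.abs_im_le_norm (-χ x)
    have := norm_nonneg β
    linarith)
  refine lt_abs_im_of_norm_sub_le (z := -χ x) (r := 1 + ‖β‖) ?_ (by linarith)
  have h2 := norm_add_le (h (-χ x) - (-χ x + β)) β
  rw [sub_add_eq_sub_sub, sub_add_cancel] at h2
  rw [sub_add_eq_sub_sub] at h1
  linarith

theorem small_of_im_eq (H : ConjugationBounds χ f h β C K L) {z : ℂ} (hz : K < |z.im|) (y : ℂ)
    (hy : y.im = z.im) : 4 * C * normTangent y 2 ≤ 1 := H.small y (by rwa [hy])

/-- The germ `h` exchanges the two limits. Here `h (-χ (f^[k] x))` is asymptotic to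
`-χ y + β - k` and is mapped to `h (-χ x)` by `f^[k]`, and the iterates `f^[k]` are uniformly
Lipschitz. -/
theorem isReciprocalIteratorValue (H : ConjugationBounds χ f h β C K L) (hχ : IsIdOrConj χ)
    {x y : ℂ} (hx : K + 2 + ‖β‖ < |x.im|) (hy : IsDirectIteratorValue f x y) :
    IsReciprocalIteratorValue f (-χ y + β) (h (-χ x)) := by
  have hβ := norm_nonneg β
  have hxK : K < |x.im| := by linarith
  have hiter : ∀ k, K + 1 + ‖β‖ < |(f^[k] x).im| := fun k =>
    lt_abs_im_of_norm_sub_le ((H.norm_iterate_sub_le hxK k).trans (H.small x hxK))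
      (by simpa using (by linarith : K + 1 + ‖β‖ + 1 < |x.im|))
  have hyim : K + 1 + ‖β‖ < |y.im| := lt_abs_im_of_norm_sub_le
    ((H.norm_direct_sub_le hxK hy).trans (H.small x hxK)) (by linarith)
  have hinf : Tendsto (fun k : ℕ => -χ (f^[k] x)) atTop atInfinity := by
    refine tendsto_norm_atTop_iff_cobounded.1 (tendsto_atTop_mono (fun k => ?_)
      (tendsto_natCast_atTop_atTop.atTop_add hy.norm.neg))
    have := norm_sub_norm_le (k : ℂ) (k - f^[k] x)
    rw [sub_sub_cancel, norm_sub_rev, Complex.norm_natCast] at this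
    rw [norm_neg, hχ.norm_apply]
    linarith
  have hlim : Tendsto (fun k : ℕ => h (-χ (f^[k] x)) - (-χ y + β - k)) atTop (𝓝 0) := by
    have h1 := (H.tendsto.comp hinf).sub ((hχ.continuous.tendsto _).comp hy)
    have h2 := h1.add_const (χ y - β)
    rw [sub_add_sub_cancel, sub_self] at h2
    refine h2.congr fun k => ?_
    simp only [Function.comp_apply, map_sub, map_natCast]
    ring
  have hdiff : Tendsto (fun k : ℕ => h (-χ x) - f^[k] (-χ y + β - k)) atTop (𝓝 0) := by
    refine squeeze_zero_norm (fun k => ?_)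
      (by simpa using hlim.norm.const_mul (Real.exp 1))
    rw [← H.iterate_eq hχ (k := k) fun i _ => (by
      linarith [hiter i, Complex.abs_im_le_norm (f^[i] x)])]
    refine H.norm_iterate_sub_iterate_le (H.lt_abs_im hχ (hiter k)) ?_ k
    refine lt_abs_im_of_norm_sub_le (z := -χ y - k) (r := ‖β‖) (le_of_eq (by ring_nf)) ?_
    simp only [Complex.sub_im, Complex.neg_im, Complex.natCast_im, sub_zero, abs_neg,
      hχ.abs_im_apply]
    linarith
  have h3 := hdiff.const_sub (h (-χ x))
  simp only [sub_sub_cancel, sub_zero] at h3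
  exact h3

/-- The germ `h` exchanges the two limits: `f^[k]` maps `h (-χ x)` and `h (-χ x')`, with `x'` equal
to `f^[k] (-χ z - k)` and close to `x`, to nearby points, the second of which is `h (z + k)`. -/
theorem isDirectIteratorValue (H : ConjugationBounds χ f h β C K L) (hχ : IsIdOrConj χ)
    {z x : ℂ} (hz : K + 2 + ‖β‖ < |z.im|) (hx : IsReciprocalIteratorValue f (-χ z) x) :
    IsDirectIteratorValue f (h (-χ x)) (z + β) := by
  have hβ := norm_nonneg β
  have him : |(-χ z).im| = |z.im| := by rw [Complex.neg_im, abs_neg, hχ.abs_im_apply]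
  have hzK : K < |(-χ z).im| := by linarith
  have hiter : ∀ k i : ℕ, K + 1 + ‖β‖ < |(f^[i] (-χ z - k)).im| := fun k i =>
    lt_abs_im_of_norm_sub_le
      (H.norm_iterate_sub_natCast_sub_le hzK (H.small_of_im_eq hzK) k i) (by
        simp only [Complex.add_im, Complex.sub_im, Complex.natCast_im, sub_zero, add_zero]
        linarith)
  have hxim : K + 1 + ‖β‖ < |x.im| := lt_abs_im_of_norm_sub_le
    (H.norm_reciprocal_sub_le hzK hx (H.small_of_im_eq hzK)) (by linarith)
  have hinf : Tendsto (fun k : ℕ => z + k) atTop atInfinity := by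
    refine tendsto_norm_atTop_iff_cobounded.1 (tendsto_atTop_mono (fun k => ?_)
      (tendsto_natCast_atTop_atTop.atTop_add (tendsto_const_nhds (x := -‖z‖))))
    have := norm_sub_norm_le (k : ℂ) (-z)
    rw [sub_neg_eq_add, norm_neg, Complex.norm_natCast, add_comm] at this
    linarith
  have h1 : Tendsto (fun k : ℕ => f^[k] (h (-χ x)) - h (z + k)) atTop (𝓝 0) := by
    refine squeeze_zero_norm (fun k => ?_)
      (by simpa using ((hx.sub_const x).norm.const_mul L).const_mul (Real.exp 1))
    have h2 : z + k = -χ (-χ z - k) := by simp [hχ.apply_apply, add_comm]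
    rw [h2, ← H.iterate_eq hχ (x := -χ z - k) (k := k) fun i _ => (by
      linarith [hiter k i, Complex.abs_im_le_norm (f^[i] (-χ z - k))])]
    refine (H.norm_iterate_sub_iterate_le (H.lt_abs_im hχ hxim)
      (H.lt_abs_im hχ (hiter k k)) k).trans ?_
    gcongr
    have hnorm : ∀ y : ℂ, ‖-χ y‖ = ‖y‖ := fun y => by rw [norm_neg, hχ.norm_apply]
    refine (H.norm_apply_sub_le _ _ ?_ ?_).trans_eq ?_
    · rw [hnorm]
      linarith [Complex.abs_im_le_norm x]
    · rw [hnorm]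
      linarith [hiter k k, Complex.abs_im_le_norm (f^[k] (-χ z - k))]
    · rw [norm_sub_rev _ x, ← hnorm (x - _), map_sub]
      ring_nf
  have h3 := (h1.add (H.tendsto.comp hinf)).add_const z
  rw [zero_add, add_comm β z] at h3
  refine h3.congr fun k => ?_
  simp only [Function.comp_apply]
  ring

end ConjugationBounds

/-- The functional equation of the connector that reflects a weak symmetry of `f`. -/
theorem IsConnector.eventually_eq {P : ℂ → ℂ} (hχ : IsIdOrConj χ) (hf : IsStandardDiffeo f)
    (hP : IsConnector f P) {h : ℂ → ℂ} {b : PowerSeries ℂ}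
    (H : ConjugatesToInverse h b (symConj χ f) f) : ∀ᶠ z in atVerticalInfinity,
      P (symConj χ P z + PowerSeries.coeff 0 b) = z + PowerSeries.coeff 0 b := by
  set β := PowerSeries.coeff 0 b
  obtain ⟨K₀, hK₀⟩ := eventually_atVerticalInfinity.1 hP
  obtain ⟨C, K, L, hK, B⟩ := H.exists_conjugationBounds hχ hf K₀
  refine eventually_atVerticalInfinity.2 ⟨K + 4 + ‖β‖, fun z hz => ?_⟩
  have hβ := norm_nonneg β
  have him : ∀ y : ℂ, |(-χ y).im| = |y.im| := fun y => by
    rw [Complex.neg_im, abs_neg, hχ.abs_im_apply]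
  have hzK : K < |(-χ z).im| := by rw [him]; linarith
  obtain ⟨x, hx1, hx2⟩ := hK₀ (-χ z) (by linarith)
  have hx : K + 3 + ‖β‖ < |x.im| := lt_abs_im_of_norm_sub_le
    (B.norm_reciprocal_sub_le hzK hx1 (B.small_of_im_eq hzK)) (by rw [him]; linarith)
  have hxK : K < |x.im| := by linarith
  have hy : K + 2 + ‖β‖ < |(P (-χ z)).im| := lt_abs_im_of_norm_sub_le
    ((B.norm_direct_sub_le hxK hx2).trans (B.small x hxK)) (by linarith)
  obtain ⟨x', hx1', hx2'⟩ := hK₀ (symConj χ P z + β)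
    (lt_abs_im_of_norm_sub_le (z := -χ (P (-χ z))) (r := ‖β‖) (le_of_eq (by
      rw [symConj, add_sub_cancel_left])) (by rw [him]; linarith))
  rw [tendsto_nhds_unique hx1' (B.isReciprocalIteratorValue hχ (by linarith) hx2)] at hx2'
  exact tendsto_nhds_unique hx2' (B.isDirectIteratorValue hχ (by linarith) hx1)

end IdentityTangent

namespace IdentityTangent

/-! ### Conservation of the symmetries by the connector -/

variable {f : ℂ → ℂ} {χ : ℂ →+* ℂ}

theorem tendsto_atVerticalInfinity_of_sub {w : ℂ → ℂ} {l : ℂ}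
    (h : Tendsto (fun z => w z - z) atVerticalInfinity (𝓝 l)) :
    Tendsto w atVerticalInfinity atVerticalInfinity := by
  refine tendsto_comap_iff.2 (tendsto_atTop_mono (fun z => ?_) (tendsto_comap.atTop_add h.norm.neg))
  have h1 := Complex.abs_im_le_norm (w z - z)
  rw [Complex.sub_im, abs_sub_comm] at h1
  have := abs_sub_abs_le_abs_sub z.im (w z).im
  simp only [Function.comp_apply]
  linarith

theorem tendsto_add_const_atVerticalInfinity (c : ℂ) :
    Tendsto (· + c) atVerticalInfinity atVerticalInfinity :=
  tendsto_atVerticalInfinity_of_sub (l := c) (by simpa using tendsto_const_nhds)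

theorem IsIdOrConj.tendsto_neg_atVerticalInfinity (hχ : IsIdOrConj χ) :
    Tendsto (fun z => -χ z) atVerticalInfinity atVerticalInfinity := by
  refine tendsto_comap_iff.2 (tendsto_comap.congr fun z => ?_)
  rw [Function.comp_apply, Complex.neg_im, abs_neg, hχ.abs_im_apply]

theorem isInverseAlong_symConj (hχ : IsIdOrConj χ) {Q : ℂ → ℂ}
    (h : ∀ᶠ z in atVerticalInfinity, Q (symConj χ Q z) = z) :
    IsInverseAlong atVerticalInfinity Q (symConj χ Q) := by
  refine ⟨h, ?_⟩
  filter_upwards [hχ.tendsto_neg_atVerticalInfinity.eventually h] with z hz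
  rw [symConj, map_neg, hχ.apply_apply, neg_neg] at hz
  rw [symConj, hz, map_neg, hχ.apply_apply, neg_neg]

/-- The two forms of the functional equation of `P`, the given one and its mirror image, combine to
the equivariance of `P` under a translation. -/
theorem eventually_add_of_symConj (hχ : IsIdOrConj χ) {P : ℂ → ℂ} {β : ℂ}
    (hP : Tendsto (fun z => P z - z) atVerticalInfinity (𝓝 0))
    (h : ∀ᶠ z in atVerticalInfinity, P (symConj χ P z + β) = z + β) :
    ∀ᶠ z in atVerticalInfinity, P (z + (β - χ β)) = P z + (β - χ β) := by
  have hP' := tendsto_atVerticalInfinity_of_sub hP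
  filter_upwards [hχ.tendsto_neg_atVerticalInfinity.eventually h,
    ((tendsto_add_const_atVerticalInfinity (-χ β)).comp hP').eventually h] with z h1 h2
  simp only [Function.comp_apply, symConj, map_add, map_neg, hχ.apply_apply, neg_add, neg_neg]
    at h1 h2
  rw [h1, map_add, map_neg, hχ.apply_apply] at h2
  rw [show z + (β - χ β) = -(-z + χ β) + β by ring, h2]
  ring

/-- A germ at `±i∞` that is asymptotic to the identity and equivariant under a translation in a
non-horizontal direction is the identity. -/
theorem eventually_eq_self_of_add {P : ℂ → ℂ} {c : ℂ} (hc : c.im ≠ 0)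
    (hP : Tendsto (fun z => P z - z) atVerticalInfinity (𝓝 0))
    (h : ∀ᶠ z in atVerticalInfinity, P (z + c) = P z + c) :
    ∀ᶠ z in atVerticalInfinity, P z = z := by
  -- If `Im e` has the sign of `Im z`, then `z + n * e` tends to `±i∞`, while `P - id` keeps its
  -- value along this sequence.
  have key : ∀ (K : ℝ) (e : ℂ), e.im ≠ 0 → (∀ z, K < |z.im| → P (z + e) = P z + e) →
      ∀ z, K < |z.im| → 0 ≤ z.im ∧ 0 ≤ e.im ∨ z.im ≤ 0 ∧ e.im ≤ 0 → P z = z := by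
    intro K e he hK z hz hze
    have him : ∀ n : ℕ, |(z + n * e).im| = |z.im| + n * |e.im| := by
      intro n
      have h1 : (z + n * e).im = z.im + n * e.im := by simp
      rw [h1, (abs_add_eq_add_abs_iff _ _).2, abs_mul, Nat.abs_cast]
      have hn : (0 : ℝ) ≤ n := n.cast_nonneg
      exact hze.imp (fun h => ⟨h.1, mul_nonneg hn h.2⟩)
        fun h => ⟨h.1, mul_nonpos_of_nonneg_of_nonpos hn h.2⟩
    have hiter : ∀ n : ℕ, P (z + n * e) - (z + n * e) = P z - z := by
      intro n
      induction n with
      | zero => simp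
      | succ n ih =>
        have h1 := hK (z + n * e) (by
          rw [him]
          have : 0 ≤ n * |e.im| := by positivity
          linarith)
        rw [show z + ((n + 1 : ℕ) : ℂ) * e = z + n * e + e by push_cast; ring, h1, ← ih]
        ring
    have hlim : Tendsto (fun n : ℕ => z + n * e) atTop atVerticalInfinity := by
      refine tendsto_comap_iff.2 (Tendsto.congr (fun n => (him n).symm) ?_)
      exact tendsto_atTop_add_const_left _ _
        (tendsto_natCast_atTop_atTop.atTop_mul_const (abs_pos.2 he))
    have h1 := (hP.comp hlim).congr (f₂ := fun _ => P z - z) hiter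
    exact sub_eq_zero.1 (tendsto_nhds_unique tendsto_const_nhds h1)
  obtain ⟨K, hK⟩ := eventually_atVerticalInfinity.1 h
  have h2 := (tendsto_add_const_atVerticalInfinity (-c)).eventually h
  obtain ⟨K', hK'⟩ := eventually_atVerticalInfinity.1 h2
  refine eventually_atVerticalInfinity.2 ⟨max K K', fun z hz => ?_⟩
  have hz1 : K < |z.im| := (le_max_left _ _).trans_lt hz
  have hz2 : K' < |z.im| := (le_max_right _ _).trans_lt hz
  have hneg : ∀ z, K' < |z.im| → P (z + -c) = P z + -c := fun z hz => by
    have := hK' z hz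
    rw [neg_add_cancel_right] at this
    rw [this]
    ring
  have hc' : (-c).im ≠ 0 := by simpa using hc
  rcases le_total 0 z.im with h0 | h0 <;> rcases le_total 0 c.im with h1 | h1
  · exact key K c hc hK z hz1 (Or.inl ⟨h0, h1⟩)
  · exact key K' (-c) hc' hneg z hz2 (Or.inl ⟨h0, by simpa using h1⟩)
  · exact key K' (-c) hc' hneg z hz2 (Or.inr ⟨h0, by simpa using h1⟩)
  · exact key K c hc hK z hz1 (Or.inr ⟨h0, h1⟩)

/-- A weak symmetry of `f` through a germ `h z = z + β + O(z⁻¹)` becomes a strict symmetry of the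
connector conjugated by the translation by `β / 2`. -/
theorem IsConnector.isInverseAlong_shiftConj {P : ℂ → ℂ} (hχ : IsIdOrConj χ)
    (hf : IsStandardDiffeo f) (hP : IsConnector f P) {h : ℂ → ℂ} {b : PowerSeries ℂ}
    (H : ConjugatesToInverse h b (symConj χ f) f) :
    IsInverseAlong atVerticalInfinity (shiftConj (-(PowerSeries.coeff 0 b) / 2) P)
      (symConj χ (shiftConj (-(PowerSeries.coeff 0 b) / 2) P)) := by
  have hsym := hP.eventually_eq hχ hf H
  have hlim := hP.tendsto_sub hf
  set β := PowerSeries.coeff 0 b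
  refine isInverseAlong_symConj hχ ?_
  -- If `χ β = β`, the two half-shifts add up to `β`. Otherwise `β - χ β` is purely imaginary and
  -- nonzero, and the equivariance under it leaves only the trivial connector.
  by_cases hc : β - χ β = 0
  · have hβ : χ β = β := (sub_eq_zero.1 hc).symm
    filter_upwards [(tendsto_add_const_atVerticalInfinity (-(β / 2))).eventually hsym] with z hz
    simp only [symConj, map_add, map_neg, map_div₀, hβ, map_ofNat] at hz
    simp only [symConj, shiftConj, map_add, map_neg, map_div₀, hβ, map_ofNat]
    rw [show -χ z - -β / 2 = -(χ z + -(β / 2)) by ring,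
      show ∀ y, -(χ y + -β / 2) - -β / 2 = -χ y + β from fun y => by ring, hz]
    ring
  · have him : (β - χ β).im ≠ 0 := by
      rcases hχ with rfl | rfl
      · simp at hc
      · intro h0
        exact hc (Complex.ext (by simp) (by simpa using h0))
    have hid := eventually_eq_self_of_add him hlim (eventually_add_of_symConj hχ hlim hsym)
    have hid' : ∀ᶠ z in atVerticalInfinity, shiftConj (-β / 2) P z = z := by
      filter_upwards [(tendsto_add_const_atVerticalInfinity (-(-β / 2))).eventually hid] with z hz
      rw [shiftConj, sub_eq_add_neg, hz]
      ring
    filter_upwards [hid', hχ.tendsto_neg_atVerticalInfinity.eventually hid'] with z h1 h2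
    rw [symConj, h2, map_neg, hχ.apply_apply, neg_neg, h1]

/-- A symmetry of `f` is a weak symmetry through the identity. -/
theorem conjugatesToInverse_id (h : IsInverseAlong atInfinity f (symConj χ f)) :
    ConjugatesToInverse id 0 (symConj χ f) f :=
  ⟨⟨1, one_ne_zero, 0, fun z _ => by simp⟩, symConj χ f, h,
    Eventually.of_forall fun _ => rfl⟩

theorem IsConnector.isInverseAlong {P : ℂ → ℂ} (hχ : IsIdOrConj χ) (hf : IsStandardDiffeo f)
    (hP : IsConnector f P) (h : IsInverseAlong atInfinity f (symConj χ f)) :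
    IsInverseAlong atVerticalInfinity P (symConj χ P) := by
  have h1 := hP.isInverseAlong_shiftConj hχ hf (conjugatesToInverse_id h)
  have h2 : shiftConj (-(PowerSeries.coeff 0 (0 : PowerSeries ℂ)) / 2) P = P := by
    ext z
    simp [shiftConj]
  rwa [h2] at h1

/-- Conservation of a symmetry at every step of the expansion of the infinitesimal collector. -/
theorem IsStandardDiffeo.hasParity_collector (hχ : IsIdOrConj χ) (hf : IsStandardDiffeo f)
    {v : PowerSeries ℂ} (hv : IsGenerator (symmetricFactor f) v)
    (h : IsInverseAlong atInfinity f (symConj χ f)) :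
    (HasParitySeq χ fun d => PowerSeries.coeff d v) ∧
      (∀ (r : ℕ) (d l : Fin r → ℕ), HasParityFun χ (collectorTerm v d l)) ∧
      (∀ w : ℕ, HasParityFun χ (collectorPart v w)) ∧
      (∀ (w : ℕ) (p : Polynomial ℂ), IsMonotangentReduction (collectorPart v w) p →
        HasParitySeq χ p.coeff) := by
  have h1 := hf.coeff_one_generator hv
  have hpar := hv.hasParitySeq hχ (eventually_symmetricFactor_symConj h.1)
  have hpart := hasParityFun_collectorPart hv.1 h1 hχ hpar
  exact ⟨hpar, fun r d l => hasParityFun_collectorTerm hv.1 h1 hχ hpar d l, hpart,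
    fun w p hp => hasParitySeq_of_isMonotangentReduction hχ (hpart w) hp⟩

end IdentityTangent

theorem mainTheorem6 (f : ℂ → ℂ) (hf : IsStandardDiffeo f) :
    -- the connector exists
    (∃ P : ℂ → ℂ, IsConnector f P) ∧
    -- conservation of reflexivity and counitariness, strict and weak
    (∀ P : ℂ → ℂ, IsConnector f P →
      (IsReflexive atInfinity f → IsReflexive atVerticalInfinity P) ∧
      (IsCounitary atInfinity f → IsCounitary atVerticalInfinity P) ∧
      (∀ (h : ℂ → ℂ) (b : PowerSeries ℂ), IsWeaklyReflexiveVia h b f →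
        IsReflexive atVerticalInfinity (shiftConj (-(PowerSeries.coeff 0 b) / 2) P)) ∧
      (∀ (h : ℂ → ℂ) (b : PowerSeries ℂ), IsWeaklyCounitaryVia h b f →
        IsCounitary atVerticalInfinity (shiftConj (-(PowerSeries.coeff 0 b) / 2) P))) ∧
    -- the factor `g` has one infinitesimal generator
    (∃! v : PowerSeries ℂ, IsGenerator (symmetricFactor f) v) ∧
    -- conservation at every step of the expansion of the infinitesimal collector
    (∀ v : PowerSeries ℂ, IsGenerator (symmetricFactor f) v →
      (∀ w : ℕ, ∃! p : Polynomial ℂ, IsMonotangentReduction (collectorPart v w) p) ∧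
      (IsReflexive atInfinity f →
        IsEvenSeq (fun d => PowerSeries.coeff d v) ∧
        (∀ (r : ℕ) (d l : Fin r → ℕ), IsEvenFun (collectorTerm v d l)) ∧
        (∀ w : ℕ, IsEvenFun (collectorPart v w)) ∧
        (∀ (w : ℕ) (p : Polynomial ℂ), IsMonotangentReduction (collectorPart v w) p →
          IsEvenSeq p.coeff)) ∧
      (IsCounitary atInfinity f →
        IsCoevenSeq (fun d => PowerSeries.coeff d v) ∧
        (∀ (r : ℕ) (d l : Fin r → ℕ), IsCoevenFun (collectorTerm v d l)) ∧
        (∀ w : ℕ, IsCoevenFun (collectorPart v w)) ∧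
        (∀ (w : ℕ) (p : Polynomial ℂ), IsMonotangentReduction (collectorPart v w) p →
          IsCoevenSeq p.coeff))) := by
  have hid : IsIdOrConj (RingHom.id ℂ) := Or.inl rfl
  have hconj : IsIdOrConj (starRingEnd ℂ) := Or.inr rfl
  refine ⟨hf.exists_isConnector, fun P hP => ⟨fun h => hP.isInverseAlong hid hf h,
    fun h => hP.isInverseAlong hconj hf h, fun h b H => hP.isInverseAlong_shiftConj hid hf H,
    fun h b H => hP.isInverseAlong_shiftConj hconj hf H⟩, hf.existsUnique_isGenerator,
    fun v hv => ⟨fun w => existsUnique_isMonotangentReduction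
      (isTangential_collectorPart hv.1 (hf.coeff_one_generator hv) w), fun h => ?_, fun h => ?_⟩⟩
  · obtain ⟨h1, h2, h3, h4⟩ := hf.hasParity_collector hid hv h
    exact ⟨hasParitySeq_id_iff.1 h1, fun r d l => hasParityFun_id_iff.1 (h2 r d l),
      fun w => hasParityFun_id_iff.1 (h3 w), fun w p hp => hasParitySeq_id_iff.1 (h4 w p hp)⟩
  · obtain ⟨h1, h2, h3, h4⟩ := hf.hasParity_collector hconj hv h
    exact ⟨hasParitySeq_conj_iff.1 h1, fun r d l => hasParityFun_conj_iff.1 (h2 r d l),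
      fun w => hasParityFun_conj_iff.1 (h3 w), fun w p hp => hasParitySeq_conj_iff.1 (h4 w p hp)⟩
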